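/- Let $D\subset\mathbb{R}^4$ be a non-empty connected open set with coordinates $(\tau,\phi,p,q)$ on which $p\neq q$ and $1-p^2q^2>0$, oriented by $d\tau\wedge d\phi\wedge dp\wedge dq$. Let $P=P(p)$ and $Q=Q(q)$ be smooth functions with $P>0$ and $Q<0$ over $D$, and consider the Plebański–Demiański metric $$g=\frac{1}{(p-q)^2}\left[-Q\frac{(d\tau-p^2d\phi)^2}{1-p^2q^2}+P\frac{(d\phi-q^2d\tau)^2}{1-p^2q^2}+(1-p^2q^2)\left(\frac{dp^2}{P}-\frac{dq^2}{Q}\right)\right].$$ (1) $g$ is conformally self-dual on $D$, i.e. its Weyl tensor satisfies $*C=C$, if and only if there are real constants $a_0,\dots,a_4$ such that, over $D$, $$P=a_0+a_1p+a_2p^2+a_3p^3+a_4p^4,\qquad Q=a_4+a_3q+a_2q^2+a_1q^3+a_0q^4.$$ (2) If $P$ and $Q$ are of this form, then on $D$: (i) $g$ is quaternionic-Kähler (in dimension four: Einstein and conformally half-flat) iff $g$ is Einstein, $\mathrm{Ric}=\lambda g$ with $\lambda$ constant, iff $a_1=a_3$; (ii) $g$ is hyper-Kähler (it admits three orthogonal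 almost complex structures $I,J,K=IJ$, parallel for the Levi-Civita connection) iff $g$ is Ricci-flat iff $a_1=a_3$ and $a_0=a_4$; (iii) $g$ is flat iff $a_1=a_3=0$ and $a_0=a_4$. (3) The solutions are generically non-Einstein: for every point $x\in D$, with coordinates $p_0,q_0$, the set of $(a_0,\dots,a_4)\in\mathbb{R}^5$ for which the quartics of (1) satisfy $P(p_0)>0$ and $Q(q_0)<0$ is open and non-empty, and those of its elements for which the corresponding metric is Einstein on some neighbourhood of $x$ form a nowhere dense set. -/

import Mathlib

open scoped ContDiff Matrix

noncomputable section

namespace PD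

/-- Points of a coordinate chart of a 4-manifold. -/
abbrev R4 : Type := Fin 4 → ℝ

/-- A metric in coordinates: the matrix of components `g_{ab}` at each point. -/
abbrev MetricField : Type := R4 → Matrix (Fin 4) (Fin 4) ℝ

/-- The coordinate partial derivative `∂_a f`. -/
def pd (a : Fin 4) (f : R4 → ℝ) (x : R4) : ℝ := fderiv ℝ f x (Pi.single a 1)

/-! ## Curvature of a metric in coordinates -/

/-- Christoffel symbols of the Levi-Civita connection, `christoffel g c a b x = Γ^c_{ab}(x)`. -/
def christoffel (g : MetricField) (c a b : Fin 4) (x : R4) : ℝ :=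
  (1 / 2) * ∑ d, (g x)⁻¹ c d *
    (pd a (fun y => g y b d) x + pd b (fun y => g y a d) x - pd d (fun y => g y a b) x)

/-- The curvature tensor `R^a_{bcd} = ∂_c Γ^a_{db} - ∂_d Γ^a_{cb} + Γ^a_{ce} Γ^e_{db}
- Γ^a_{de} Γ^e_{cb}`. -/
def riemannUp (g : MetricField) (a b c d : Fin 4) (x : R4) : ℝ :=
  pd c (christoffel g a d b) x - pd d (christoffel g a c b) x
    + ∑ e, (christoffel g a c e x * christoffel g e d b x
      - christoffel g a d e x * christoffel g e c b x)

/-- The curvature tensor with all indices lowered, `R_{abcd} = g_{ae} R^e_{bcd}`. -/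
def riemann (g : MetricField) (a b c d : Fin 4) (x : R4) : ℝ :=
  ∑ e, g x a e * riemannUp g e b c d x

/-- The Ricci tensor `R_{ab} = R^c_{acb}`. -/
def ricci (g : MetricField) (a b : Fin 4) (x : R4) : ℝ := ∑ c, riemannUp g c a c b x

/-- The scalar curvature `R = g^{ab} R_{ab}`. -/
def scalar (g : MetricField) (x : R4) : ℝ := ∑ a, ∑ b, (g x)⁻¹ a b * ricci g a b x

/-- The Weyl tensor `C_{abcd}` in dimension four. -/
def weyl (g : MetricField) (a b c d : Fin 4) (x : R4) : ℝ :=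
  riemann g a b c d x
    - (1 / 2) * (g x a c * ricci g b d x - g x a d * ricci g b c x
      - g x b c * ricci g a d x + g x b d * ricci g a c x)
    + (scalar g x / 6) * (g x a c * g x b d - g x a d * g x b c)

/-- The Levi-Civita symbol: the sign of `(a, b, c, d)` as a permutation of `(0, 1, 2, 3)`, and `0`
if two of the indices agree. -/
def leviCivita (a b c d : Fin 4) : ℝ :=
  Matrix.det (Matrix.of fun i j : Fin 4 => if ![a, b, c, d] i = j then (1 : ℝ) else 0)

/-- The Riemannian volume form `ε_{abcd}` for the orientation in which the coordinates
`(x⁰, x¹, x², x³)` are positively oriented. -/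
def volForm (g : MetricField) (a b c d : Fin 4) (x : R4) : ℝ :=
  Real.sqrt (g x).det * leviCivita a b c d

/-- The Hodge dual of the Weyl tensor, `(*C)_{abcd} = ½ ε_{abmn} g^{me} g^{nf} C_{efcd}`. -/
def hodgeWeyl (g : MetricField) (a b c d : Fin 4) (x : R4) : ℝ :=
  (1 / 2) * ∑ m, ∑ n, ∑ e, ∑ f,
    volForm g a b m n x * (g x)⁻¹ m e * (g x)⁻¹ n f * weyl g e f c d x

/-! ## Field equations and special geometries on a domain -/

/-- `*C = C` on `D`. -/
def IsConformallySelfDual (D : Set R4) (g : MetricField) : Prop :=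
  ∀ x ∈ D, ∀ a b c d, hodgeWeyl g a b c d x = weyl g a b c d x

/-- `*C = -C` on `D`. -/
def IsConformallyAntiSelfDual (D : Set R4) (g : MetricField) : Prop :=
  ∀ x ∈ D, ∀ a b c d, hodgeWeyl g a b c d x = -weyl g a b c d x

/-- `R_{ab} = λ g_{ab}` on `D` for some constant `λ`. -/
def IsEinstein (D : Set R4) (g : MetricField) : Prop :=
  ∃ lam : ℝ, ∀ x ∈ D, ∀ a b, ricci g a b x = lam * g x a b

/-- `R_{ab} = 0` on `D`. -/
def IsRicciFlat (D : Set R4) (g : MetricField) : Prop :=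
  ∀ x ∈ D, ∀ a b, ricci g a b x = 0

/-- The Riemann tensor vanishes on `D`. -/
def IsFlat (D : Set R4) (g : MetricField) : Prop :=
  ∀ x ∈ D, ∀ a b c d, riemann g a b c d x = 0

/-- Quaternionic-Kähler in dimension four, where the holonomy condition is void and the usual
definition is: Einstein and conformally half-flat. -/
def IsQuaternionicKahler (D : Set R4) (g : MetricField) : Prop :=
  IsEinstein D g ∧ (IsConformallySelfDual D g ∨ IsConformallyAntiSelfDual D g)

/-- The covariant derivative `∇_a J^b_c` of a field of endomorphisms, where `J x b c = J^b_c(x)`. -/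
def covDerivEnd (g : MetricField) (J : R4 → Matrix (Fin 4) (Fin 4) ℝ) (a b c : Fin 4) (x : R4) : ℝ :=
  pd a (fun y => J y b c) x
    + ∑ d, (christoffel g b a d x * J x d c - christoffel g d a c x * J x b d)

/-- `J` is a Kähler structure for `g` on `D`: a smooth almost complex structure on `D` that is
orthogonal for `g` and parallel for the Levi-Civita connection. -/
structure IsKahlerStructure (D : Set R4) (g : MetricField)
    (J : R4 → Matrix (Fin 4) (Fin 4) ℝ) : Prop where
  smooth : ∀ a b, ContDiffOn ℝ ∞ (fun x => J x a b) D
  sq : ∀ x ∈ D, J x * J x = -1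
  orthogonal : ∀ x ∈ D, (J x)ᵀ * g x * J x = g x
  parallel : ∀ x ∈ D, ∀ a b c, covDerivEnd g J a b c x = 0

/-- `g` is hyper-Kähler on `D`: there are three Kähler structures `I`, `J`, `K` with `I J = K`
(they then satisfy the quaternion relations). -/
def IsHyperKahler (D : Set R4) (g : MetricField) : Prop :=
  ∃ I J K : R4 → Matrix (Fin 4) (Fin 4) ℝ,
    IsKahlerStructure D g I ∧ IsKahlerStructure D g J ∧ IsKahlerStructure D g K ∧
      ∀ x ∈ D, I x * J x = K x

/-! ## The Plebański–Demiański ansatz, in coordinates `x = (τ, φ, p, q)` -/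

/-- The components of the 1-form `dτ - p² dφ`. -/
def thetaTau (x : R4) : R4 := ![1, -(x 2) ^ 2, 0, 0]

/-- The components of the 1-form `dφ - q² dτ`. -/
def thetaPhi (x : R4) : R4 := ![-(x 3) ^ 2, 1, 0, 0]

/-- The components of `dp`. -/
def dp : R4 := ![0, 0, 1, 0]

/-- The components of `dq`. -/
def dq : R4 := ![0, 0, 0, 1]

/-- The Plebański–Demiański metric
`(p-q)⁻² [ -Q (dτ - p² dφ)² / (1-p²q²) + P (dφ - q² dτ)² / (1-p²q²)
  + (1-p²q²) (dp²/P - dq²/Q) ]`. -/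
def metric (P Q : ℝ → ℝ) : MetricField := fun x =>
  let p := x 2
  let q := x 3
  let s := 1 - p ^ 2 * q ^ 2
  (1 / (p - q) ^ 2) •
    ((-Q q / s) • Matrix.vecMulVec (thetaTau x) (thetaTau x)
      + (P p / s) • Matrix.vecMulVec (thetaPhi x) (thetaPhi x)
      + s • ((1 / P p) • Matrix.vecMulVec dp dp - (1 / Q q) • Matrix.vecMulVec dq dq))

/-- `D` is a connected coordinate domain on which `p ≠ q` and `1 - p²q² > 0`. -/
structure IsChartDomain (D : Set R4) : Prop where
  isOpen : IsOpen D
  isConnected : IsConnected D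
  ne : ∀ x ∈ D, x 2 ≠ x 3
  pos : ∀ x ∈ D, 0 < 1 - (x 2) ^ 2 * (x 3) ^ 2

/-- `P(p)` and `Q(q)` are smooth functions with `P > 0` and `Q < 0`, over the values that the
coordinates `p` and `q` take on `D`. -/
structure IsAdmissible (D : Set R4) (P Q : ℝ → ℝ) : Prop where
  smooth_P : ∀ x ∈ D, ContDiffAt ℝ ∞ P (x 2)
  smooth_Q : ∀ x ∈ D, ContDiffAt ℝ ∞ Q (x 3)
  P_pos : ∀ x ∈ D, 0 < P (x 2)
  Q_neg : ∀ x ∈ D, Q (x 3) < 0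

/-- The quartic `a₀ + a₁ p + a₂ p² + a₃ p³ + a₄ p⁴`. -/
def quarticP (a : Fin 5 → ℝ) (p : ℝ) : ℝ :=
  a 0 + a 1 * p + a 2 * p ^ 2 + a 3 * p ^ 3 + a 4 * p ^ 4

/-- The quartic with reversed coefficients, `a₄ + a₃ q + a₂ q² + a₁ q³ + a₀ q⁴`. -/
def quarticQ (a : Fin 5 → ℝ) (q : ℝ) : ℝ :=
  a 4 + a 3 * q + a 2 * q ^ 2 + a 1 * q ^ 3 + a 0 * q ^ 4

/-- On `D`, the functions `P` and `Q` are the quartics with coefficients `a`. -/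
def IsQuarticPair (D : Set R4) (P Q : ℝ → ℝ) (a : Fin 5 → ℝ) : Prop :=
  ∀ x ∈ D, P (x 2) = quarticP a (x 2) ∧ Q (x 3) = quarticQ a (x 3)

/-- The coefficient vectors for which `P > 0` and `Q < 0` at the point `x`, hence near `x`. -/
def paramsAt (x : R4) : Set (Fin 5 → ℝ) :=
  {a | 0 < quarticP a (x 2) ∧ quarticQ a (x 3) < 0}

/-- The coefficient vectors for which, moreover, the metric is Einstein near `x`. -/
def einsteinParamsAt (x : R4) : Set (Fin 5 → ℝ) :=
  {a | a ∈ paramsAt x ∧ ∃ U : Set R4, IsOpen U ∧ x ∈ U ∧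
    IsEinstein U (metric (quarticP a) (quarticQ a))}

end PD

end

open scoped ContDiff Matrix

noncomputable section

namespace PD

/-! Take the orthonormal coframe with e⁰ along dτ - p²dφ, e¹ along dφ - q²dτ, e² along dp and e³
along dq. Its Levi-Civita connection form has values in 𝔰𝔬(4) = 𝔰𝔬(3) ⊕ 𝔰𝔬(3), and each half is an
explicit triple of 1-forms (`connVal`, with ε = -1 or 1). By Cartan's structure equations the
curvature is of type D for arbitrary P and Q: it has eigenvalues X, X, Z on anti-self-dual forms and
X', X', Z' on self-dual forms, the trace-free Ricci tensor is a single function Y, and 2X + Z = 2X'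
+ Z' by the first Bianchi identity. Therefore the Weyl tensor is self-dual iff X = Z, Ric = r g iff
Y = 0 and 2X + Z = r, and the metric is flat iff all five functions vanish. `IsCoframe` carries the
passage between coordinate tensors and frame components; `torsion_val`, `spinCurvVal_asd` and
`spinCurvVal_sd` are the structure equations.

Part (1): X - Z is a nonvanishing multiple of an expression `weylExpr` of second order and linear in
P and Q. Three p-derivatives at fixed q remove everything except (1 - pq)² P⁗', so P is a quartic on
the interval of values of p. With this P the equation is a quadratic polynomial in p, and its three
coefficients determine Q'', Q' and Q at each q: Q is the reversed quartic, with no equation left to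
integrate.

Part (2): on the quartics X = Z = (a₄ - a₀) + (a₃ - a₁)(p + q)/(2(1 + pq)), and Y is a₃ - a₁ times a
nonvanishing function. If a₁ = a₃ then X' = (a₄ - a₀) + a₁((p - q)/(1 + pq))³. The Einstein,
Ricci-flat and flat criteria can be read off.

A hyper-Kähler structure makes one half of the curvature vanish, because that half both commutes
with K and is orthogonal to it; together with the Bianchi identity this gives Ric = 0. Conversely,
if a₁ = a₃ and a₀ = a₄, the connection on anti-self-dual forms is flat. Since D need not be simply
connected, this alone does not give global parallel sections. They are written explicitly: one is
the normalized dφ-component of the connection itself, and the others rotate about it through the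
angle k(φ - τ), a function defined on all of D.

Part (3): Einstein parameters lie in the hyperplane a₁ = a₃. -/

/-! ## Matrix-valued partial derivatives -/

/-- The matrix of coordinate partial derivatives of the entries of a matrix field. -/
def pdM (a : Fin 4) (A : R4 → Matrix (Fin 4) (Fin 4) ℝ) (x : R4) : Matrix (Fin 4) (Fin 4) ℝ :=
  Matrix.of fun i j => pd a (fun y => A y i j) x

/-- All entries of a matrix field are differentiable at `x`. -/
def DiffM (A : R4 → Matrix (Fin 4) (Fin 4) ℝ) (x : R4) : Prop :=
  ∀ i j, DifferentiableAt ℝ (fun y => A y i j) x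

theorem pdM_apply (a : Fin 4) (A : R4 → Matrix (Fin 4) (Fin 4) ℝ) (x : R4) (i j : Fin 4) :
    pdM a A x i j = pd a (fun y => A y i j) x := rfl

theorem pd_congr {f g : R4 → ℝ} {x : R4} (h : f =ᶠ[nhds x] g) (a : Fin 4) :
    pd a f x = pd a g x := by
  unfold pd; rw [h.fderiv_eq]

theorem pdM_congr {A B : R4 → Matrix (Fin 4) (Fin 4) ℝ} {x : R4} (h : A =ᶠ[nhds x] B)
    (a : Fin 4) : pdM a A x = pdM a B x := by
  ext i j
  exact pd_congr (h.mono fun y hy => by simp only [hy]) a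

theorem pd_add {f g : R4 → ℝ} {x : R4} (hf : DifferentiableAt ℝ f x)
    (hg : DifferentiableAt ℝ g x) (a : Fin 4) :
    pd a (fun y => f y + g y) x = pd a f x + pd a g x := by
  unfold pd; rw [fderiv_fun_add hf hg]; rfl

theorem pd_mul {f g : R4 → ℝ} {x : R4} (hf : DifferentiableAt ℝ f x)
    (hg : DifferentiableAt ℝ g x) (a : Fin 4) :
    pd a (fun y => f y * g y) x = f x * pd a g x + pd a f x * g x := by
  unfold pd; rw [fderiv_fun_mul hf hg]
  simp [mul_comm]

theorem pd_sum {ι : Type*} {s : Finset ι} {f : ι → R4 → ℝ} {x : R4}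
    (hf : ∀ i ∈ s, DifferentiableAt ℝ (f i) x) (a : Fin 4) :
    pd a (fun y => ∑ i ∈ s, f i y) x = ∑ i ∈ s, pd a (f i) x := by
  unfold pd; rw [fderiv_fun_sum hf]; simp

variable {A B : R4 → Matrix (Fin 4) (Fin 4) ℝ} {x : R4}

theorem DiffM.mul (hA : DiffM A x) (hB : DiffM B x) : DiffM (fun y => A y * B y) x := by
  intro i j
  simp only [Matrix.mul_apply]
  exact DifferentiableAt.fun_sum fun k _ => (hA i k).mul (hB k j)

theorem DiffM.add (hA : DiffM A x) (hB : DiffM B x) : DiffM (fun y => A y + B y) x :=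
  fun i j => (hA i j).add (hB i j)

theorem DiffM.transpose (hA : DiffM A x) : DiffM (fun y => (A y)ᵀ) x :=
  fun i j => hA j i

theorem DiffM.congr (hA : DiffM A x) (h : B =ᶠ[nhds x] A) : DiffM B x :=
  fun i j => (hA i j).congr_of_eventuallyEq (h.mono fun y hy => by simp only [hy])

theorem pdM_mul (hA : DiffM A x) (hB : DiffM B x) (a : Fin 4) :
    pdM a (fun y => A y * B y) x = A x * pdM a B x + pdM a A x * B x := by
  ext i j
  simp only [pdM_apply, Matrix.mul_apply, Matrix.add_apply]
  rw [pd_sum (f := fun k y => A y i k * B y k j) fun k _ => (hA i k).mul (hB k j),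
    ← Finset.sum_add_distrib]
  exact Finset.sum_congr rfl fun k _ => pd_mul (hA i k) (hB k j) a

theorem pdM_add (hA : DiffM A x) (hB : DiffM B x) (a : Fin 4) :
    pdM a (fun y => A y + B y) x = pdM a A x + pdM a B x := by
  ext i j
  exact pd_add (hA i j) (hB i j) a

theorem pdM_sub (hA : DiffM A x) (hB : DiffM B x) (a : Fin 4) :
    pdM a (fun y => A y - B y) x = pdM a A x - pdM a B x := by
  ext i j
  simp only [pdM_apply, pd, Matrix.sub_apply]
  rw [fderiv_fun_sub (hA i j) (hB i j)]; rfl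

theorem pdM_transpose (a : Fin 4) : pdM a (fun y => (A y)ᵀ) x = (pdM a A x)ᵀ := rfl

theorem DiffM.det (hA : DiffM A x) : DifferentiableAt ℝ (fun y => (A y).det) x := by
  simp only [Matrix.det_apply']
  refine DifferentiableAt.fun_sum fun σ _ => (differentiableAt_const _).mul ?_
  exact (HasFDerivAt.finsetProd (g := fun i y => A y (σ i) i)
    fun i _ => (hA (σ i) i).hasFDerivAt).differentiableAt

theorem DiffM.inv (hA : DiffM A x) (h : (A x).det ≠ 0) : DiffM (fun y => (A y)⁻¹) x := by
  intro i j
  simp only [Matrix.inv_def, Matrix.smul_apply, smul_eq_mul, Ring.inverse_eq_inv',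
    Matrix.adjugate_apply]
  refine (hA.det.inv h).mul (DiffM.det (A := fun y => (A y).updateRow j (Pi.single i 1)) ?_)
  intro k l
  by_cases hk : k = j
  · subst hk
    simp only [Matrix.updateRow_self]
    exact differentiableAt_const _
  · simp only [Matrix.updateRow_ne hk]
    exact hA k l

/-- Coordinate second derivatives of a `C²` function commute. -/
theorem pd_comm {f : R4 → ℝ} (hf : ContDiffAt ℝ 2 f x) (a b : Fin 4) :
    pd a (pd b f) x = pd b (pd a f) x := by
  have hd : DifferentiableAt ℝ (fderiv ℝ f) x :=
    (hf.fderiv_right (m := 1) (by norm_num)).differentiableAt (by norm_num)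
  have key : ∀ c d : Fin 4, pd c (pd d f) x
      = fderiv ℝ (fderiv ℝ f) x (Pi.single c 1) (Pi.single d 1) := by
    intro c d
    change fderiv ℝ (fun y => fderiv ℝ f y (Pi.single d 1)) x (Pi.single c 1) = _
    rw [fderiv_clm_apply hd (differentiableAt_const _)]
    simp
  rw [key, key]
  exact (hf.isSymmSndFDerivAt (by simp)).eq _ _

theorem differentiableAt_pd {f : R4 → ℝ} (hf : ContDiffAt ℝ 2 f x) (a : Fin 4) :
    DifferentiableAt ℝ (pd a f) x :=
  ((hf.fderiv_right (m := 1) (by norm_num)).differentiableAt (by norm_num)).clm_apply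
    (differentiableAt_const _)

/-! ## Orthonormal coframes and their connection forms -/

/-- `E` is an oriented orthonormal coframe of `g` on the open set `D`, and `Θ a` are the components
of its Levi-Civita connection form, characterized by antisymmetry and vanishing torsion. -/
structure IsCoframe (D : Set R4) (g : MetricField) (E : R4 → Matrix (Fin 4) (Fin 4) ℝ)
    (Θ : Fin 4 → R4 → Matrix (Fin 4) (Fin 4) ℝ) : Prop where
  isOpen : IsOpen D
  metric_eq : ∀ x ∈ D, g x = (E x)ᵀ * E x
  det_pos : ∀ x ∈ D, 0 < (E x).det
  smooth : ∀ x ∈ D, ∀ i b, ContDiffAt ℝ 2 (fun y => E y i b) x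
  diff : ∀ x ∈ D, ∀ a, DiffM (Θ a) x
  antisymm : ∀ x ∈ D, ∀ a, (Θ a x)ᵀ = -Θ a x
  torsion : ∀ x ∈ D, ∀ a b i, (Θ a x * E x + pdM a E x) i b = (Θ b x * E x + pdM b E x) i a

/-- The curvature `∂_c Θ_d - ∂_d Θ_c + [Θ_c, Θ_d]` of a connection form. -/
def curvForm (Θ : Fin 4 → R4 → Matrix (Fin 4) (Fin 4) ℝ) (c d : Fin 4) (x : R4) :
    Matrix (Fin 4) (Fin 4) ℝ :=
  pdM c (Θ d) x - pdM d (Θ c) x + (Θ c x * Θ d x - Θ d x * Θ c x)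

/-- The connection matrix `E⁻¹ (Θ_a E + ∂_a E)` in the coordinate frame. -/
def gaugeConn (E : R4 → Matrix (Fin 4) (Fin 4) ℝ) (Θ : Fin 4 → R4 → Matrix (Fin 4) (Fin 4) ℝ)
    (a : Fin 4) (x : R4) : Matrix (Fin 4) (Fin 4) ℝ :=
  (E x)⁻¹ * (Θ a x * E x + pdM a E x)

/-- The Christoffel symbols as matrices `(Γ_a)^c_b`. -/
def christoffelM (g : MetricField) (a : Fin 4) (x : R4) : Matrix (Fin 4) (Fin 4) ℝ :=
  Matrix.of fun c b => christoffel g c a b x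

/-- The curvature tensor as matrices `(R_{cd})^a_b`. -/
def riemannM (g : MetricField) (c d : Fin 4) (x : R4) : Matrix (Fin 4) (Fin 4) ℝ :=
  Matrix.of fun a b => riemannUp g a b c d x

theorem riemannM_eq (g : MetricField) (c d : Fin 4) (x : R4) :
    riemannM g c d x = curvForm (christoffelM g) c d x := by
  ext a b
  simp only [riemannM, curvForm, Matrix.of_apply, riemannUp, Matrix.add_apply, Matrix.sub_apply,
    Matrix.mul_apply, pdM_apply, christoffelM, Finset.sum_sub_distrib]

namespace IsCoframe

variable {D : Set R4} {g : MetricField} {E : R4 → Matrix (Fin 4) (Fin 4) ℝ}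
  {Θ : Fin 4 → R4 → Matrix (Fin 4) (Fin 4) ℝ}

theorem isUnit_det (h : IsCoframe D g E Θ) (hx : x ∈ D) : IsUnit (E x).det :=
  (h.det_pos x hx).ne'.isUnit

theorem diffM (h : IsCoframe D g E Θ) (hx : x ∈ D) : DiffM E x :=
  fun i j => (h.smooth x hx i j).differentiableAt (by norm_num)

theorem diffM_pdM (h : IsCoframe D g E Θ) (hx : x ∈ D) (a : Fin 4) : DiffM (pdM a E) x :=
  fun i j => differentiableAt_pd (h.smooth x hx i j) a

theorem inv_metric (h : IsCoframe D g E Θ) (hx : x ∈ D) :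
    (g x)⁻¹ = (E x)⁻¹ * ((E x)⁻¹)ᵀ := by
  rw [h.metric_eq x hx, Matrix.mul_inv_rev, Matrix.transpose_nonsing_inv]

/-- The Koszul argument. Zero torsion makes `H a d b` symmetric in `a` and `b`, antisymmetry of `Θ`
gives ∂_a g = H_a + H_aᵀ, and in the Christoffel combination all terms cancel except 2H. An
explicitly guessed `Θ` thus needs only these two checks. -/
theorem christoffelM_eq (h : IsCoframe D g E Θ) (hx : x ∈ D) (a : Fin 4) :
    christoffelM g a x = gaugeConn E Θ a x := by
  set H : Fin 4 → Matrix (Fin 4) (Fin 4) ℝ := fun a => (E x)ᵀ * (Θ a x * E x + pdM a E x) with hH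
  have hsymm : ∀ a b d, H a d b = H b d a := by
    intro a b d
    simp only [hH, Matrix.mul_apply (M := (E x)ᵀ)]
    exact Finset.sum_congr rfl fun i _ => by rw [h.torsion x hx a b i]
  have hg : ∀ a, pdM a g x = (H a)ᵀ + H a := by
    intro a
    have hev : g =ᶠ[nhds x] fun y => (E y)ᵀ * E y :=
      Filter.eventually_of_mem (h.isOpen.mem_nhds hx) fun y hy => h.metric_eq y hy
    rw [pdM_congr hev, pdM_mul (h.diffM hx).transpose (h.diffM hx), pdM_transpose]
    simp only [hH, Matrix.transpose_mul, Matrix.transpose_add, Matrix.transpose_transpose,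
      h.antisymm x hx a]
    noncomm_ring
  have hpd : ∀ a b d, pd a (fun y => g y b d) x = H a d b + H a b d := by
    intro a b d
    have := congrFun (congrFun (hg a) b) d
    simpa [pdM_apply] using this
  have hE : (E x)⁻¹ * (Θ a x * E x + pdM a E x) = (g x)⁻¹ * H a := by
    have h1 : ((E x)⁻¹)ᵀ * (E x)ᵀ = 1 := by
      rw [← Matrix.transpose_mul, Matrix.mul_nonsing_inv _ (h.isUnit_det hx),
        Matrix.transpose_one]
    rw [h.inv_metric hx, hH]
    simp only [Matrix.mul_assoc]
    rw [← Matrix.mul_assoc ((E x)⁻¹)ᵀ, h1, Matrix.one_mul]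
  ext c b
  rw [gaugeConn, hE, Matrix.mul_apply]
  simp only [christoffelM, Matrix.of_apply, christoffel, hpd]
  rw [Finset.mul_sum]
  refine Finset.sum_congr rfl fun d _ => ?_
  rw [hsymm b a d, hsymm d b a, hsymm d a b]
  ring

theorem christoffelM_eventuallyEq (h : IsCoframe D g E Θ) (hx : x ∈ D) (a : Fin 4) :
    christoffelM g a =ᶠ[nhds x] gaugeConn E Θ a :=
  Filter.eventually_of_mem (h.isOpen.mem_nhds hx) fun _ hy => h.christoffelM_eq hy a

theorem diffM_christoffelM (h : IsCoframe D g E Θ) (hx : x ∈ D) (a : Fin 4) :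
    DiffM (christoffelM g a) x :=
  (((h.diffM hx).inv (h.det_pos x hx).ne').mul
    (((h.diff x hx a).mul (h.diffM hx)).add (h.diffM_pdM hx a))).congr
      (h.christoffelM_eventuallyEq hx a)

theorem mul_christoffelM (h : IsCoframe D g E Θ) (hx : x ∈ D) (a : Fin 4) :
    E x * christoffelM g a x = Θ a x * E x + pdM a E x := by
  rw [h.christoffelM_eq hx, gaugeConn, Matrix.mul_nonsing_inv_cancel_left _ _ (h.isUnit_det hx)]

/-- Gauge covariance of curvature. The identity `mul_christoffelM` is differentiated and
antisymmetrized: second derivatives of `E` cancel by symmetry, and its first derivatives are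
eliminated by the same identity. -/
theorem mul_riemannM (h : IsCoframe D g E Θ) (hx : x ∈ D) (c d : Fin 4) :
    E x * riemannM g c d x = curvForm Θ c d x * E x := by
  have hder : ∀ c d, E x * pdM c (christoffelM g d) x + pdM c E x * christoffelM g d x
      = Θ d x * pdM c E x + pdM c (Θ d) x * E x + pdM c (pdM d E) x := by
    intro c d
    rw [← pdM_mul (h.diffM hx) (h.diffM_christoffelM hx d),
      ← pdM_mul (h.diff x hx d) (h.diffM hx),
      ← pdM_add ((h.diff x hx d).mul (h.diffM hx)) (h.diffM_pdM hx d)]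
    exact pdM_congr (Filter.eventually_of_mem (h.isOpen.mem_nhds hx)
      fun y hy => h.mul_christoffelM hy d) c
  have hcomm : pdM c (pdM d E) x = pdM d (pdM c E) x := by
    ext i j
    exact pd_comm (h.smooth x hx i j) c d
  have hp : ∀ a, pdM a E x = E x * christoffelM g a x - Θ a x * E x := fun a => by
    rw [h.mul_christoffelM hx a]; abel
  have h1 := hder c d
  have h2 := hder d c
  rw [hcomm] at h1
  have h3 : E x * pdM c (christoffelM g d) x - E x * pdM d (christoffelM g c) x
      = Θ d x * pdM c E x + pdM c (Θ d) x * E x - Θ c x * pdM d E x - pdM d (Θ c) x * E x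
        - pdM c E x * christoffelM g d x + pdM d E x * christoffelM g c x := by
    rw [eq_sub_of_add_eq h1, eq_sub_of_add_eq h2]; abel
  rw [riemannM_eq, curvForm, curvForm, Matrix.mul_add, Matrix.mul_sub, h3, hp c, hp d]
  noncomm_ring

/-- The curvature tensor is the curvature of the connection form, seen in the coordinate frame. -/
theorem riemann_eq (h : IsCoframe D g E Θ) (hx : x ∈ D) (a b c d : Fin 4) :
    riemann g a b c d x = ((E x)ᵀ * curvForm Θ c d x * E x) a b := by
  rw [Matrix.mul_assoc, ← h.mul_riemannM hx, ← Matrix.mul_assoc, ← h.metric_eq x hx,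
    Matrix.mul_apply]
  rfl

end IsCoframe

/-! ## The Hodge dual in an orthonormal frame -/

/-- The 0-1 matrix that defines the symbol, times the Vandermonde matrix of 0, 1, 2, 3, is the
Vandermonde matrix of a, b, c, d; the number 12 is the Vandermonde determinant of 0, 1, 2, 3. The
polynomial form makes the components of `star` computable. -/
theorem leviCivita_eq (a b c d : Fin 4) :
    leviCivita a b c d = ((b : ℝ) - a) * (c - a) * (d - a) * (c - b) * (d - b) * (d - c) / 12 := by
  set v : Fin 4 → Fin 4 := ![a, b, c, d] with hv
  have h := Matrix.det_vandermonde fun i : Fin 4 => ((v i : Fin 4) : ℝ)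
  have h0 := Matrix.det_vandermonde fun i : Fin 4 => (i : ℝ)
  have hmul : Matrix.vandermonde (fun i : Fin 4 => ((v i : Fin 4) : ℝ))
      = (Matrix.of fun i j : Fin 4 => if v i = j then (1 : ℝ) else 0)
        * Matrix.vandermonde fun i : Fin 4 => (i : ℝ) := by
    ext i j
    simp [Matrix.mul_apply, Matrix.vandermonde_apply]
  rw [hmul, Matrix.det_mul, h0] at h
  change leviCivita a b c d * _ = _ at h
  have e1 : ∏ i : Fin 4, ∏ j ∈ Finset.Ioi i, ((j : ℝ) - (i : ℝ)) = 12 := by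
    have : ∀ i : Fin 4, Finset.Ioi i = Finset.univ.filter (fun j => i < j) := by decide
    simp [this, Finset.prod_filter, Fin.prod_univ_four]
    norm_num
  have e2 : ∏ i : Fin 4, ∏ j ∈ Finset.Ioi i, (((v j : Fin 4) : ℝ) - ((v i : Fin 4) : ℝ))
      = ((b : ℝ) - a) * (c - a) * (d - a) * (c - b) * (d - b) * (d - c) := by
    have : ∀ i : Fin 4, Finset.Ioi i = Finset.univ.filter (fun j => i < j) := by decide
    simp [this, Finset.prod_filter, Fin.prod_univ_four, hv, -mul_eq_mul_left_iff, -mul_eq_mul_right_iff]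
    ring
  rw [e1, e2] at h
  linarith

/-- The Hodge dual `½ ε_{ijmn} M_{mn}` of a 2-form given by its components in an oriented
orthonormal frame. -/
def star (M : Matrix (Fin 4) (Fin 4) ℝ) : Matrix (Fin 4) (Fin 4) ℝ :=
  Matrix.of fun i j => (1 / 2) * ∑ m, ∑ n, leviCivita i j m n * M m n

theorem star_eq (M : Matrix (Fin 4) (Fin 4) ℝ) :
    star M = (1 / 2 : ℝ) • !![0, M 2 3 - M 3 2, M 3 1 - M 1 3, M 1 2 - M 2 1;
      M 3 2 - M 2 3, 0, M 0 3 - M 3 0, M 2 0 - M 0 2;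
      M 1 3 - M 3 1, M 3 0 - M 0 3, 0, M 0 1 - M 1 0;
      M 2 1 - M 1 2, M 0 2 - M 2 0, M 1 0 - M 0 1, 0] := by
  ext i j
  fin_cases i <;> fin_cases j <;>
    simp [star, leviCivita_eq, Fin.sum_univ_four] <;> norm_num <;> ring

theorem det_four (E : Matrix (Fin 4) (Fin 4) ℝ) :
    E.det = (E 0 0 * E 1 1 - E 0 1 * E 1 0) * (E 2 2 * E 3 3 - E 2 3 * E 3 2)
      - (E 0 0 * E 1 2 - E 0 2 * E 1 0) * (E 2 1 * E 3 3 - E 2 3 * E 3 1)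
      + (E 0 0 * E 1 3 - E 0 3 * E 1 0) * (E 2 1 * E 3 2 - E 2 2 * E 3 1)
      + (E 0 1 * E 1 2 - E 0 2 * E 1 1) * (E 2 0 * E 3 3 - E 2 3 * E 3 0)
      - (E 0 1 * E 1 3 - E 0 3 * E 1 1) * (E 2 0 * E 3 2 - E 2 2 * E 3 0)
      + (E 0 2 * E 1 3 - E 0 3 * E 1 2) * (E 2 0 * E 3 1 - E 2 1 * E 3 0) := by
  rw [Matrix.det_succ_row_zero]
  simp only [Fin.sum_univ_four, Matrix.det_fin_three, Matrix.submatrix_apply]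
  simp [Fin.succAbove, Fin.lt_def]
  ring

theorem star_transpose (M : Matrix (Fin 4) (Fin 4) ℝ) : (star M)ᵀ = -star M := by
  rw [star_eq]
  ext i j
  fin_cases i <;> fin_cases j <;> simp <;> ring

theorem eq_of_antisymm {A B : Matrix (Fin 4) (Fin 4) ℝ} (hA : Aᵀ = -A) (hB : Bᵀ = -B)
    (h : ∀ i j, i < j → A i j = B i j) : A = B := by
  have hA' : ∀ i j, A j i = -A i j := fun i j => congrFun (congrFun hA i) j
  have hB' : ∀ i j, B j i = -B i j := fun i j => congrFun (congrFun hB i) j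
  ext i j
  rcases lt_trichotomy i j with hij | rfl | hij
  · exact h i j hij
  · linarith [hA' i i, hB' i i]
  · rw [hA' j i, hB' j i, h j i hij]

-- Naturality of the Hodge dual under a change of coframe: the Levi-Civita symbol is multiplied by
-- the determinant. Both sides are antisymmetric, so six polynomial identities suffice.
set_option maxHeartbeats 4000000 in
theorem det_mul_star (E N : Matrix (Fin 4) (Fin 4) ℝ) :
    E.det • star N = Eᵀ * star (E * N * Eᵀ) * E := by
  refine eq_of_antisymm ?_ ?_ fun i j hij => ?_
  · rw [Matrix.transpose_smul, star_transpose, smul_neg]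
  · simp only [Matrix.transpose_mul, star_transpose, Matrix.transpose_transpose, Matrix.mul_assoc,
      Matrix.neg_mul, Matrix.mul_neg]
  rw [star_eq, star_eq, det_four]
  have h : ∀ i j, (E * N * Eᵀ) i j = ∑ k, ∑ l, E i k * N k l * E j l := by
    intro i j
    simp only [Matrix.mul_apply, Matrix.transpose_apply, Finset.sum_mul]
    exact Finset.sum_comm
  simp only [h, Matrix.mul_apply, Fin.sum_univ_four, Matrix.transpose_apply]
  fin_cases i <;> fin_cases j <;> first | exact absurd hij (by decide) | (simp; ring)

/-! ## Curvature in an orthonormal frame -/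

/-- A 2-form with values in matrices, from its components in the coframe `E`. -/
def pull₂ (E : Matrix (Fin 4) (Fin 4) ℝ) (R : Fin 4 → Fin 4 → Matrix (Fin 4) (Fin 4) ℝ)
    (c d : Fin 4) : Matrix (Fin 4) (Fin 4) ℝ :=
  ∑ k, ∑ l, (E k c * E l d) • R k l

/-- The Ricci tensor `R_{jl} = R_{ijil}` in an orthonormal frame, where `R k l i j = R_{ijkl}`. -/
def frameRicci (R : Fin 4 → Fin 4 → Matrix (Fin 4) (Fin 4) ℝ) : Matrix (Fin 4) (Fin 4) ℝ :=
  Matrix.of fun j l => ∑ i, R i l i j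

/-- The Weyl tensor in an orthonormal frame. -/
def frameWeyl (R : Fin 4 → Fin 4 → Matrix (Fin 4) (Fin 4) ℝ) (k l : Fin 4) :
    Matrix (Fin 4) (Fin 4) ℝ :=
  Matrix.of fun i j => R k l i j
    - (1 / 2) * ((1 : Matrix (Fin 4) (Fin 4) ℝ) i k * frameRicci R j l
      - (1 : Matrix (Fin 4) (Fin 4) ℝ) i l * frameRicci R j k
      - (1 : Matrix (Fin 4) (Fin 4) ℝ) j k * frameRicci R i l
      + (1 : Matrix (Fin 4) (Fin 4) ℝ) j l * frameRicci R i k)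
    + ((frameRicci R).trace / 6) * ((1 : Matrix (Fin 4) (Fin 4) ℝ) i k
        * (1 : Matrix (Fin 4) (Fin 4) ℝ) j l
      - (1 : Matrix (Fin 4) (Fin 4) ℝ) i l * (1 : Matrix (Fin 4) (Fin 4) ℝ) j k)

theorem conj_apply (E A : Matrix (Fin 4) (Fin 4) ℝ) (a b : Fin 4) :
    (Eᵀ * A * E) a b = ∑ i, ∑ j, E i a * E j b * A i j := by
  simp only [Matrix.mul_apply, Matrix.transpose_apply, Finset.sum_mul]
  rw [Finset.sum_comm]
  exact Finset.sum_congr rfl fun i _ => Finset.sum_congr rfl fun j _ => by ring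

theorem conj_pull₂_apply (E : Matrix (Fin 4) (Fin 4) ℝ)
    (R : Fin 4 → Fin 4 → Matrix (Fin 4) (Fin 4) ℝ) (a b c d : Fin 4) :
    (Eᵀ * pull₂ E R c d * E) a b
      = ∑ i, ∑ j, ∑ k, ∑ l, E i a * E j b * (E k c * E l d) * R k l i j := by
  rw [conj_apply]
  refine Finset.sum_congr rfl fun i _ => Finset.sum_congr rfl fun j _ => ?_
  simp only [pull₂, Matrix.sum_apply, Matrix.smul_apply, smul_eq_mul, Finset.mul_sum, mul_assoc]

theorem conj_mul_conj (E A B : Matrix (Fin 4) (Fin 4) ℝ) (a b c d : Fin 4) :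
    (Eᵀ * A * E) a c * (Eᵀ * B * E) b d
      = ∑ i, ∑ j, ∑ k, ∑ l, E i a * E j b * (E k c * E l d) * (A i k * B j l) := by
  rw [conj_apply, conj_apply, Finset.sum_mul_sum]
  refine Finset.sum_congr rfl fun i _ => Finset.sum_congr rfl fun j _ => ?_
  rw [Finset.sum_mul_sum]
  exact Finset.sum_congr rfl fun k _ => Finset.sum_congr rfl fun l _ => by ring

theorem conj_mul_conj_swap (E A B : Matrix (Fin 4) (Fin 4) ℝ) (a b c d : Fin 4) :
    (Eᵀ * A * E) a d * (Eᵀ * B * E) b c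
      = ∑ i, ∑ j, ∑ k, ∑ l, E i a * E j b * (E k c * E l d) * (A i l * B j k) := by
  rw [conj_mul_conj]
  refine Finset.sum_congr rfl fun i _ => Finset.sum_congr rfl fun j _ => ?_
  rw [Finset.sum_comm]
  exact Finset.sum_congr rfl fun k _ => Finset.sum_congr rfl fun l _ => by ring

/-- For each fixed matrix entry `i j`, the form indices transform by congruence with the invertible
`E`. -/
theorem pull₂_eq_zero_iff {E : Matrix (Fin 4) (Fin 4) ℝ} (hE : IsUnit E.det)
    (R : Fin 4 → Fin 4 → Matrix (Fin 4) (Fin 4) ℝ) :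
    (∀ c d, pull₂ E R c d = 0) ↔ ∀ k l, R k l = 0 := by
  refine ⟨fun h k l => ?_, fun h c d => by simp [pull₂, h]⟩
  ext i j
  have h0 : Eᵀ * (Matrix.of fun k l => R k l i j) * E = 0 := by
    ext c d
    rw [conj_apply]
    have := congrFun (congrFun (h c d) i) j
    simpa [pull₂, Matrix.sum_apply] using this
  have hE' : IsUnit Eᵀ.det := by rwa [Matrix.det_transpose]
  have h1 : (Matrix.of fun k l => R k l i j) = (Eᵀ)⁻¹ * (Eᵀ * (Matrix.of fun k l => R k l i j) * E)
      * E⁻¹ := by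
    rw [Matrix.mul_assoc (Eᵀ)⁻¹, Matrix.mul_nonsing_inv_cancel_right _ _ hE,
      Matrix.nonsing_inv_mul_cancel_left _ _ hE']
  rw [h0, Matrix.mul_zero, Matrix.zero_mul] at h1
  exact congrFun (congrFun h1 k) l

theorem conj_eq_zero_iff {E : Matrix (Fin 4) (Fin 4) ℝ} (hE : IsUnit E.det)
    (A : Matrix (Fin 4) (Fin 4) ℝ) : Eᵀ * A * E = 0 ↔ A = 0 := by
  refine ⟨fun h => ?_, fun h => by simp [h]⟩
  have hE' : IsUnit Eᵀ.det := by rwa [Matrix.det_transpose]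
  have h1 : A = (Eᵀ)⁻¹ * (Eᵀ * A * E) * E⁻¹ := by
    rw [Matrix.mul_assoc (Eᵀ)⁻¹, Matrix.mul_nonsing_inv_cancel_right _ _ hE,
      Matrix.nonsing_inv_mul_cancel_left _ _ hE']
  rw [h1, h, Matrix.mul_zero, Matrix.zero_mul]

/-- `pull₂` touches only the form indices. This moves the Hodge dual, commutators and traces from
coordinate components of the curvature to frame components. -/
theorem pull₂_map (E : Matrix (Fin 4) (Fin 4) ℝ)
    (R : Fin 4 → Fin 4 → Matrix (Fin 4) (Fin 4) ℝ)
    (f : Matrix (Fin 4) (Fin 4) ℝ →ₗ[ℝ] Matrix (Fin 4) (Fin 4) ℝ) (c d : Fin 4) :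
    f (pull₂ E R c d) = pull₂ E (fun k l => f (R k l)) c d := by
  simp only [pull₂, map_sum, map_smul]

/-- The Hodge dual as a linear map. -/
def starₗ : Matrix (Fin 4) (Fin 4) ℝ →ₗ[ℝ] Matrix (Fin 4) (Fin 4) ℝ where
  toFun := star
  map_add' A B := by
    ext i j
    simp only [star, Matrix.of_apply, Matrix.add_apply, mul_add, Finset.sum_add_distrib]
  map_smul' r A := by
    ext i j
    simp only [star, Matrix.of_apply, Matrix.smul_apply, smul_eq_mul, Finset.mul_sum,
      RingHom.id_apply]
    exact Finset.sum_congr rfl fun m _ => Finset.sum_congr rfl fun n _ => by ring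

namespace IsCoframe

variable {D : Set R4} {g : MetricField} {E : R4 → Matrix (Fin 4) (Fin 4) ℝ}
  {Θ : Fin 4 → R4 → Matrix (Fin 4) (Fin 4) ℝ} {x : R4}
  {R : Fin 4 → Fin 4 → Matrix (Fin 4) (Fin 4) ℝ}

theorem metric_apply (h : IsCoframe D g E Θ) (hx : x ∈ D) (a b : Fin 4) :
    g x a b = ((E x)ᵀ * (1 : Matrix (Fin 4) (Fin 4) ℝ) * E x) a b := by
  rw [Matrix.mul_one, ← h.metric_eq x hx]

theorem ricci_eq (h : IsCoframe D g E Θ) (hx : x ∈ D)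
    (hR : ∀ c d, curvForm Θ c d x = pull₂ (E x) R c d) (a b : Fin 4) :
    ricci g a b x = ((E x)ᵀ * frameRicci R * E x) a b := by
  have hr : ∀ c d, riemannM g c d x
      = ∑ k, ∑ l, (E x k c * E x l d) • ((E x)⁻¹ * R k l * E x) := by
    intro c d
    rw [← Matrix.nonsing_inv_mul_cancel_left _ (riemannM g c d x) (h.isUnit_det hx),
      h.mul_riemannM hx, hR, pull₂, ← Matrix.mul_assoc, Finset.mul_sum, Finset.sum_mul]
    refine Finset.sum_congr rfl fun k _ => ?_
    rw [Finset.mul_sum, Finset.sum_mul]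
    refine Finset.sum_congr rfl fun l _ => ?_
    rw [Matrix.mul_smul, Matrix.smul_mul]
  have hk : ∀ k l, ∑ c, E x k c * ((E x)⁻¹ * R k l * E x) c a = (R k l * E x) k a := by
    intro k l
    rw [← Matrix.mul_apply, ← Matrix.mul_assoc, Matrix.mul_nonsing_inv_cancel_left _ _
      (h.isUnit_det hx)]
  calc ricci g a b x = ∑ c, riemannM g c b x c a := rfl
    _ = ∑ c, ∑ k, ∑ l, E x k c * E x l b * ((E x)⁻¹ * R k l * E x) c a := by
        simp only [hr, Matrix.sum_apply, Matrix.smul_apply, smul_eq_mul]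
    _ = ∑ k, ∑ l, E x l b * ∑ c, E x k c * ((E x)⁻¹ * R k l * E x) c a := by
        rw [Finset.sum_comm]
        refine Finset.sum_congr rfl fun k _ => ?_
        rw [Finset.sum_comm]
        refine Finset.sum_congr rfl fun l _ => ?_
        rw [Finset.mul_sum]
        exact Finset.sum_congr rfl fun c _ => by ring
    _ = ∑ l, ∑ k, ∑ j, E x l b * (R k l k j * E x j a) := by
        rw [Finset.sum_comm]
        refine Finset.sum_congr rfl fun l _ => Finset.sum_congr rfl fun k _ => ?_
        rw [hk, Matrix.mul_apply, Finset.mul_sum]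
    _ = ((E x)ᵀ * frameRicci R * E x) a b := by
        rw [conj_apply]
        symm
        rw [Finset.sum_comm]
        refine Finset.sum_congr rfl fun l _ => ?_
        simp only [frameRicci, Matrix.of_apply, Finset.mul_sum]
        rw [Finset.sum_comm]
        exact Finset.sum_congr rfl fun k _ => Finset.sum_congr rfl fun j _ => by ring

theorem scalar_eq (h : IsCoframe D g E Θ) (hx : x ∈ D)
    (hR : ∀ c d, curvForm Θ c d x = pull₂ (E x) R c d) :
    scalar g x = (frameRicci R).trace := by
  have h1 : scalar g x = ((g x)⁻¹ * ((E x)ᵀ * frameRicci R * E x)ᵀ).trace := by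
    simp only [scalar, Matrix.trace, Matrix.diag, Matrix.mul_apply (M := (g x)⁻¹),
      Matrix.transpose_apply, h.ricci_eq hx hR]
  have h2 : ((E x)⁻¹)ᵀ * (E x)ᵀ = 1 := by
    rw [← Matrix.transpose_mul, Matrix.mul_nonsing_inv _ (h.isUnit_det hx), Matrix.transpose_one]
  rw [h1, h.inv_metric hx, Matrix.transpose_mul, Matrix.transpose_mul, Matrix.transpose_transpose,
    Matrix.mul_assoc, ← Matrix.mul_assoc ((E x)⁻¹)ᵀ, h2, Matrix.one_mul, Matrix.trace_mul_comm,
    Matrix.mul_assoc, Matrix.mul_nonsing_inv _ (h.isUnit_det hx), Matrix.mul_one,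
    Matrix.trace_transpose]

/-- Curvature, Ricci and metric terms are all written as fourfold sums with the same weight, a
product of four entries of `E`, and then compared summand by summand. -/
theorem weyl_eq (h : IsCoframe D g E Θ) (hx : x ∈ D)
    (hR : ∀ c d, curvForm Θ c d x = pull₂ (E x) R c d) (a b c d : Fin 4) :
    weyl g a b c d x = ((E x)ᵀ * pull₂ (E x) (frameWeyl R) c d * E x) a b := by
  rw [weyl, h.riemann_eq hx, h.scalar_eq hx hR]
  simp only [h.ricci_eq hx hR, h.metric_apply hx, hR]
  rw [mul_comm (((E x)ᵀ * (1 : Matrix (Fin 4) (Fin 4) ℝ) * E x) b c) (((E x)ᵀ * frameRicci R * E x) a d),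
    mul_comm (((E x)ᵀ * (1 : Matrix (Fin 4) (Fin 4) ℝ) * E x) b d) (((E x)ᵀ * frameRicci R * E x) a c)]
  rw [conj_mul_conj (E x) 1 (frameRicci R) a b c d,
    conj_mul_conj_swap (E x) 1 (frameRicci R) a b c d,
    conj_mul_conj_swap (E x) (frameRicci R) 1 a b c d,
    conj_mul_conj (E x) (frameRicci R) 1 a b c d, conj_mul_conj (E x) 1 1 a b c d,
    conj_mul_conj_swap (E x) 1 1 a b c d, conj_pull₂_apply, conj_pull₂_apply]
  simp only [Finset.mul_sum, ← Finset.sum_sub_distrib, ← Finset.sum_add_distrib]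
  refine Finset.sum_congr rfl fun i _ => Finset.sum_congr rfl fun j _ =>
    Finset.sum_congr rfl fun k _ => Finset.sum_congr rfl fun l _ => ?_
  simp only [frameWeyl, Matrix.of_apply]
  ring

/-- Raising indices with g⁻¹ = E⁻¹E⁻ᵀ turns the frame components `M` into `N` = E⁻¹ M E⁻ᵀ. Since det
E > 0, the volume factor √det g equals det E, and `det_mul_star` finishes. This is where the
orientation enters. -/
theorem hodgeWeyl_eq (h : IsCoframe D g E Θ) (hx : x ∈ D)
    (hR : ∀ c d, curvForm Θ c d x = pull₂ (E x) R c d) (a b c d : Fin 4) :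
    hodgeWeyl g a b c d x
      = ((E x)ᵀ * pull₂ (E x) (fun k l => star (frameWeyl R k l)) c d * E x) a b := by
  set M := pull₂ (E x) (frameWeyl R) c d with hM
  set N := (E x)⁻¹ * M * ((E x)⁻¹)ᵀ with hN
  have hu := h.isUnit_det hx
  have hsqrt : Real.sqrt (g x).det = (E x).det := by
    rw [h.metric_eq x hx, Matrix.det_mul, Matrix.det_transpose, Real.sqrt_mul_self
      (h.det_pos x hx).le]
  have ht : (E x)ᵀ * ((E x)⁻¹)ᵀ = 1 := by
    rw [← Matrix.transpose_mul, Matrix.nonsing_inv_mul _ hu, Matrix.transpose_one]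
  have ht' : ((E x)⁻¹)ᵀ * (E x)ᵀ = 1 := by
    rw [← Matrix.transpose_mul, Matrix.mul_nonsing_inv _ hu, Matrix.transpose_one]
  have hMN : M = E x * N * (E x)ᵀ := by
    rw [hN, Matrix.mul_assoc, Matrix.mul_assoc _ _ (E x)ᵀ, ht', Matrix.mul_one,
      Matrix.mul_nonsing_inv_cancel_left _ _ hu]
  have hin : ∀ m n, ∑ e, ∑ f, (g x)⁻¹ m e * (g x)⁻¹ n f * weyl g e f c d x = N m n := by
    intro m n
    have h1 : ∑ e, ∑ f, (g x)⁻¹ m e * (g x)⁻¹ n f * weyl g e f c d x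
        = ((g x)⁻¹ * ((E x)ᵀ * M * E x) * ((g x)⁻¹)ᵀ) m n := by
      simp only [h.weyl_eq hx hR, ← hM, Matrix.mul_apply (N := ((g x)⁻¹)ᵀ),
        Matrix.mul_apply (M := (g x)⁻¹), Matrix.transpose_apply, Finset.sum_mul]
      rw [Finset.sum_comm]
      exact Finset.sum_congr rfl fun f _ => Finset.sum_congr rfl fun e _ => by ring
    rw [h1, h.inv_metric hx, Matrix.transpose_mul, Matrix.transpose_transpose]
    have : (E x)⁻¹ * ((E x)⁻¹)ᵀ * ((E x)ᵀ * M * E x) * ((E x)⁻¹ * ((E x)⁻¹)ᵀ)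
        = (E x)⁻¹ * (((E x)⁻¹)ᵀ * (E x)ᵀ) * M * (E x * (E x)⁻¹) * ((E x)⁻¹)ᵀ := by
      simp only [Matrix.mul_assoc]
    rw [this, ht', Matrix.mul_nonsing_inv _ hu, Matrix.mul_one, Matrix.mul_one]
  have hstar : pull₂ (E x) (fun k l => star (frameWeyl R k l)) c d = star M :=
    (pull₂_map (E x) (frameWeyl R) starₗ c d).symm
  rw [hstar, hMN, ← det_mul_star, hodgeWeyl]
  simp only [Matrix.smul_apply, star, Matrix.of_apply, smul_eq_mul, ← hin, volForm, hsqrt,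
    Finset.mul_sum]
  refine Finset.sum_congr rfl fun m _ => Finset.sum_congr rfl fun n _ =>
    Finset.sum_congr rfl fun e _ => Finset.sum_congr rfl fun f _ => by ring

theorem hodgeWeyl_eq_weyl_iff (h : IsCoframe D g E Θ) (hx : x ∈ D)
    (hR : ∀ c d, curvForm Θ c d x = pull₂ (E x) R c d) :
    (∀ a b c d, hodgeWeyl g a b c d x = weyl g a b c d x) ↔
      ∀ k l, star (frameWeyl R k l) = frameWeyl R k l := by
  have h1 : (∀ a b c d, hodgeWeyl g a b c d x = weyl g a b c d x) ↔
      ∀ c d, pull₂ (E x) (fun k l => (starₗ - LinearMap.id :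
          Matrix (Fin 4) (Fin 4) ℝ →ₗ[ℝ] Matrix (Fin 4) (Fin 4) ℝ) (frameWeyl R k l)) c d = 0 := by
    have : ∀ c d, pull₂ (E x) (fun k l => (starₗ - LinearMap.id :
          Matrix (Fin 4) (Fin 4) ℝ →ₗ[ℝ] Matrix (Fin 4) (Fin 4) ℝ) (frameWeyl R k l)) c d = 0 ↔
        ∀ a b, hodgeWeyl g a b c d x = weyl g a b c d x := by
      intro c d
      rw [← conj_eq_zero_iff (h.isUnit_det hx), ← pull₂_map, LinearMap.sub_apply,
        Matrix.mul_sub, Matrix.sub_mul, sub_eq_zero, pull₂_map, LinearMap.id_apply]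
      constructor
      · intro he a b
        rw [h.hodgeWeyl_eq hx hR, h.weyl_eq hx hR]
        exact congrFun (congrFun he a) b
      · intro he
        ext a b
        have := he a b
        rwa [h.hodgeWeyl_eq hx hR, h.weyl_eq hx hR] at this
    simp only [this]
    exact ⟨fun H c d a b => H a b c d, fun H a b c d => H c d a b⟩
  rw [h1, pull₂_eq_zero_iff (h.isUnit_det hx)]
  simp only [LinearMap.sub_apply, LinearMap.id_apply, sub_eq_zero]
  rfl

theorem ricci_eq_smul_iff (h : IsCoframe D g E Θ) (hx : x ∈ D)
    (hR : ∀ c d, curvForm Θ c d x = pull₂ (E x) R c d) (r : ℝ) :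
    (∀ a b, ricci g a b x = r * g x a b) ↔ frameRicci R = r • 1 := by
  rw [← sub_eq_zero (b := r • (1 : Matrix (Fin 4) (Fin 4) ℝ)), ← conj_eq_zero_iff
    (h.isUnit_det hx), Matrix.mul_sub, Matrix.sub_mul, sub_eq_zero]
  constructor
  · intro H
    ext a b
    rw [← h.ricci_eq hx hR, H, h.metric_apply hx, Matrix.mul_smul, Matrix.smul_mul]
    rfl
  · intro H a b
    rw [h.ricci_eq hx hR, H, h.metric_apply hx, Matrix.mul_smul, Matrix.smul_mul]
    rfl

theorem riemann_eq_zero_iff (h : IsCoframe D g E Θ) (hx : x ∈ D)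
    (hR : ∀ c d, curvForm Θ c d x = pull₂ (E x) R c d) :
    (∀ a b c d, riemann g a b c d x = 0) ↔ ∀ k l, R k l = 0 := by
  rw [← pull₂_eq_zero_iff (h.isUnit_det hx)]
  simp only [h.riemann_eq hx, hR, ← conj_eq_zero_iff (h.isUnit_det hx) (pull₂ _ _ _ _)]
  exact ⟨fun H c d => by ext a b; exact H a b c d,
    fun H a b c d => congrFun (congrFun (H c d) a) b⟩

end IsCoframe

/-! ## Self-dual and anti-self-dual 2-forms -/

/-- The standard basis of anti-self-dual 2-forms:
`e⁰¹ - e²³`, `e⁰² + e¹³`, `e⁰³ - e¹²`. -/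
def asd : Fin 3 → Matrix (Fin 4) (Fin 4) ℝ :=
  ![!![0, 1, 0, 0; -1, 0, 0, 0; 0, 0, 0, -1; 0, 0, 1, 0],
    !![0, 0, 1, 0; 0, 0, 0, 1; -1, 0, 0, 0; 0, -1, 0, 0],
    !![0, 0, 0, 1; 0, 0, -1, 0; 0, 1, 0, 0; -1, 0, 0, 0]]

/-- The standard basis of self-dual 2-forms:
`e⁰¹ + e²³`, `e⁰² - e¹³`, `e⁰³ + e¹²`. -/
def sd : Fin 3 → Matrix (Fin 4) (Fin 4) ℝ :=
  ![!![0, 1, 0, 0; -1, 0, 0, 0; 0, 0, 0, 1; 0, 0, -1, 0],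
    !![0, 0, 1, 0; 0, 0, 0, -1; -1, 0, 0, 0; 0, 1, 0, 0],
    !![0, 0, 0, 1; 0, 0, 1, 0; 0, -1, 0, 0; -1, 0, 0, 0]]

theorem star_asd (i : Fin 3) : star (asd i) = -asd i := by
  rw [star_eq]
  ext k l
  fin_cases i <;> fin_cases k <;> fin_cases l <;> simp [asd] <;> norm_num

theorem star_sd (i : Fin 3) : star (sd i) = sd i := by
  rw [star_eq]
  ext k l
  fin_cases i <;> fin_cases k <;> fin_cases l <;> simp [sd] <;> norm_num

theorem asd_transpose (i : Fin 3) : (asd i)ᵀ = -asd i := by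
  ext k l
  fin_cases i <;> fin_cases k <;> fin_cases l <;> simp [asd]

theorem sd_transpose (i : Fin 3) : (sd i)ᵀ = -sd i := by
  ext k l
  fin_cases i <;> fin_cases k <;> fin_cases l <;> simp [sd]

/-- The `𝔰𝔬(4)`-matrix with anti-self-dual part `½ u` and self-dual part `½ v`. -/
def so4 (u v : Fin 3 → ℝ) : Matrix (Fin 4) (Fin 4) ℝ :=
  (1 / 2 : ℝ) • ∑ i, (u i • asd i + v i • sd i)

theorem so4_eq (u v : Fin 3 → ℝ) :
    so4 u v = (1 / 2 : ℝ) •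
      !![0, u 0 + v 0, u 1 + v 1, u 2 + v 2;
        -(u 0 + v 0), 0, v 2 - u 2, u 1 - v 1;
        -(u 1 + v 1), u 2 - v 2, 0, v 0 - u 0;
        -(u 2 + v 2), v 1 - u 1, u 0 - v 0, 0] := by
  ext i j
  fin_cases i <;> fin_cases j <;> simp [so4, asd, sd, Fin.sum_univ_three] <;> ring

theorem so4_transpose (u v : Fin 3 → ℝ) : (so4 u v)ᵀ = -so4 u v := by
  simp only [so4, Matrix.transpose_smul, Matrix.transpose_sum, Matrix.transpose_add,
    asd_transpose, sd_transpose, smul_neg, ← neg_add, Finset.sum_neg_distrib]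

-- The splitting 𝔰𝔬(4) = 𝔰𝔬(3) ⊕ 𝔰𝔬(3). The factor ½ in `so4` makes the brackets exactly cross
-- products; the sign on the self-dual half comes from the ordering of the basis `sd`.
open scoped Matrix in
set_option maxHeartbeats 1000000 in
theorem so4_commutator (u v u' v' : Fin 3 → ℝ) :
    so4 u v * so4 u' v' - so4 u' v' * so4 u v = so4 (u ⨯₃ u') (-(v ⨯₃ v')) := by
  refine eq_of_antisymm ?_ (so4_transpose _ _) fun i j hij => ?_
  · simp only [Matrix.transpose_sub, Matrix.transpose_mul, so4_transpose, Matrix.neg_mul,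
      Matrix.mul_neg, neg_neg, neg_sub]
  simp only [so4_eq, cross_apply, Matrix.smul_mul, Matrix.mul_smul, Matrix.sub_apply,
    Matrix.smul_apply, Matrix.mul_apply, Fin.sum_univ_four]
  fin_cases i <;> fin_cases j <;> first | exact absurd hij (by decide) | (simp; ring)

/-- The connection form with anti-self-dual part `½ η` and self-dual part `½ ζ`. -/
def spinConn (η ζ : Fin 3 → Fin 4 → R4 → ℝ) (a : Fin 4) (x : R4) : Matrix (Fin 4) (Fin 4) ℝ :=
  so4 (fun i => η i a x) (fun i => ζ i a x)

/-- The curvature `dη_i + ε η_j ∧ η_k` of a triple of 1-forms. -/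
def spinCurv (ε : ℝ) (η : Fin 3 → Fin 4 → R4 → ℝ) (c d : Fin 4) (x : R4) : Fin 3 → ℝ :=
  fun i => pd c (η i d) x - pd d (η i c) x
    + ε * ((fun i => η i c x) ⨯₃ (fun i => η i d x)) i

theorem pdM_spinConn {η ζ : Fin 3 → Fin 4 → R4 → ℝ} {x : R4}
    (hη : ∀ i a, DifferentiableAt ℝ (η i a) x) (hζ : ∀ i a, DifferentiableAt ℝ (ζ i a) x)
    (c d : Fin 4) :
    pdM c (spinConn η ζ d) x = so4 (fun i => pd c (η i d) x) (fun i => pd c (ζ i d) x) := by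
  ext k l
  have h : ∀ y, spinConn η ζ d y k l
      = ∑ i, ((η i d y * (asd i k l / 2)) + ζ i d y * (sd i k l / 2)) := by
    intro y
    simp only [spinConn, so4, Matrix.smul_apply, Matrix.sum_apply, Matrix.add_apply, smul_eq_mul,
      Finset.mul_sum]
    exact Finset.sum_congr rfl fun i _ => by ring
  have hc : ∀ r : ℝ, pd c (fun _ => r) x = 0 := fun r => by simp [pd]
  rw [pdM_apply]
  simp only [h]
  rw [pd_sum (f := fun i y => η i d y * (asd i k l / 2) + ζ i d y * (sd i k l / 2)) fun i _ =>
    ((hη i d).mul_const _).add ((hζ i d).mul_const _)]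
  simp only [so4, Matrix.smul_apply, Matrix.sum_apply, Matrix.add_apply, smul_eq_mul,
    Finset.mul_sum]
  refine Finset.sum_congr rfl fun i _ => ?_
  rw [pd_add ((hη i d).mul_const _) ((hζ i d).mul_const _),
    pd_mul (hη i d) (differentiableAt_const _), pd_mul (hζ i d) (differentiableAt_const _), hc, hc]
  ring

theorem diffM_spinConn {η ζ : Fin 3 → Fin 4 → R4 → ℝ} {x : R4}
    (hη : ∀ i a, DifferentiableAt ℝ (η i a) x) (hζ : ∀ i a, DifferentiableAt ℝ (ζ i a) x)
    (a : Fin 4) : DiffM (spinConn η ζ a) x := by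
  intro k l
  simp only [spinConn, so4, Matrix.smul_apply, Matrix.sum_apply, Matrix.add_apply, smul_eq_mul]
  exact (DifferentiableAt.fun_sum fun i _ => ((hη i a).mul_const _).add
    ((hζ i a).mul_const _)).const_mul _

theorem so4_add_sub (u v u' v' u'' v'' : Fin 3 → ℝ) :
    so4 u v - so4 u' v' + so4 u'' v'' = so4 (u - u' + u'') (v - v' + v'') := by
  simp only [so4, ← smul_sub, ← smul_add, ← Finset.sum_sub_distrib, ← Finset.sum_add_distrib,
    Pi.add_apply, Pi.sub_apply]
  congr 1
  refine Finset.sum_congr rfl fun i _ => ?_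
  module

theorem curvForm_spinConn {η ζ : Fin 3 → Fin 4 → R4 → ℝ} {x : R4}
    (hη : ∀ i a, DifferentiableAt ℝ (η i a) x) (hζ : ∀ i a, DifferentiableAt ℝ (ζ i a) x)
    (c d : Fin 4) :
    curvForm (spinConn η ζ) c d x = so4 (spinCurv 1 η c d x) (spinCurv (-1) ζ c d x) := by
  rw [curvForm, pdM_spinConn hη hζ, pdM_spinConn hη hζ, spinConn, spinConn, so4_commutator,
    so4_add_sub]
  congr 1 <;> ext i <;> simp only [spinCurv, Pi.add_apply, Pi.sub_apply, Pi.neg_apply] <;> ring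

/-! ## Curvature of type D -/

/-- The curvature `R k l i j = R_{ijkl}` of type D in a frame, with eigenvalues `x, x, z` on
anti-self-dual and `x', x', z'` on self-dual 2-forms, and trace-free Ricci part `y`. -/
def typeD (x z y x' z' : ℝ) (k l : Fin 4) : Matrix (Fin 4) (Fin 4) ℝ :=
  so4 ![x * asd 0 k l, x * asd 1 k l, z * asd 2 k l + y * sd 2 k l]
    ![x' * sd 0 k l, x' * sd 1 k l, z' * sd 2 k l + y * asd 2 k l]

theorem pull₂_typeD (E : Matrix (Fin 4) (Fin 4) ℝ) (x z y x' z' : ℝ) (c d : Fin 4) :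
    pull₂ E (typeD x z y x' z') c d =
      so4 ![x * (Eᵀ * asd 0 * E) c d, x * (Eᵀ * asd 1 * E) c d,
          z * (Eᵀ * asd 2 * E) c d + y * (Eᵀ * sd 2 * E) c d]
        ![x' * (Eᵀ * sd 0 * E) c d, x' * (Eᵀ * sd 1 * E) c d,
          z' * (Eᵀ * sd 2 * E) c d + y * (Eᵀ * asd 2 * E) c d] := by
  simp only [conj_apply, pull₂, typeD, so4, Fin.sum_univ_three, Finset.mul_sum]
  ext i j
  simp only [Matrix.sum_apply, Matrix.smul_apply, Matrix.add_apply, smul_eq_mul,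
    Matrix.cons_val_zero, Matrix.cons_val_one, Matrix.cons_val, Finset.sum_mul,
    ← Finset.sum_add_distrib, Finset.mul_sum]
  exact Finset.sum_congr rfl fun k _ => Finset.sum_congr rfl fun l _ => by ring

theorem frameRicci_typeD (x z y x' z' : ℝ) :
    frameRicci (typeD x z y x' z') = Matrix.diagonal
      ![(2 * x + z + 2 * x' + z') / 2 + y, (2 * x + z + 2 * x' + z') / 2 - y,
        (2 * x + z + 2 * x' + z') / 2 - y, (2 * x + z + 2 * x' + z') / 2 + y] := by
  ext i j
  fin_cases i <;> fin_cases j <;>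
    simp [frameRicci, typeD, so4_eq, asd, sd, Fin.sum_univ_four] <;> ring

theorem typeD_swap (x z y x' z' : ℝ) (k l : Fin 4) :
    typeD x z y x' z' k l = -typeD x z y x' z' l k := by
  have h1 : ∀ i, asd i k l = -asd i l k := fun i => congrFun (congrFun (asd_transpose i) l) k
  have h2 : ∀ i, sd i k l = -sd i l k := fun i => congrFun (congrFun (sd_transpose i) l) k
  simp only [typeD, h1, h2]
  ext i j
  simp [so4, Fin.sum_univ_three]
  ring

theorem frameWeyl_swap {R : Fin 4 → Fin 4 → Matrix (Fin 4) (Fin 4) ℝ}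
    (hR : ∀ k l, R k l = -R l k) (k l : Fin 4) : frameWeyl R k l = -frameWeyl R l k := by
  ext i j
  simp only [frameWeyl, Matrix.of_apply, Matrix.neg_apply, hR k l]
  ring

-- The hypothesis is the first Bianchi identity: both halves of the curvature operator have the same
-- trace, a quarter of the scalar curvature. Removing the Ricci part kills `y` and subtracts a third
-- of this trace from each eigenvalue.
set_option maxHeartbeats 1000000 in
theorem frameWeyl_typeD {x z y x' z' : ℝ} (h : 2 * x + z = 2 * x' + z') (k l : Fin 4) :
    frameWeyl (typeD x z y x' z') k l = typeD (x - (2 * x + z) / 3) (z - (2 * x + z) / 3) 0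
      (x' - (2 * x + z) / 3) (z' - (2 * x + z) / 3) k l := by
  wlog hkl : k < l generalizing k l
  · rcases eq_or_lt_of_le (not_lt.mp hkl) with rfl | hlt
    · have h0 : ∀ A : Matrix (Fin 4) (Fin 4) ℝ, A = -A → A = 0 := fun A hA => by
        ext i j
        have := congrFun (congrFun hA i) j
        simp only [Matrix.neg_apply] at this
        simp only [Matrix.zero_apply]
        linarith
      rw [h0 _ (frameWeyl_swap (typeD_swap _ _ _ _ _) l l), h0 _ (typeD_swap _ _ _ _ _ l l)]
    · rw [frameWeyl_swap (typeD_swap _ _ _ _ _), typeD_swap, this l k hlt]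
  obtain rfl : z' = 2 * x + z - 2 * x' := by linarith
  refine eq_of_antisymm ?_ (so4_transpose _ _) fun i j hij => ?_
  · ext i j
    have h1 : typeD x z y x' (2 * x + z - 2 * x') k l j i
        = -typeD x z y x' (2 * x + z - 2 * x') k l i j :=
      congrFun (congrFun (so4_transpose _ _) i) j
    simp only [frameWeyl, Matrix.transpose_apply, Matrix.of_apply, Matrix.neg_apply, h1]
    ring
  rw [frameWeyl, frameRicci_typeD, Matrix.trace_diagonal, Fin.sum_univ_four, typeD, typeD, so4_eq,
    so4_eq]
  fin_cases k <;> fin_cases l <;> first | exact absurd hkl (by decide) | skip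
  all_goals fin_cases i <;> fin_cases j <;>
    first | exact absurd hij (by decide) | (simp [asd, sd, Matrix.one_apply] <;> ring)

theorem star_so4 (u v : Fin 3 → ℝ) : star (so4 u v) = so4 (-u) v := by
  change starₗ (so4 u v) = _
  have h1 : ∀ i, starₗ (asd i) = -asd i := star_asd
  have h2 : ∀ i, starₗ (sd i) = sd i := star_sd
  simp only [so4, map_smul, map_sum, map_add, h1, h2, Pi.neg_apply, neg_smul, smul_neg]

/-- The anti-self-dual Weyl eigenvalues are (x - z)/3 twice and -2(x - z)/3, and `star` reverses the
sign of exactly this half. -/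
theorem star_frameWeyl_typeD_iff {x z y x' z' : ℝ} (h : 2 * x + z = 2 * x' + z') :
    (∀ k l, star (frameWeyl (typeD x z y x' z') k l) = frameWeyl (typeD x z y x' z') k l) ↔
      x = z := by
  simp only [frameWeyl_typeD h]
  constructor
  · intro H
    have h1 := congrFun (congrFun (H 0 1) 0) 1
    rw [typeD, star_so4, so4_eq, so4_eq] at h1
    simp [asd, sd] at h1
    linarith
  · rintro rfl k l
    have h0 : x - (2 * x + x) / 3 = 0 := by ring
    rw [typeD, star_so4, h0]
    congr 1
    ext i
    fin_cases i <;> simp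

theorem frameRicci_typeD_eq_smul_iff {x z y x' z' r : ℝ} (h : 2 * x + z = 2 * x' + z') :
    frameRicci (typeD x z y x' z') = r • 1 ↔ y = 0 ∧ 2 * x + z = r := by
  rw [frameRicci_typeD]
  constructor
  · intro H
    have h0 := congrFun (congrFun H 0) 0
    have h1 := congrFun (congrFun H 1) 1
    simp at h0 h1
    constructor <;> linarith
  · rintro ⟨rfl, rfl⟩
    obtain rfl : z' = 2 * x + z - 2 * x' := by linarith
    ext i j
    fin_cases i <;> fin_cases j <;> simp

theorem typeD_eq_zero_iff {x z y x' z' : ℝ} :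
    (∀ k l, typeD x z y x' z' k l = 0) ↔ x = 0 ∧ z = 0 ∧ y = 0 ∧ x' = 0 ∧ z' = 0 := by
  constructor
  · intro H
    -- These entries are halves of x + x', x' - x, z + z' + 2y, z' - z and z + z' - 2y.
    have h1 := congrFun (congrFun (H 0 1) 0) 1
    have h2 := congrFun (congrFun (H 0 1) 2) 3
    have h3 := congrFun (congrFun (H 0 3) 0) 3
    have h4 := congrFun (congrFun (H 0 3) 1) 2
    have h5 := congrFun (congrFun (H 1 2) 1) 2
    simp [typeD, so4_eq, asd, sd] at h1 h2 h3 h4 h5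
    refine ⟨?_, ?_, ?_, ?_, ?_⟩ <;> linarith
  · rintro ⟨rfl, rfl, rfl, rfl, rfl⟩ k l
    simp [typeD, so4, Fin.sum_univ_three]

/-! ## The connection and curvature of the Plebański–Demiański coframe, pointwise

Here `p, q` are coordinates, `P, P₁, P₂` and `Q, Q₁, Q₂` stand for the values of the structure
functions and of their derivatives, and `w` for `√(-P Q)`. The sign `ε` is `-1` for anti-self-dual
and `1` for self-dual quantities. -/

/-- The function `m = (1 + ε p q) (p - q)`. -/
def mVal (ε p q : ℝ) : ℝ := (1 + ε * (p * q)) * (p - q)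

/-- The `p`-derivative of `m`. -/
def mVal_p (ε p q : ℝ) : ℝ := 1 + ε * (2 * p * q - q ^ 2)

/-- The `q`-derivative of `m`. -/
def mVal_q (ε p q : ℝ) : ℝ := -1 + ε * (p ^ 2 - 2 * p * q)

/-- The function `½ m² ∂_p (P / m²)`. -/
def vP (ε p q P P₁ : ℝ) : ℝ := P₁ / 2 - P * mVal_p ε p q / mVal ε p q

/-- The function `½ m² ∂_q (Q / m²)`. -/
def vQ (ε p q Q Q₁ : ℝ) : ℝ := Q₁ / 2 - Q * mVal_q ε p q / mVal ε p q

/-- The self-dual or anti-self-dual part of the connection form. -/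
def connVal (ε p q P P₁ Q Q₁ w : ℝ) : Fin 3 → Fin 4 → ℝ :=
  ![![0, 0, w * (p ^ 2 + ε) / (P * mVal ε p q), -(w * (q ^ 2 + ε) / (Q * mVal ε p q))],
    ![-(w / mVal ε p q), -ε * (w / mVal ε p q), 0, 0],
    ![(-ε * q ^ 2 * vP ε p q P P₁ - vQ ε p q Q Q₁) / ((1 - p * q) * (1 + p * q)),
      (p ^ 2 * vQ ε p q Q Q₁ + ε * vP ε p q P P₁) / ((1 - p * q) * (1 + p * q)), 0, 0]]

/-- The `p`-derivative of `connVal`. -/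
def connVal_p (ε p q P P₁ P₂ Q Q₁ w : ℝ) : Fin 3 → Fin 4 → ℝ :=
  let m := mVal ε p q
  let mp := mVal_p ε p q
  let s := (1 - p * q) * (1 + p * q)
  let wp := w * P₁ / (2 * P)
  let vPp := P₂ / 2 - P₁ * mp / m - P * (2 * ε * q * m - mp ^ 2) / m ^ 2
  let vQp := -Q * (ε * (2 * p - 2 * q) * m - mp * mVal_q ε p q) / m ^ 2
  ![![0, 0, (wp * (p ^ 2 + ε) + 2 * w * p) / (P * m)
        - w * (p ^ 2 + ε) * (P₁ * m + P * mp) / (P * m) ^ 2,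
      -(wp * (q ^ 2 + ε) / (Q * m)) + w * (q ^ 2 + ε) * mp / (Q * m ^ 2)],
    ![-(wp / m) + w * mp / m ^ 2, -ε * (wp / m - w * mp / m ^ 2), 0, 0],
    ![(-ε * q ^ 2 * vPp - vQp) / s
        + (-ε * q ^ 2 * vP ε p q P P₁ - vQ ε p q Q Q₁) * (2 * p * q ^ 2) / s ^ 2,
      (2 * p * vQ ε p q Q Q₁ + p ^ 2 * vQp + ε * vPp) / s
        + (p ^ 2 * vQ ε p q Q Q₁ + ε * vP ε p q P P₁) * (2 * p * q ^ 2) / s ^ 2, 0, 0]]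

/-- The `q`-derivative of `connVal`. -/
def connVal_q (ε p q P P₁ Q Q₁ Q₂ w : ℝ) : Fin 3 → Fin 4 → ℝ :=
  let m := mVal ε p q
  let mq := mVal_q ε p q
  let s := (1 - p * q) * (1 + p * q)
  let wq := w * Q₁ / (2 * Q)
  let vPq := -P * (ε * (2 * p - 2 * q) * m - mVal_p ε p q * mq) / m ^ 2
  let vQq := Q₂ / 2 - Q₁ * mq / m - Q * (-2 * ε * p * m - mq ^ 2) / m ^ 2
  ![![0, 0, wq * (p ^ 2 + ε) / (P * m) - w * (p ^ 2 + ε) * mq / (P * m ^ 2),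
      -((wq * (q ^ 2 + ε) + 2 * w * q) / (Q * m))
        + w * (q ^ 2 + ε) * (Q₁ * m + Q * mq) / (Q * m) ^ 2],
    ![-(wq / m) + w * mq / m ^ 2, -ε * (wq / m - w * mq / m ^ 2), 0, 0],
    ![(-ε * (2 * q * vP ε p q P P₁ + q ^ 2 * vPq) - vQq) / s
        + (-ε * q ^ 2 * vP ε p q P P₁ - vQ ε p q Q Q₁) * (2 * p ^ 2 * q) / s ^ 2,
      (p ^ 2 * vQq + ε * vPq) / s
        + (p ^ 2 * vQ ε p q Q Q₁ + ε * vP ε p q P P₁) * (2 * p ^ 2 * q) / s ^ 2, 0, 0]]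

/-- The coframe, where `C` is the component of `dp`. -/
def frameVal (p q P w C : ℝ) : Matrix (Fin 4) (Fin 4) ℝ :=
  let s := (1 - p * q) * (1 + p * q)
  !![C * w / s, -p ^ 2 * (C * w / s), 0, 0; -q ^ 2 * (C * P / s), C * P / s, 0, 0; 0, 0, C, 0;
    0, 0, 0, C * P / w]

/-- The `p`-derivative of the logarithm of `C`. -/
def logCp (p q P P₁ : ℝ) : ℝ :=
  -(p * q ^ 2 / ((1 - p * q) * (1 + p * q))) - 1 / (p - q) - P₁ / (2 * P)

/-- The `q`-derivative of the logarithm of `C`. -/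
def logCq (p q : ℝ) : ℝ := -(p ^ 2 * q / ((1 - p * q) * (1 + p * q))) + 1 / (p - q)

/-- The partial derivatives of the coframe. -/
def dframeVal (p q P P₁ Q Q₁ w C : ℝ) : Fin 4 → Matrix (Fin 4) (Fin 4) ℝ :=
  let s := (1 - p * q) * (1 + p * q)
  let A := C * w / s
  let B := C * P / s
  let D := C * P / w
  let Ap := A * (logCp p q P P₁ + P₁ / (2 * P) + 2 * p * q ^ 2 / s)
  let Aq := A * (logCq p q + Q₁ / (2 * Q) + 2 * p ^ 2 * q / s)
  let Bp := B * (logCp p q P P₁ + P₁ / P + 2 * p * q ^ 2 / s)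
  let Bq := B * (logCq p q + 2 * p ^ 2 * q / s)
  ![0, 0,
    !![Ap, -p ^ 2 * Ap - 2 * p * A, 0, 0; -q ^ 2 * Bp, Bp, 0, 0; 0, 0, C * logCp p q P P₁, 0;
      0, 0, 0, D * (logCp p q P P₁ + P₁ / (2 * P))],
    !![Aq, -p ^ 2 * Aq, 0, 0; -q ^ 2 * Bq - 2 * q * B, Bq, 0, 0; 0, 0, C * logCq p q, 0;
      0, 0, 0, D * (logCq p q - Q₁ / (2 * Q))]]

-- Cartan's first structure equation: `connVal` for ε = -1 and ε = 1 are the two halves of a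
-- torsion-free connection.
set_option maxHeartbeats 2000000 in
theorem torsion_val {p q P P₁ Q Q₁ w C : ℝ} (h1 : 1 - p * q ≠ 0) (h2 : 1 + p * q ≠ 0)
    (h3 : p - q ≠ 0) (hP : P ≠ 0) (hw : w ≠ 0) (hQ : Q = -w ^ 2 / P) (a b i : Fin 4) :
    (so4 (fun i => connVal (-1) p q P P₁ Q Q₁ w i a) (fun i => connVal 1 p q P P₁ Q Q₁ w i a)
        * frameVal p q P w C + dframeVal p q P P₁ Q Q₁ w C a) i b
      = (so4 (fun i => connVal (-1) p q P P₁ Q Q₁ w i b) (fun i => connVal 1 p q P P₁ Q Q₁ w i b)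
        * frameVal p q P w C + dframeVal p q P P₁ Q Q₁ w C b) i a := by
  wlog hab : a < b generalizing a b
  · rcases eq_or_lt_of_le (not_lt.mp hab) with rfl | hlt
    · rfl
    · exact (this b a hlt).symm
  -- With Q expressed through w and P, each component is a rational identity in independent
  -- variables and no square root remains.
  subst hQ
  -- The denominators 1 - pq, 1 + pq and p - q are kept as atoms while fractions are cleared, and
  -- expanded only for the final polynomial identity.
  obtain ⟨u, hu⟩ : ∃ u, 1 - p * q = u := ⟨_, rfl⟩
  obtain ⟨v, hv⟩ : ∃ v, 1 + p * q = v := ⟨_, rfl⟩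
  obtain ⟨t, ht⟩ : ∃ t, p - q = t := ⟨_, rfl⟩
  have hu' : 1 + -(p * q) = u := by rw [← hu]; ring
  rw [hu] at h1
  rw [hv] at h2
  rw [ht] at h3
  simp only [so4_eq, Matrix.add_apply, Matrix.smul_mul, Matrix.smul_apply, Matrix.mul_apply,
    Fin.sum_univ_four]
  fin_cases a <;> fin_cases b <;> first | exact absurd hab (by decide) | skip
  all_goals
    fin_cases i <;>
    simp [connVal, frameVal, dframeVal, vP, vQ, mVal, mVal_p, mVal_q, logCp, logCq, hu, hv, ht,
      hu'] <;>
    field_simp <;> simp only [← hu, ← hv, ← ht] <;> ring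

/-! ### Curvature eigenvalues -/

/-- The double eigenvalue of the curvature on self-dual or anti-self-dual 2-forms. -/
def curvX (ε p q P P₁ Q Q₁ : ℝ) : ℝ :=
  (p - q) / ((1 + ε * (p * q)) * ((1 - p * q) * (1 + p * q)))
    * ((p ^ 2 * ε + 1) * vQ ε p q Q Q₁ + (ε * q ^ 2 + 1) * vP ε p q P P₁)

/-- The differential expression that vanishes exactly if a half of the Weyl tensor does. -/
def weylExpr (ε p q P P₁ P₂ Q Q₁ Q₂ : ℝ) : ℝ :=
  (1 + ε * (p * q)) ^ 2 * (P₂ - Q₂) - 6 * ε * (1 + ε * (p * q)) * (q * P₁ - p * Q₁)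
    + 12 * (q ^ 2 * P - p ^ 2 * Q)

/-- The simple eigenvalue of the curvature on self-dual or anti-self-dual 2-forms. -/
def curvZ (ε p q P P₁ P₂ Q Q₁ Q₂ : ℝ) : ℝ :=
  curvX ε p q P P₁ Q Q₁ - (p - q) ^ 2 * weylExpr ε p q P P₁ P₂ Q Q₁ Q₂
    / (4 * (1 + ε * (p * q)) ^ 2 * ((1 - p * q) * (1 + p * q)))

/-- The trace-free part of the Ricci tensor. -/
def curvY (p q P P₁ P₂ Q Q₁ Q₂ : ℝ) : ℝ :=
  -- Read off from the dτ∧dq component of the third anti-self-dual curvature form, which must equal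
  -- (Z + Y)/(p - q)². The entry used does not involve w, so the argument 0 in its place is a dummy.
  -(p - q) ^ 2 * (connVal_q (-1) p q P P₁ Q Q₁ Q₂ 0 2 0 + P * (1 - q ^ 2) / mVal (-1) p q ^ 2)
    - curvZ (-1) p q P P₁ P₂ Q Q₁ Q₂

/-- The exterior derivative of the connection form plus its wedge square. -/
def spinCurvVal (ε p q P P₁ P₂ Q Q₁ Q₂ w : ℝ) (c d : Fin 4) : Fin 3 → ℝ :=
  let dη : Fin 4 → Fin 3 → Fin 4 → ℝ :=
    ![0, 0, connVal_p ε p q P P₁ P₂ Q Q₁ w, connVal_q ε p q P P₁ Q Q₁ Q₂ w]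
  let η := connVal ε p q P P₁ Q Q₁ w
  fun i => dη c i d - dη d i c + -ε * ((fun i => η i c) ⨯₃ (fun i => η i d)) i

/-- The first Bianchi identity, obtained here as an algebraic identity of the eigenvalues. -/
theorem curv_bianchi {p q P P₁ P₂ Q Q₁ Q₂ : ℝ} (h1 : 1 - p * q ≠ 0) (h2 : 1 + p * q ≠ 0)
    (h3 : p - q ≠ 0) :
    2 * curvX (-1) p q P P₁ Q Q₁ + curvZ (-1) p q P P₁ P₂ Q Q₁ Q₂
      = 2 * curvX 1 p q P P₁ Q Q₁ + curvZ 1 p q P P₁ P₂ Q Q₁ Q₂ := by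
  obtain ⟨u, hu⟩ : ∃ u, 1 - p * q = u := ⟨_, rfl⟩
  obtain ⟨v, hv⟩ : ∃ v, 1 + p * q = v := ⟨_, rfl⟩
  obtain ⟨t, ht⟩ : ∃ t, p - q = t := ⟨_, rfl⟩
  have hu' : 1 + -(p * q) = u := by rw [← hu]; ring
  rw [hu] at h1
  rw [hv] at h2
  rw [ht] at h3
  simp only [curvX, curvZ, weylExpr, vP, vQ, mVal, mVal_p, mVal_q, neg_mul, one_mul, hu, hv, ht,
    hu']
  field_simp
  simp only [← hu, ← hv, ← ht]
  ring

-- Cartan's second structure equation for the anti-self-dual half. The matrices (frame)ᵀ · asd ·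
-- frame and (frame)ᵀ · sd · frame are the coordinate components of the basic 2-forms of the
-- coframe.
set_option maxHeartbeats 4000000 in
theorem spinCurvVal_asd {p q P P₁ P₂ Q Q₁ Q₂ w C : ℝ} (h1 : 1 - p * q ≠ 0) (h2 : 1 + p * q ≠ 0)
    (h3 : p - q ≠ 0) (hP : P ≠ 0) (hw : w ≠ 0) (hQ : Q = -w ^ 2 / P)
    (hC : C ^ 2 = (1 - p * q) * (1 + p * q) / ((p - q) ^ 2 * P)) (c d : Fin 4) (hcd : c < d) :
    spinCurvVal (-1) p q P P₁ P₂ Q Q₁ Q₂ w c d =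
      ![curvX (-1) p q P P₁ Q Q₁ * ((frameVal p q P w C)ᵀ * asd 0 * frameVal p q P w C) c d,
        curvX (-1) p q P P₁ Q Q₁ * ((frameVal p q P w C)ᵀ * asd 1 * frameVal p q P w C) c d,
        curvZ (-1) p q P P₁ P₂ Q Q₁ Q₂
            * ((frameVal p q P w C)ᵀ * asd 2 * frameVal p q P w C) c d
          + curvY p q P P₁ P₂ Q Q₁ Q₂
            * ((frameVal p q P w C)ᵀ * sd 2 * frameVal p q P w C) c d] := by
  subst hQ
  obtain ⟨u, hu⟩ : ∃ u, 1 - p * q = u := ⟨_, rfl⟩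
  obtain ⟨v, hv⟩ : ∃ v, 1 + p * q = v := ⟨_, rfl⟩
  obtain ⟨t, ht⟩ : ∃ t, p - q = t := ⟨_, rfl⟩
  have hu' : 1 + -(p * q) = u := by rw [← hu]; ring
  rw [hu] at h1
  rw [hv] at h2
  rw [ht] at h3
  rw [hu, hv, ht] at hC
  -- The common factor `C` enters 2-forms only through C², which is rational by `hC`.
  have hframe : frameVal p q P w C
      = C • !![w / (u * v), -p ^ 2 * (w / (u * v)), 0, 0;
        -q ^ 2 * (P / (u * v)), P / (u * v), 0, 0; 0, 0, 1, 0; 0, 0, 0, P / w] := by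
    ext i j
    fin_cases i <;> fin_cases j <;> simp [frameVal, hu, hv] <;> ring
  have hsq : ∀ A, (frameVal p q P w C)ᵀ * A * frameVal p q P w C = (u * v / (t ^ 2 * P)) •
      ((!![w / (u * v), -p ^ 2 * (w / (u * v)), 0, 0; -q ^ 2 * (P / (u * v)), P / (u * v), 0, 0;
        0, 0, 1, 0; 0, 0, 0, P / w])ᵀ * A * !![w / (u * v), -p ^ 2 * (w / (u * v)), 0, 0;
        -q ^ 2 * (P / (u * v)), P / (u * v), 0, 0; 0, 0, 1, 0; 0, 0, 0, P / w]) := by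
    intro A
    rw [hframe, Matrix.transpose_smul, Matrix.smul_mul, Matrix.smul_mul, Matrix.mul_smul,
      smul_smul, ← pow_two, hC]
  simp only [hsq, Matrix.smul_apply, smul_eq_mul]
  ext i
  simp only [Matrix.mul_apply, Fin.sum_univ_four, Matrix.transpose_apply]
  fin_cases c <;> fin_cases d <;> first | exact absurd hcd (by decide) | skip
  all_goals
    fin_cases i <;>
    simp [spinCurvVal, cross_apply, connVal, connVal_p, connVal_q, curvX, curvZ, curvY, weylExpr,
      vP, vQ, mVal, mVal_p, mVal_q, asd, sd, hu, hv, ht, hu'] <;>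
    field_simp <;> simp only [← hu, ← hv, ← ht] <;> ring

-- The self-dual half. The same `curvY` appears as the mixed term, since the curvature operator is
-- symmetric.
set_option maxHeartbeats 4000000 in
theorem spinCurvVal_sd {p q P P₁ P₂ Q Q₁ Q₂ w C : ℝ} (h1 : 1 - p * q ≠ 0) (h2 : 1 + p * q ≠ 0)
    (h3 : p - q ≠ 0) (hP : P ≠ 0) (hw : w ≠ 0) (hQ : Q = -w ^ 2 / P)
    (hC : C ^ 2 = (1 - p * q) * (1 + p * q) / ((p - q) ^ 2 * P)) (c d : Fin 4) (hcd : c < d) :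
    spinCurvVal 1 p q P P₁ P₂ Q Q₁ Q₂ w c d =
      ![curvX 1 p q P P₁ Q Q₁ * ((frameVal p q P w C)ᵀ * sd 0 * frameVal p q P w C) c d,
        curvX 1 p q P P₁ Q Q₁ * ((frameVal p q P w C)ᵀ * sd 1 * frameVal p q P w C) c d,
        curvZ 1 p q P P₁ P₂ Q Q₁ Q₂
            * ((frameVal p q P w C)ᵀ * sd 2 * frameVal p q P w C) c d
          + curvY p q P P₁ P₂ Q Q₁ Q₂
            * ((frameVal p q P w C)ᵀ * asd 2 * frameVal p q P w C) c d] := by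
  subst hQ
  obtain ⟨u, hu⟩ : ∃ u, 1 - p * q = u := ⟨_, rfl⟩
  obtain ⟨v, hv⟩ : ∃ v, 1 + p * q = v := ⟨_, rfl⟩
  obtain ⟨t, ht⟩ : ∃ t, p - q = t := ⟨_, rfl⟩
  have hu' : 1 + -(p * q) = u := by rw [← hu]; ring
  rw [hu] at h1
  rw [hv] at h2
  rw [ht] at h3
  rw [hu, hv, ht] at hC
  have hframe : frameVal p q P w C
      = C • !![w / (u * v), -p ^ 2 * (w / (u * v)), 0, 0;
        -q ^ 2 * (P / (u * v)), P / (u * v), 0, 0; 0, 0, 1, 0; 0, 0, 0, P / w] := by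
    ext i j
    fin_cases i <;> fin_cases j <;> simp [frameVal, hu, hv] <;> ring
  have hsq : ∀ A, (frameVal p q P w C)ᵀ * A * frameVal p q P w C = (u * v / (t ^ 2 * P)) •
      ((!![w / (u * v), -p ^ 2 * (w / (u * v)), 0, 0; -q ^ 2 * (P / (u * v)), P / (u * v), 0, 0;
        0, 0, 1, 0; 0, 0, 0, P / w])ᵀ * A * !![w / (u * v), -p ^ 2 * (w / (u * v)), 0, 0;
        -q ^ 2 * (P / (u * v)), P / (u * v), 0, 0; 0, 0, 1, 0; 0, 0, 0, P / w]) := by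
    intro A
    rw [hframe, Matrix.transpose_smul, Matrix.smul_mul, Matrix.smul_mul, Matrix.mul_smul,
      smul_smul, ← pow_two, hC]
  simp only [hsq, Matrix.smul_apply, smul_eq_mul]
  ext i
  simp only [Matrix.mul_apply, Fin.sum_univ_four, Matrix.transpose_apply]
  fin_cases c <;> fin_cases d <;> first | exact absurd hcd (by decide) | skip
  all_goals
    fin_cases i <;>
    simp [spinCurvVal, cross_apply, connVal, connVal_p, connVal_q, curvX, curvZ, curvY, weylExpr,
      vP, vQ, mVal, mVal_p, mVal_q, asd, sd, hu, hv, ht, hu'] <;>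
    field_simp <;> simp only [← hu, ← hv, ← ht] <;> ring

/-! ## Functions of `p` and `q` on the chart -/

/-- `f` is differentiable at `x` with partial derivatives `(0, 0, fp, fq)`. -/
def HasPQ (f : R4 → ℝ) (fp fq : ℝ) (x : R4) : Prop :=
  HasFDerivAt f (fp • (ContinuousLinearMap.proj 2 : R4 →L[ℝ] ℝ)
    + fq • (ContinuousLinearMap.proj 3 : R4 →L[ℝ] ℝ)) x

namespace HasPQ

variable {f g : R4 → ℝ} {fp fq gp gq : ℝ} {x : R4}

theorem pd (h : HasPQ f fp fq x) (a : Fin 4) :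
    PD.pd a f x = (![0, 0, fp, fq] : Fin 4 → ℝ) a := by
  rw [PD.pd, HasFDerivAt.fderiv h]
  fin_cases a <;> simp

theorem congr (h : HasPQ f fp fq x) (hp : fp = gp) (hq : fq = gq) : HasPQ f gp gq x :=
  hp ▸ hq ▸ h

theorem const (c : ℝ) : HasPQ (fun _ => c) 0 0 x := by
  have := hasFDerivAt_const (𝕜 := ℝ) c x
  simpa [HasPQ] using this

theorem coord_p : HasPQ (fun y => y 2) 1 0 x := by
  refine (ContinuousLinearMap.proj 2 : R4 →L[ℝ] ℝ).hasFDerivAt.congr_fderiv ?_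
  module

theorem coord_q : HasPQ (fun y => y 3) 0 1 x := by
  refine (ContinuousLinearMap.proj 3 : R4 →L[ℝ] ℝ).hasFDerivAt.congr_fderiv ?_
  module

theorem comp {φ : ℝ → ℝ} {φ' : ℝ} (hφ : HasDerivAt φ φ' (f x)) (h : HasPQ f fp fq x) :
    HasPQ (fun y => φ (f y)) (φ' * fp) (φ' * fq) x := by
  refine (hφ.comp_hasFDerivAt x h).congr_fderiv ?_
  module

theorem add (hf : HasPQ f fp fq x) (hg : HasPQ g gp gq x) :
    HasPQ (fun y => f y + g y) (fp + gp) (fq + gq) x := by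
  have := HasFDerivAt.add hf hg
  refine this.congr_fderiv ?_
  module

theorem neg (hf : HasPQ f fp fq x) : HasPQ (fun y => -f y) (-fp) (-fq) x := by
  have := HasFDerivAt.neg hf
  refine this.congr_fderiv ?_
  module

theorem sub (hf : HasPQ f fp fq x) (hg : HasPQ g gp gq x) :
    HasPQ (fun y => f y - g y) (fp - gp) (fq - gq) x := by
  have := HasFDerivAt.sub hf hg
  refine this.congr_fderiv ?_
  module

theorem mul (hf : HasPQ f fp fq x) (hg : HasPQ g gp gq x) :
    HasPQ (fun y => f y * g y) (fp * g x + f x * gp) (fq * g x + f x * gq) x := by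
  have := HasFDerivAt.mul hf hg
  refine this.congr_fderiv ?_
  module

theorem div (hf : HasPQ f fp fq x) (hg : HasPQ g gp gq x) (h0 : g x ≠ 0) :
    HasPQ (fun y => f y / g y) ((fp * g x - f x * gp) / g x ^ 2)
      ((fq * g x - f x * gq) / g x ^ 2) x := by
  have := hf.mul (comp (hasDerivAt_inv h0) hg)
  simp only [div_eq_mul_inv (f _)]
  refine this.congr ?_ ?_ <;> field_simp <;> ring

theorem sqrt (hf : HasPQ f fp fq x) (h0 : 0 < f x) :
    HasPQ (fun y => √(f y)) (√(f x) * (fp / (2 * f x))) (√(f x) * (fq / (2 * f x))) x := by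
  have hs : √(f x) ≠ 0 := (Real.sqrt_pos.2 h0).ne'
  have h2 : f x = √(f x) ^ 2 := (Real.sq_sqrt h0.le).symm
  refine (comp (Real.hasDerivAt_sqrt h0.ne') hf).congr ?_ ?_ <;>
  · rw [h2, Real.sqrt_sq (Real.sqrt_nonneg _)]
    field_simp

theorem pow (hf : HasPQ f fp fq x) (n : ℕ) :
    HasPQ (fun y => f y ^ n) (n * f x ^ (n - 1) * fp) (n * f x ^ (n - 1) * fq) x :=
  comp (hasDerivAt_pow n (f x)) hf

end HasPQ

theorem contDiffAt_deriv {f : ℝ → ℝ} {t : ℝ} (h : ContDiffAt ℝ ∞ f t) :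
    ContDiffAt ℝ ∞ (deriv f) t := by
  have h1 : ContDiffAt ℝ ∞ (fun u => fderiv ℝ f u 1) t :=
    (h.fderiv_right (m := ∞) (by simp)).clm_apply contDiffAt_const
  exact h1

theorem hasDerivAt_deriv {f : ℝ → ℝ} {t : ℝ} (h : ContDiffAt ℝ ∞ f t) :
    HasDerivAt (deriv f) (deriv (deriv f) t) t :=
  ((contDiffAt_deriv h).differentiableAt (by simp)).hasDerivAt

/-! ## The Plebański–Demiański coframe -/

/-- The function `√(-P Q)`. -/
def wFun (P Q : ℝ → ℝ) (y : R4) : ℝ := √(-(P (y 2) * Q (y 3)))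

/-- The component of `dp` in the coframe. -/
def cFun (P : ℝ → ℝ) (y : R4) : ℝ :=
  √((1 - y 2 * y 3) * (1 + y 2 * y 3) / ((y 2 - y 3) ^ 2 * P (y 2)))

/-- The coframe of the Plebański–Demiański metric. -/
def frame (P Q : ℝ → ℝ) (y : R4) : Matrix (Fin 4) (Fin 4) ℝ :=
  frameVal (y 2) (y 3) (P (y 2)) (wFun P Q y) (cFun P y)

/-- The components of the connection form of the coframe. -/
def conn (P Q : ℝ → ℝ) (ε : ℝ) (i : Fin 3) (a : Fin 4) (y : R4) : ℝ :=
  connVal ε (y 2) (y 3) (P (y 2)) (deriv P (y 2)) (Q (y 3)) (deriv Q (y 3)) (wFun P Q y) i a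

section Point

variable {P Q : ℝ → ℝ} {x : R4}

/-- The regularity conditions at a point of the chart. -/
structure IsGoodPoint (P Q : ℝ → ℝ) (x : R4) : Prop where
  ne : x 2 ≠ x 3
  pos : 0 < 1 - (x 2) ^ 2 * (x 3) ^ 2
  smooth_P : ContDiffAt ℝ ∞ P (x 2)
  smooth_Q : ContDiffAt ℝ ∞ Q (x 3)
  P_pos : 0 < P (x 2)
  Q_neg : Q (x 3) < 0

namespace IsGoodPoint

theorem abs_lt (h : IsGoodPoint P Q x) : |x 2 * x 3| < 1 := by
  rw [← sq_lt_one_iff_abs_lt_one, mul_pow]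
  linarith [h.pos]

theorem minus_pos (h : IsGoodPoint P Q x) : 0 < 1 - x 2 * x 3 := by
  linarith [(_root_.abs_lt.1 h.abs_lt).2]

theorem plus_pos (h : IsGoodPoint P Q x) : 0 < 1 + x 2 * x 3 := by
  linarith [(_root_.abs_lt.1 h.abs_lt).1]

theorem sub_ne (h : IsGoodPoint P Q x) : x 2 - x 3 ≠ 0 := sub_ne_zero.2 h.ne

theorem s_ne (h : IsGoodPoint P Q x) : (1 - x 2 * x 3) * (1 + x 2 * x 3) ≠ 0 :=
  (mul_pos h.minus_pos h.plus_pos).ne'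

theorem neg_mul_pos (h : IsGoodPoint P Q x) : 0 < -(P (x 2) * Q (x 3)) := by
  have := mul_pos h.P_pos (neg_pos.2 h.Q_neg)
  linarith

theorem w_pos (h : IsGoodPoint P Q x) : 0 < wFun P Q x := Real.sqrt_pos.2 h.neg_mul_pos

theorem w_sq (h : IsGoodPoint P Q x) : wFun P Q x ^ 2 = -(P (x 2) * Q (x 3)) :=
  Real.sq_sqrt h.neg_mul_pos.le

theorem Q_eq (h : IsGoodPoint P Q x) : Q (x 3) = -wFun P Q x ^ 2 / P (x 2) := by
  rw [h.w_sq, neg_neg, mul_div_cancel_left₀ _ h.P_pos.ne']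

theorem c_arg_pos (h : IsGoodPoint P Q x) :
    0 < (1 - x 2 * x 3) * (1 + x 2 * x 3) / ((x 2 - x 3) ^ 2 * P (x 2)) :=
  div_pos (mul_pos h.minus_pos h.plus_pos) (mul_pos (sq_pos_of_ne_zero h.sub_ne) h.P_pos)

theorem c_pos (h : IsGoodPoint P Q x) : 0 < cFun P x := Real.sqrt_pos.2 h.c_arg_pos

theorem c_sq (h : IsGoodPoint P Q x) :
    cFun P x ^ 2 = (1 - x 2 * x 3) * (1 + x 2 * x 3) / ((x 2 - x 3) ^ 2 * P (x 2)) :=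
  Real.sq_sqrt h.c_arg_pos.le

theorem hasDerivAt_P (h : IsGoodPoint P Q x) : HasDerivAt P (deriv P (x 2)) (x 2) :=
  (h.smooth_P.differentiableAt (by simp)).hasDerivAt

theorem hasDerivAt_Q (h : IsGoodPoint P Q x) : HasDerivAt Q (deriv Q (x 3)) (x 3) :=
  (h.smooth_Q.differentiableAt (by simp)).hasDerivAt

theorem hP (h : IsGoodPoint P Q x) : HasPQ (fun y => P (y 2)) (deriv P (x 2)) 0 x :=
  (HasPQ.comp h.hasDerivAt_P HasPQ.coord_p).congr (by simp) (by simp)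

theorem hQ (h : IsGoodPoint P Q x) : HasPQ (fun y => Q (y 3)) 0 (deriv Q (x 3)) x :=
  (HasPQ.comp h.hasDerivAt_Q HasPQ.coord_q).congr (by simp) (by simp)

theorem hP' (h : IsGoodPoint P Q x) :
    HasPQ (fun y => deriv P (y 2)) (deriv (deriv P) (x 2)) 0 x :=
  (HasPQ.comp (hasDerivAt_deriv h.smooth_P) HasPQ.coord_p).congr (by simp) (by simp)

theorem hQ' (h : IsGoodPoint P Q x) :
    HasPQ (fun y => deriv Q (y 3)) 0 (deriv (deriv Q) (x 3)) x :=
  (HasPQ.comp (hasDerivAt_deriv h.smooth_Q) HasPQ.coord_q).congr (by simp) (by simp)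

theorem hw (h : IsGoodPoint P Q x) :
    HasPQ (wFun P Q) (wFun P Q x * deriv P (x 2) / (2 * P (x 2)))
      (wFun P Q x * deriv Q (x 3) / (2 * Q (x 3))) x := by
  have hP0 := h.P_pos.ne'
  have hQ0 := h.Q_neg.ne
  refine ((h.hP.mul h.hQ).neg.sqrt h.neg_mul_pos).congr ?_ ?_ <;>
  · rw [wFun]
    field_simp
    try ring

theorem hs : HasPQ (fun y => (1 - y 2 * y 3) * (1 + y 2 * y 3)) (-2 * x 2 * x 3 ^ 2)
    (-2 * x 2 ^ 2 * x 3) x := by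
  refine (((HasPQ.const 1).sub (HasPQ.coord_p.mul HasPQ.coord_q)).mul
    ((HasPQ.const 1).add (HasPQ.coord_p.mul HasPQ.coord_q))).congr ?_ ?_ <;> ring

theorem hc (h : IsGoodPoint P Q x) :
    HasPQ (cFun P) (cFun P x * logCp (x 2) (x 3) (P (x 2)) (deriv P (x 2)))
      (cFun P x * logCq (x 2) (x 3)) x := by
  have hP0 := h.P_pos.ne'
  have h3 := h.sub_ne
  have h1 := h.minus_pos.ne'
  have h2 := h.plus_pos.ne'
  have hd : (x 2 - x 3) ^ 2 * P (x 2) ≠ 0 := mul_ne_zero (pow_ne_zero _ h3) hP0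
  refine ((hs.div (((HasPQ.coord_p.sub HasPQ.coord_q).pow 2).mul h.hP) hd).sqrt
    h.c_arg_pos).congr ?_ ?_ <;>
  · change cFun P x * _ = _
    congr 1
    obtain ⟨u, hu⟩ : ∃ u, 1 - x 2 * x 3 = u := ⟨_, rfl⟩
    obtain ⟨v, hv⟩ : ∃ v, 1 + x 2 * x 3 = v := ⟨_, rfl⟩
    obtain ⟨t, ht⟩ : ∃ t, x 2 - x 3 = t := ⟨_, rfl⟩
    rw [hu] at h1
    rw [hv] at h2
    rw [ht] at h3
    simp only [logCp, logCq, hu, hv, ht]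
    field_simp
    simp only [← hu, ← hv, ← ht]
    ring

theorem mVal_ne (h : IsGoodPoint P Q x) {ε : ℝ} (hε : ε = -1 ∨ ε = 1) :
    mVal ε (x 2) (x 3) ≠ 0 := by
  have h1 := h.minus_pos.ne'
  have h2 := h.plus_pos.ne'
  refine mul_ne_zero ?_ h.sub_ne
  rcases hε with rfl | rfl
  · rwa [neg_one_mul, ← sub_eq_add_neg]
  · rwa [one_mul]

theorem hm (ε : ℝ) : HasPQ (fun y => mVal ε (y 2) (y 3)) (mVal_p ε (x 2) (x 3))
    (mVal_q ε (x 2) (x 3)) x := by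
  refine (((HasPQ.const 1).add ((HasPQ.const ε).mul (HasPQ.coord_p.mul HasPQ.coord_q))).mul
    (HasPQ.coord_p.sub HasPQ.coord_q)).congr ?_ ?_ <;>
  · simp only [mVal_p, mVal_q]
    ring

theorem hm_p (ε : ℝ) : HasPQ (fun y => mVal_p ε (y 2) (y 3)) (2 * ε * x 3)
    (ε * (2 * x 2 - 2 * x 3)) x := by
  refine ((HasPQ.const 1).add ((HasPQ.const ε).mul ((((HasPQ.const 2).mul HasPQ.coord_p).mul
    HasPQ.coord_q).sub (HasPQ.coord_q.pow 2)))).congr ?_ ?_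
  · simp
    ring
  · simp

theorem hm_q (ε : ℝ) : HasPQ (fun y => mVal_q ε (y 2) (y 3)) (ε * (2 * x 2 - 2 * x 3))
    (-2 * ε * x 2) x := by
  refine ((HasPQ.const (-1)).add ((HasPQ.const ε).mul ((HasPQ.coord_p.pow 2).sub
    (((HasPQ.const 2).mul HasPQ.coord_p).mul HasPQ.coord_q)))).congr ?_ ?_
  · simp
  · simp
    ring

theorem hvP (h : IsGoodPoint P Q x) {ε : ℝ} (hm0 : mVal ε (x 2) (x 3) ≠ 0) :
    HasPQ (fun y => vP ε (y 2) (y 3) (P (y 2)) (deriv P (y 2)))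
      (deriv (deriv P) (x 2) / 2 - deriv P (x 2) * mVal_p ε (x 2) (x 3) / mVal ε (x 2) (x 3)
        - P (x 2) * (2 * ε * x 3 * mVal ε (x 2) (x 3) - mVal_p ε (x 2) (x 3) ^ 2)
          / mVal ε (x 2) (x 3) ^ 2)
      (-P (x 2) * (ε * (2 * x 2 - 2 * x 3) * mVal ε (x 2) (x 3)
        - mVal_p ε (x 2) (x 3) * mVal_q ε (x 2) (x 3)) / mVal ε (x 2) (x 3) ^ 2) x := by
  refine ((h.hP'.div (HasPQ.const 2) two_ne_zero).sub ((h.hP.mul (hm_p ε)).div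
    (hm ε) hm0)).congr ?_ ?_ <;> field_simp <;> ring

theorem hvQ (h : IsGoodPoint P Q x) {ε : ℝ} (hm0 : mVal ε (x 2) (x 3) ≠ 0) :
    HasPQ (fun y => vQ ε (y 2) (y 3) (Q (y 3)) (deriv Q (y 3)))
      (-Q (x 3) * (ε * (2 * x 2 - 2 * x 3) * mVal ε (x 2) (x 3)
        - mVal_p ε (x 2) (x 3) * mVal_q ε (x 2) (x 3)) / mVal ε (x 2) (x 3) ^ 2)
      (deriv (deriv Q) (x 3) / 2 - deriv Q (x 3) * mVal_q ε (x 2) (x 3) / mVal ε (x 2) (x 3)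
        - Q (x 3) * (-2 * ε * x 2 * mVal ε (x 2) (x 3) - mVal_q ε (x 2) (x 3) ^ 2)
          / mVal ε (x 2) (x 3) ^ 2) x := by
  refine ((h.hQ'.div (HasPQ.const 2) two_ne_zero).sub ((h.hQ.mul (hm_q ε)).div
    (hm ε) hm0)).congr ?_ ?_ <;> field_simp <;> ring

/-- Certifies that the closed forms `connVal_p` and `connVal_q`, used in the pointwise algebra,
really are the partial derivatives of the connection components. -/
theorem hconn (h : IsGoodPoint P Q x) {ε : ℝ} (hε : ε = -1 ∨ ε = 1) (i : Fin 3) (a : Fin 4) :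
    HasPQ (conn P Q ε i a)
      (connVal_p ε (x 2) (x 3) (P (x 2)) (deriv P (x 2)) (deriv (deriv P) (x 2)) (Q (x 3))
        (deriv Q (x 3)) (wFun P Q x) i a)
      (connVal_q ε (x 2) (x 3) (P (x 2)) (deriv P (x 2)) (Q (x 3)) (deriv Q (x 3))
        (deriv (deriv Q) (x 3)) (wFun P Q x) i a) x := by
  have hm0 := h.mVal_ne hε
  have hP0 := h.P_pos.ne'
  have hQ0 := h.Q_neg.ne
  have hs0 := h.s_ne
  have hwm := h.hw.div (hm ε) hm0
  have hq2 : HasPQ (fun y => -ε * y 3 ^ 2) 0 (-ε * (2 * x 3)) x :=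
    ((HasPQ.const (-ε)).mul (HasPQ.coord_q.pow 2)).congr (by simp) (by simp)
  have h12 := (h.hw.mul ((HasPQ.coord_p.pow 2).add (HasPQ.const ε))).div (h.hP.mul (hm ε))
    (mul_ne_zero hP0 hm0)
  have h13 := ((h.hw.mul ((HasPQ.coord_q.pow 2).add (HasPQ.const ε))).div (h.hQ.mul (hm ε))
    (mul_ne_zero hQ0 hm0)).neg
  have h30 := ((hq2.mul (h.hvP hm0)).sub (h.hvQ hm0)).div hs hs0
  have h31 := (((HasPQ.coord_p.pow 2).mul (h.hvQ hm0)).add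
    ((HasPQ.const ε).mul (h.hvP hm0))).div hs hs0
  obtain ⟨m, hm'⟩ : ∃ m, mVal ε (x 2) (x 3) = m := ⟨_, rfl⟩
  obtain ⟨s, hs'⟩ : ∃ s, (1 - x 2 * x 3) * (1 + x 2 * x 3) = s := ⟨_, rfl⟩
  rw [hs'] at hs0
  rw [hm'] at hm0
  fin_cases i <;> fin_cases a
  any_goals exact HasPQ.const 0
  · refine HasPQ.congr h12 ?_ ?_ <;> simp [connVal_p, connVal_q, hm'] <;> field_simp
  · refine HasPQ.congr h13 ?_ ?_ <;> simp [connVal_p, connVal_q, hm'] <;> field_simp <;> ring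
  · refine HasPQ.congr hwm.neg ?_ ?_ <;> simp [connVal_p, connVal_q, hm'] <;> field_simp <;> ring
  · refine HasPQ.congr ((HasPQ.const (-ε)).mul hwm) ?_ ?_ <;>
      simp [connVal_p, connVal_q, hm', -mul_eq_mul_left_iff] <;> field_simp
  · refine HasPQ.congr h30 ?_ ?_ <;> simp only [connVal_p, connVal_q, hm', hs'] <;> simp <;>
      field_simp <;> ring
  · refine HasPQ.congr h31 ?_ ?_ <;> simp only [connVal_p, connVal_q, hm', hs'] <;> simp <;>
      field_simp

end IsGoodPoint

end Point

/-! ## The coframe and curvature of the Plebański–Demiański metric -/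

namespace IsGoodPoint

variable {P Q : ℝ → ℝ} {x : R4}

theorem hframe (h : IsGoodPoint P Q x) (i b : Fin 4) :
    HasPQ (fun y => frame P Q y i b)
      (dframeVal (x 2) (x 3) (P (x 2)) (deriv P (x 2)) (Q (x 3)) (deriv Q (x 3)) (wFun P Q x)
        (cFun P x) 2 i b)
      (dframeVal (x 2) (x 3) (P (x 2)) (deriv P (x 2)) (Q (x 3)) (deriv Q (x 3)) (wFun P Q x)
        (cFun P x) 3 i b) x := by
  have hP0 := h.P_pos.ne'
  have hQ0 := h.Q_neg.ne
  have hw0 := h.w_pos.ne'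
  have hs0 := h.s_ne
  have hA := (h.hc.mul h.hw).div hs hs0
  have hB := (h.hc.mul h.hP).div hs hs0
  have hD := (h.hc.mul h.hP).div h.hw hw0
  obtain ⟨s, hs'⟩ : ∃ s, (1 - x 2 * x 3) * (1 + x 2 * x 3) = s := ⟨_, rfl⟩
  have hpA := ((HasPQ.coord_p.pow 2).neg.mul hA)
  have hqB := ((HasPQ.coord_q.pow 2).neg.mul hB)
  simp only [hs'] at hA hB hD hpA hqB
  rw [hs'] at hs0
  fin_cases i <;> fin_cases b
  any_goals exact HasPQ.const 0
  · refine HasPQ.congr hA ?_ ?_ <;> simp only [dframeVal, hs'] <;> simp <;> field_simp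
  · refine HasPQ.congr hpA ?_ ?_ <;> simp only [dframeVal, hs'] <;>
      simp [-mul_eq_mul_left_iff] <;> field_simp <;> ring
  · refine HasPQ.congr hqB ?_ ?_ <;> simp only [dframeVal, hs'] <;>
      simp [-mul_eq_mul_left_iff] <;> field_simp <;> ring
  · refine HasPQ.congr hB ?_ ?_ <;> simp only [dframeVal, hs'] <;> simp <;> field_simp
  · exact h.hc
  · refine HasPQ.congr hD ?_ ?_ <;> simp only [dframeVal] <;> simp <;> field_simp <;> ring

theorem pdM_frame (h : IsGoodPoint P Q x) (a : Fin 4) :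
    pdM a (frame P Q) x = dframeVal (x 2) (x 3) (P (x 2)) (deriv P (x 2)) (Q (x 3))
      (deriv Q (x 3)) (wFun P Q x) (cFun P x) a := by
  ext i b
  rw [pdM_apply, (h.hframe i b).pd]
  fin_cases a <;> rfl

theorem contDiffAt_frame (h : IsGoodPoint P Q x) (i b : Fin 4) :
    ContDiffAt ℝ ∞ (fun y => frame P Q y i b) x := by
  have hp : ContDiffAt ℝ ∞ (fun y : R4 => y 2) x := by fun_prop
  have hq : ContDiffAt ℝ ∞ (fun y : R4 => y 3) x := by fun_prop
  have hP : ContDiffAt ℝ ∞ (fun y : R4 => P (y 2)) x :=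
    h.smooth_P.comp x hp
  have hQ : ContDiffAt ℝ ∞ (fun y : R4 => Q (y 3)) x :=
    h.smooth_Q.comp x hq
  have hs : ContDiffAt ℝ ∞ (fun y : R4 => (1 - y 2 * y 3) * (1 + y 2 * y 3)) x := by fun_prop
  have hw : ContDiffAt ℝ ∞ (wFun P Q) x := (hP.mul hQ).neg.sqrt h.neg_mul_pos.ne'
  have hC : ContDiffAt ℝ ∞ (cFun P) x :=
    (hs.div (((hp.sub hq).pow 2).mul hP)
      (mul_ne_zero (pow_ne_zero _ h.sub_ne) h.P_pos.ne')).sqrt h.c_arg_pos.ne'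
  have hA := (hC.mul hw).div hs h.s_ne
  have hB := (hC.mul hP).div hs h.s_ne
  fin_cases i <;> fin_cases b
  any_goals exact contDiffAt_const
  · exact hA
  · exact (hp.pow 2).neg.mul hA
  · exact (hq.pow 2).neg.mul hB
  · exact hB
  · exact hC
  · exact (hC.mul hP).div hw h.w_pos.ne'

theorem metric_eq_frame (h : IsGoodPoint P Q x) :
    metric P Q x = (frame P Q x)ᵀ * frame P Q x := by
  have h1 := h.minus_pos.ne'
  have h2 := h.plus_pos.ne'
  have h3 := h.sub_ne
  have hP := h.P_pos.ne'
  have hw := h.w_pos.ne'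
  have hC := h.c_sq
  have hs : 1 - x 2 ^ 2 * x 3 ^ 2 = (1 - x 2 * x 3) * (1 + x 2 * x 3) := by ring
  simp only [metric, frame, h.Q_eq, hs]
  generalize wFun P Q x = w at *
  generalize cFun P x = C at *
  generalize P (x 2) = P₀ at *
  have hframe : frameVal (x 2) (x 3) P₀ w C
      = C • frameVal (x 2) (x 3) P₀ w 1 := by
    ext i j
    fin_cases i <;> fin_cases j <;> simp [frameVal] <;> ring
  rw [hframe, Matrix.transpose_smul, Matrix.smul_mul, Matrix.mul_smul, smul_smul, ← pow_two, hC]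
  obtain ⟨u, hu⟩ : ∃ u, 1 - x 2 * x 3 = u := ⟨_, rfl⟩
  obtain ⟨v, hv⟩ : ∃ v, 1 + x 2 * x 3 = v := ⟨_, rfl⟩
  obtain ⟨t, ht⟩ : ∃ t, x 2 - x 3 = t := ⟨_, rfl⟩
  rw [hu] at h1
  rw [hv] at h2
  rw [ht] at h3
  simp only [hu, hv, ht, frameVal]
  ext i j
  fin_cases i <;> fin_cases j <;>
    simp [Matrix.mul_apply, Fin.sum_univ_four, thetaTau, thetaPhi, dp, dq] <;>
    field_simp

theorem det_frame_pos (h : IsGoodPoint P Q x) : 0 < (frame P Q x).det := by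
  have hs := mul_pos h.minus_pos h.plus_pos
  have hdet : (frame P Q x).det = cFun P x ^ 4 * P (x 2) ^ 2
      / ((1 - x 2 * x 3) * (1 + x 2 * x 3)) := by
    have h1 := h.minus_pos.ne'
    have h2 := h.plus_pos.ne'
    have hw := h.w_pos.ne'
    rw [det_four, frame, frameVal]
    simp
    have hs0 := hs.ne'
    obtain ⟨s, hs'⟩ : ∃ s, (1 - x 2 * x 3) * (1 + x 2 * x 3) = s := ⟨_, rfl⟩
    rw [hs'] at hs0
    rw [hs']
    field_simp
    rw [← hs']
    ring
  rw [hdet]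
  exact div_pos (mul_pos (pow_pos h.c_pos 4) (pow_pos h.P_pos 2)) hs

theorem differentiableAt_conn (h : IsGoodPoint P Q x) {ε : ℝ} (hε : ε = -1 ∨ ε = 1) (i : Fin 3)
    (a : Fin 4) : DifferentiableAt ℝ (conn P Q ε i a) x :=
  HasFDerivAt.differentiableAt (h.hconn hε i a)

theorem spinCurv_conn (h : IsGoodPoint P Q x) {ε : ℝ} (hε : ε = -1 ∨ ε = 1) (c d : Fin 4) :
    spinCurv (-ε) (conn P Q ε) c d x = spinCurvVal ε (x 2) (x 3) (P (x 2)) (deriv P (x 2))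
      (deriv (deriv P) (x 2)) (Q (x 3)) (deriv Q (x 3)) (deriv (deriv Q) (x 3)) (wFun P Q x)
      c d := by
  ext i
  simp only [spinCurv, spinCurvVal, (h.hconn hε i _).pd]
  congr 1
  fin_cases c <;> fin_cases d <;> rfl

/-- The curvature of the Plebański–Demiański metric in its coframe. -/
def pdCurv (P Q : ℝ → ℝ) (x : R4) : Fin 4 → Fin 4 → Matrix (Fin 4) (Fin 4) ℝ :=
  typeD (curvX (-1) (x 2) (x 3) (P (x 2)) (deriv P (x 2)) (Q (x 3)) (deriv Q (x 3)))
    (curvZ (-1) (x 2) (x 3) (P (x 2)) (deriv P (x 2)) (deriv (deriv P) (x 2)) (Q (x 3))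
      (deriv Q (x 3)) (deriv (deriv Q) (x 3)))
    (curvY (x 2) (x 3) (P (x 2)) (deriv P (x 2)) (deriv (deriv P) (x 2)) (Q (x 3))
      (deriv Q (x 3)) (deriv (deriv Q) (x 3)))
    (curvX 1 (x 2) (x 3) (P (x 2)) (deriv P (x 2)) (Q (x 3)) (deriv Q (x 3)))
    (curvZ 1 (x 2) (x 3) (P (x 2)) (deriv P (x 2)) (deriv (deriv P) (x 2)) (Q (x 3))
      (deriv Q (x 3)) (deriv (deriv Q) (x 3)))

/-- Both sides are skew in `c d`, so the structure equations for c < d suffice. -/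
theorem curvForm_conn (h : IsGoodPoint P Q x) (c d : Fin 4) :
    curvForm (spinConn (conn P Q (-1)) (conn P Q 1)) c d x
      = pull₂ (frame P Q x) (pdCurv P Q x) c d := by
  wlog hcd : c < d generalizing c d
  · have hskew : ∀ c d, pull₂ (frame P Q x) (pdCurv P Q x) c d
        = -pull₂ (frame P Q x) (pdCurv P Q x) d c := by
      intro c d
      simp only [pull₂, ← Finset.sum_neg_distrib]
      rw [Finset.sum_comm]
      refine Finset.sum_congr rfl fun l _ => Finset.sum_congr rfl fun k _ => ?_
      rw [pdCurv, typeD_swap _ _ _ _ _ k l, smul_neg, mul_comm]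
    have hskew' : curvForm (spinConn (conn P Q (-1)) (conn P Q 1)) c d x
        = -curvForm (spinConn (conn P Q (-1)) (conn P Q 1)) d c x := by
      simp only [curvForm]; abel
    rcases eq_or_lt_of_le (not_lt.mp hcd) with rfl | hlt
    · have h0 : ∀ A : Matrix (Fin 4) (Fin 4) ℝ, A = -A → A = 0 := fun A hA => by
        ext i j
        have := congrFun (congrFun hA i) j
        simp only [Matrix.neg_apply] at this
        simp only [Matrix.zero_apply]
        linarith
      rw [h0 _ hskew', h0 _ (hskew _ _)]
    · rw [hskew', this d c hlt, ← hskew]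
  rw [curvForm_spinConn (h.differentiableAt_conn (Or.inl rfl))
    (h.differentiableAt_conn (Or.inr rfl)), pdCurv, pull₂_typeD]
  have e1 := h.spinCurv_conn (Or.inl rfl) c d
  rw [neg_neg] at e1
  rw [e1, h.spinCurv_conn (Or.inr rfl) c d,
    spinCurvVal_asd h.minus_pos.ne' h.plus_pos.ne' h.sub_ne h.P_pos.ne' h.w_pos.ne' h.Q_eq h.c_sq
      c d hcd,
    spinCurvVal_sd h.minus_pos.ne' h.plus_pos.ne' h.sub_ne h.P_pos.ne' h.w_pos.ne' h.Q_eq h.c_sq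
      c d hcd]
  rfl

end IsGoodPoint

theorem isCoframe {D : Set R4} (hD : IsOpen D) {P Q : ℝ → ℝ}
    (h : ∀ x ∈ D, IsGoodPoint P Q x) :
    IsCoframe D (metric P Q) (frame P Q) (spinConn (conn P Q (-1)) (conn P Q 1)) where
  isOpen := hD
  metric_eq x hx := (h x hx).metric_eq_frame
  det_pos x hx := (h x hx).det_frame_pos
  smooth x hx i b := ((h x hx).contDiffAt_frame i b).of_le (WithTop.coe_le_coe.2 le_top)
  diff x hx := diffM_spinConn ((h x hx).differentiableAt_conn (Or.inl rfl))
    ((h x hx).differentiableAt_conn (Or.inr rfl))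
  antisymm _ _ _ := so4_transpose _ _
  torsion x hx a b i := by
    have hx' := h x hx
    rw [hx'.pdM_frame, hx'.pdM_frame]
    exact torsion_val hx'.minus_pos.ne' hx'.plus_pos.ne' hx'.sub_ne hx'.P_pos.ne' hx'.w_pos.ne'
      hx'.Q_eq a b i

/-! ## Field equations as equations for the structure functions -/

/-- `weylExpr` along the structure functions `P` and `Q`. -/
def weylFun (P Q : ℝ → ℝ) (x : R4) : ℝ :=
  weylExpr (-1) (x 2) (x 3) (P (x 2)) (deriv P (x 2)) (deriv (deriv P) (x 2)) (Q (x 3))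
    (deriv Q (x 3)) (deriv (deriv Q) (x 3))

namespace IsGoodPoint

variable {P Q : ℝ → ℝ} {x : R4} {D : Set R4}

theorem bianchi (h : IsGoodPoint P Q x) :
    2 * curvX (-1) (x 2) (x 3) (P (x 2)) (deriv P (x 2)) (Q (x 3)) (deriv Q (x 3))
      + curvZ (-1) (x 2) (x 3) (P (x 2)) (deriv P (x 2)) (deriv (deriv P) (x 2)) (Q (x 3))
        (deriv Q (x 3)) (deriv (deriv Q) (x 3))
    = 2 * curvX 1 (x 2) (x 3) (P (x 2)) (deriv P (x 2)) (Q (x 3)) (deriv Q (x 3))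
      + curvZ 1 (x 2) (x 3) (P (x 2)) (deriv P (x 2)) (deriv (deriv P) (x 2)) (Q (x 3))
        (deriv Q (x 3)) (deriv (deriv Q) (x 3)) :=
  curv_bianchi h.minus_pos.ne' h.plus_pos.ne' h.sub_ne

/-- X - Z is `weylFun` times a factor that does not vanish where p ≠ q and |pq| < 1. -/
theorem selfDual_iff (h : ∀ y ∈ D, IsGoodPoint P Q y) (hD : IsOpen D) (hx : x ∈ D) :
    (∀ a b c d, hodgeWeyl (metric P Q) a b c d x = weyl (metric P Q) a b c d x) ↔
      weylFun P Q x = 0 := by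
  have h' := h x hx
  rw [(isCoframe hD h).hodgeWeyl_eq_weyl_iff hx h'.curvForm_conn, pdCurv,
    star_frameWeyl_typeD_iff h'.bianchi, curvZ, eq_comm, sub_eq_self, div_eq_zero_iff]
  have h1 : (4 * (1 + -1 * (x 2 * x 3)) ^ 2 * ((1 - x 2 * x 3) * (1 + x 2 * x 3))) ≠ 0 := by
    refine mul_ne_zero (mul_ne_zero four_ne_zero (pow_ne_zero _ ?_)) h'.s_ne
    rw [neg_one_mul, ← sub_eq_add_neg]
    exact h'.minus_pos.ne'
  simp only [h1, or_false, mul_eq_zero, pow_ne_zero 2 h'.sub_ne, false_or]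
  rfl

theorem einstein_iff (h : ∀ y ∈ D, IsGoodPoint P Q y) (hD : IsOpen D) (hx : x ∈ D) (r : ℝ) :
    (∀ a b, ricci (metric P Q) a b x = r * metric P Q x a b) ↔
      curvY (x 2) (x 3) (P (x 2)) (deriv P (x 2)) (deriv (deriv P) (x 2)) (Q (x 3))
        (deriv Q (x 3)) (deriv (deriv Q) (x 3)) = 0 ∧
      2 * curvX (-1) (x 2) (x 3) (P (x 2)) (deriv P (x 2)) (Q (x 3)) (deriv Q (x 3))
        + curvZ (-1) (x 2) (x 3) (P (x 2)) (deriv P (x 2)) (deriv (deriv P) (x 2)) (Q (x 3))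
          (deriv Q (x 3)) (deriv (deriv Q) (x 3)) = r := by
  have h' := h x hx
  rw [(isCoframe hD h).ricci_eq_smul_iff hx h'.curvForm_conn, pdCurv,
    frameRicci_typeD_eq_smul_iff h'.bianchi]

theorem flat_iff (h : ∀ y ∈ D, IsGoodPoint P Q y) (hD : IsOpen D) (hx : x ∈ D) :
    (∀ a b c d, riemann (metric P Q) a b c d x = 0) ↔ ∀ k l, pdCurv P Q x k l = 0 :=
  (isCoframe hD h).riemann_eq_zero_iff hx (h x hx).curvForm_conn

end IsGoodPoint

/-! ## The quartic solutions -/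

section Quartic

variable {a : Fin 5 → ℝ} {p q : ℝ}

theorem hasDerivAt_quarticP (a : Fin 5 → ℝ) (p : ℝ) : HasDerivAt (quarticP a)
    (a 1 + 2 * a 2 * p + 3 * a 3 * p ^ 2 + 4 * a 4 * p ^ 3) p := by
  have h := (((((hasDerivAt_const p (a 0)).add ((hasDerivAt_id p).const_mul (a 1))).add
    ((hasDerivAt_pow 2 p).const_mul (a 2))).add ((hasDerivAt_pow 3 p).const_mul (a 3))).add
    ((hasDerivAt_pow 4 p).const_mul (a 4)))
  refine h.congr_deriv ?_
  norm_num
  ring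

theorem quarticQ_eq (a : Fin 5 → ℝ) : quarticQ a = quarticP ![a 4, a 3, a 2, a 1, a 0] := by
  ext q
  simp [quarticQ, quarticP]

theorem deriv_quarticP (a : Fin 5 → ℝ) :
    deriv (quarticP a) = quarticP ![a 1, 2 * a 2, 3 * a 3, 4 * a 4, 0] := by
  ext p
  rw [(hasDerivAt_quarticP a p).deriv]
  simp [quarticP]

theorem deriv_quarticQ (a : Fin 5 → ℝ) :
    deriv (quarticQ a) = quarticP ![a 3, 2 * a 2, 3 * a 1, 4 * a 0, 0] := by
  rw [quarticQ_eq, deriv_quarticP]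
  simp

theorem contDiff_quarticP (a : Fin 5 → ℝ) : ContDiff ℝ ∞ (quarticP a) := by
  unfold quarticP; fun_prop

theorem contDiff_quarticQ (a : Fin 5 → ℝ) : ContDiff ℝ ∞ (quarticQ a) := by
  unfold quarticQ; fun_prop

/-- Evaluates `f` along `P`, `Q` and their derivatives for the quartic solutions. -/
def onQuartic {α : Type*} (f : ℝ → ℝ → ℝ → ℝ → ℝ → ℝ → α) (a : Fin 5 → ℝ) (p q : ℝ) : α :=
  f (a 0 + a 1 * p + a 2 * p ^ 2 + a 3 * p ^ 3 + a 4 * p ^ 4)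
    (a 1 + 2 * a 2 * p + 3 * a 3 * p ^ 2 + 4 * a 4 * p ^ 3)
    (2 * a 2 + 6 * a 3 * p + 12 * a 4 * p ^ 2)
    (a 4 + a 3 * q + a 2 * q ^ 2 + a 1 * q ^ 3 + a 0 * q ^ 4)
    (a 3 + 2 * a 2 * q + 3 * a 1 * q ^ 2 + 4 * a 0 * q ^ 3)
    (2 * a 2 + 6 * a 1 * q + 12 * a 0 * q ^ 2)

theorem weylExpr_quartic (a : Fin 5 → ℝ) (p q : ℝ) :
    onQuartic (weylExpr (-1) p q) a p q = 0 := by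
  simp only [onQuartic, weylExpr]
  ring

/-- The anti-self-dual half of the curvature in closed form. The variable term and `curvY` share the
factor a₃ - a₁, so killing Y also makes X constant. -/
theorem curvX_quartic (h1 : 1 - p * q ≠ 0) (h2 : 1 + p * q ≠ 0) (h3 : p - q ≠ 0) :
    onQuartic (fun P P₁ _ Q Q₁ _ => curvX (-1) p q P P₁ Q Q₁) a p q
      = (a 4 - a 0) + (a 3 - a 1) * (p + q) / (2 * (1 + p * q)) := by
  obtain ⟨u, hu⟩ : ∃ u, 1 - p * q = u := ⟨_, rfl⟩
  obtain ⟨v, hv⟩ : ∃ v, 1 + p * q = v := ⟨_, rfl⟩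
  obtain ⟨t, ht⟩ : ∃ t, p - q = t := ⟨_, rfl⟩
  have hu' : 1 + -(p * q) = u := by rw [← hu]; ring
  rw [hu] at h1
  rw [hv] at h2
  rw [ht] at h3
  simp only [onQuartic, curvX, vP, vQ, mVal, mVal_p, mVal_q, neg_mul, one_mul, hu, hv, ht, hu']
  field_simp
  simp only [← hu, ← hv, ← ht]
  ring

theorem curvZ_quartic (h1 : 1 - p * q ≠ 0) (h2 : 1 + p * q ≠ 0) (h3 : p - q ≠ 0) :
    onQuartic (curvZ (-1) p q) a p q
      = (a 4 - a 0) + (a 3 - a 1) * (p + q) / (2 * (1 + p * q)) := by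
  have h := weylExpr_quartic a p q
  rw [← curvX_quartic (a := a) h1 h2 h3]
  simp only [onQuartic] at h
  simp only [onQuartic, curvZ, h, mul_zero, zero_div, sub_zero]

theorem curvY_quartic (h1 : 1 - p * q ≠ 0) (h2 : 1 + p * q ≠ 0) (h3 : p - q ≠ 0) :
    onQuartic (curvY p q) a p q
      = (a 3 - a 1) * (p - q) * (1 - p * q) / (2 * (1 + p * q) ^ 2) := by
  have h := curvZ_quartic (a := a) h1 h2 h3
  simp only [onQuartic] at h
  obtain ⟨u, hu⟩ : ∃ u, 1 - p * q = u := ⟨_, rfl⟩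
  obtain ⟨v, hv⟩ : ∃ v, 1 + p * q = v := ⟨_, rfl⟩
  obtain ⟨t, ht⟩ : ∃ t, p - q = t := ⟨_, rfl⟩
  have hu' : 1 + -(p * q) = u := by rw [← hu]; ring
  simp only [onQuartic, curvY, h]
  rw [hu] at h1
  rw [hv] at h2
  rw [ht] at h3
  simp [connVal_q, vP, vQ, mVal, mVal_p, mVal_q, hu, hv, ht, hu']
  field_simp
  simp only [← hu, ← hv, ← ht]
  ring

/-- For Einstein solutions, a₁ is the only coefficient of the remaining self-dual Weyl curvature;
this is the source of the extra condition for flatness. -/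
theorem curvX_sd_quartic (h : a 1 = a 3) (h1 : 1 - p * q ≠ 0) (h2 : 1 + p * q ≠ 0)
    (h3 : p - q ≠ 0) :
    onQuartic (fun P P₁ _ Q Q₁ _ => curvX 1 p q P P₁ Q Q₁) a p q
      = (a 4 - a 0) + a 1 * ((p - q) / (1 + p * q)) ^ 3 := by
  obtain ⟨u, hu⟩ : ∃ u, 1 - p * q = u := ⟨_, rfl⟩
  obtain ⟨v, hv⟩ : ∃ v, 1 + p * q = v := ⟨_, rfl⟩
  obtain ⟨t, ht⟩ : ∃ t, p - q = t := ⟨_, rfl⟩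
  rw [hu] at h1
  rw [hv] at h2
  rw [ht] at h3
  simp only [onQuartic, curvX, vP, vQ, mVal, mVal_p, mVal_q, ← h, one_mul, hu, hv, ht]
  field_simp
  simp only [← hu, ← hv, ← ht]
  ring

end Quartic

variable {D : Set R4} {P Q : ℝ → ℝ} {x : R4} {a : Fin 5 → ℝ}

theorem IsChartDomain.isGoodPoint (hD : IsChartDomain D) (h : IsAdmissible D P Q) :
    ∀ x ∈ D, IsGoodPoint P Q x := fun x hx =>
  ⟨hD.ne x hx, hD.pos x hx, h.smooth_P x hx, h.smooth_Q x hx, h.P_pos x hx, h.Q_neg x hx⟩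

/-- Along a coordinate line through a point of an open set, nearby points are in the set. -/
theorem eventually_update_mem (hD : IsOpen D) (hx : x ∈ D) (i : Fin 4) :
    ∀ᶠ t in nhds (x i), Function.update x i t ∈ D := by
  have hc : Continuous fun t => Function.update x i t := continuous_const.update i continuous_id
  exact hc.continuousAt.eventually_mem (by simpa using hD.mem_nhds hx)

theorem IsQuarticPair.eventuallyEq_P (h : IsQuarticPair D P Q a) (hD : IsOpen D) (hx : x ∈ D) :
    P =ᶠ[nhds (x 2)] quarticP a :=
  (eventually_update_mem hD hx 2).mono fun t ht => by simpa using (h _ ht).1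

theorem IsQuarticPair.eventuallyEq_Q (h : IsQuarticPair D P Q a) (hD : IsOpen D) (hx : x ∈ D) :
    Q =ᶠ[nhds (x 3)] quarticQ a :=
  (eventually_update_mem hD hx 3).mono fun t ht => by simpa using (h _ ht).2

theorem IsQuarticPair.eq_onQuartic {α : Type*} (h : IsQuarticPair D P Q a) (hD : IsOpen D)
    (hx : x ∈ D) (f : ℝ → ℝ → ℝ → ℝ → ℝ → ℝ → α) :
    f (P (x 2)) (deriv P (x 2)) (deriv (deriv P) (x 2)) (Q (x 3)) (deriv Q (x 3))
      (deriv (deriv Q) (x 3)) = onQuartic f a (x 2) (x 3) := by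
  have hP := h.eventuallyEq_P hD hx
  have hQ := h.eventuallyEq_Q hD hx
  rw [hP.deriv.deriv_eq, hQ.deriv.deriv_eq, hP.deriv_eq, hQ.deriv_eq, (h x hx).1, (h x hx).2,
    deriv_quarticP, deriv_quarticQ, deriv_quarticP, deriv_quarticP, onQuartic]
  have e1 : quarticP ![a 1, 2 * a 2, 3 * a 3, 4 * a 4, 0] (x 2)
      = a 1 + 2 * a 2 * x 2 + 3 * a 3 * x 2 ^ 2 + 4 * a 4 * x 2 ^ 3 := by
    simp [quarticP]
  have e2 : quarticP ![(![a 1, 2 * a 2, 3 * a 3, 4 * a 4, 0] : Fin 5 → ℝ) 1,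
      2 * (![a 1, 2 * a 2, 3 * a 3, 4 * a 4, 0] : Fin 5 → ℝ) 2,
      3 * (![a 1, 2 * a 2, 3 * a 3, 4 * a 4, 0] : Fin 5 → ℝ) 3,
      4 * (![a 1, 2 * a 2, 3 * a 3, 4 * a 4, 0] : Fin 5 → ℝ) 4, 0] (x 2)
      = 2 * a 2 + 6 * a 3 * x 2 + 12 * a 4 * x 2 ^ 2 := by
    simp [quarticP]
    ring
  have e3 : quarticP ![a 3, 2 * a 2, 3 * a 1, 4 * a 0, 0] (x 3)
      = a 3 + 2 * a 2 * x 3 + 3 * a 1 * x 3 ^ 2 + 4 * a 0 * x 3 ^ 3 := by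
    simp [quarticP]
  have e4 : quarticP ![(![a 3, 2 * a 2, 3 * a 1, 4 * a 0, 0] : Fin 5 → ℝ) 1,
      2 * (![a 3, 2 * a 2, 3 * a 1, 4 * a 0, 0] : Fin 5 → ℝ) 2,
      3 * (![a 3, 2 * a 2, 3 * a 1, 4 * a 0, 0] : Fin 5 → ℝ) 3,
      4 * (![a 3, 2 * a 2, 3 * a 1, 4 * a 0, 0] : Fin 5 → ℝ) 4, 0] (x 3)
      = 2 * a 2 + 6 * a 1 * x 3 + 12 * a 0 * x 3 ^ 2 := by
    simp [quarticP]
    ring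
  rw [e1, e2, e3, e4]
  rfl

/-! ### Special geometries among the quartic solutions -/

theorem selfDual_of_quartic (hD : IsChartDomain D) (hA : IsAdmissible D P Q)
    (hq : IsQuarticPair D P Q a) : IsConformallySelfDual D (metric P Q) := fun x hx =>
  (IsGoodPoint.selfDual_iff (hD.isGoodPoint hA) hD.isOpen hx).2 <|
    (hq.eq_onQuartic hD.isOpen hx (weylExpr (-1) (x 2) (x 3))).trans (weylExpr_quartic _ _ _)

/-- Y is a₃ - a₁ times a factor nonzero at every point of D, so a single point already forces a₁ =
a₃. Then 2X + Z = 3(a₄ - a₀) is the Einstein constant. -/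
theorem ricci_quartic_iff (hD : IsChartDomain D) (hA : IsAdmissible D P Q)
    (hq : IsQuarticPair D P Q a) (hx : x ∈ D) (r : ℝ) :
    (∀ b c, ricci (metric P Q) b c x = r * metric P Q x b c) ↔
      a 1 = a 3 ∧ 3 * (a 4 - a 0) = r := by
  have hg := hD.isGoodPoint hA x hx
  have h1 := hg.minus_pos.ne'
  have h2 := hg.plus_pos.ne'
  have h3 := hg.sub_ne
  rw [IsGoodPoint.einstein_iff (hD.isGoodPoint hA) hD.isOpen hx,
    hq.eq_onQuartic hD.isOpen hx (curvY (x 2) (x 3)),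
    hq.eq_onQuartic hD.isOpen hx (curvZ (-1) (x 2) (x 3)),
    hq.eq_onQuartic hD.isOpen hx (fun P P₁ _ Q Q₁ _ => curvX (-1) (x 2) (x 3) P P₁ Q Q₁),
    curvX_quartic h1 h2 h3, curvY_quartic h1 h2 h3, curvZ_quartic h1 h2 h3, div_eq_zero_iff]
  have h4 : 2 * (1 + x 2 * x 3) ^ 2 ≠ 0 := mul_ne_zero two_ne_zero (pow_ne_zero 2 h2)
  simp only [h4, or_false, mul_eq_zero, h1, h3, sub_eq_zero, eq_comm (a := a 3)]
  refine and_congr_right fun h => ?_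
  rw [h, sub_self, zero_mul, zero_div, add_zero]
  constructor <;> intro h5 <;> linarith

theorem isEinstein_quartic_iff (hD : IsChartDomain D) (hA : IsAdmissible D P Q)
    (hq : IsQuarticPair D P Q a) : IsEinstein D (metric P Q) ↔ a 1 = a 3 := by
  constructor
  · rintro ⟨r, hr⟩
    obtain ⟨x, hx⟩ := hD.isConnected.nonempty
    exact ((ricci_quartic_iff hD hA hq hx r).1 (hr x hx)).1
  · exact fun h => ⟨3 * (a 4 - a 0), fun x hx => (ricci_quartic_iff hD hA hq hx _).2 ⟨h, rfl⟩⟩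

theorem isQuaternionicKahler_quartic_iff (hD : IsChartDomain D) (hA : IsAdmissible D P Q)
    (hq : IsQuarticPair D P Q a) : IsQuaternionicKahler D (metric P Q) ↔ a 1 = a 3 := by
  rw [← isEinstein_quartic_iff hD hA hq]
  -- Self-duality is automatic for quartic pairs, so only the Einstein condition remains.
  exact ⟨fun h => h.1, fun h => ⟨h, Or.inl (selfDual_of_quartic hD hA hq)⟩⟩

theorem isRicciFlat_quartic_iff (hD : IsChartDomain D) (hA : IsAdmissible D P Q)
    (hq : IsQuarticPair D P Q a) : IsRicciFlat D (metric P Q) ↔ a 1 = a 3 ∧ a 0 = a 4 := by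
  have h : IsRicciFlat D (metric P Q) ↔
      ∀ x ∈ D, ∀ b c, ricci (metric P Q) b c x = 0 * metric P Q x b c := by
    simp only [IsRicciFlat, zero_mul]
  rw [h]
  constructor
  · intro h
    obtain ⟨x, hx⟩ := hD.isConnected.nonempty
    have := (ricci_quartic_iff hD hA hq hx 0).1 (h x hx)
    exact ⟨this.1, by linarith [this.2]⟩
  · exact fun h x hx => (ricci_quartic_iff hD hA hq hx 0).2 ⟨h.1, by rw [h.2]; ring⟩

theorem isFlat_quartic_iff (hD : IsChartDomain D) (hA : IsAdmissible D P Q)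
    (hq : IsQuarticPair D P Q a) : IsFlat D (metric P Q) ↔ a 1 = 0 ∧ a 3 = 0 ∧ a 0 = a 4 := by
  have key : ∀ x ∈ D, (∀ b c d e, riemann (metric P Q) b c d e x = 0) ↔
      a 1 = 0 ∧ a 3 = 0 ∧ a 0 = a 4 := by
    intro x hx
    have hg := hD.isGoodPoint hA x hx
    have h1 := hg.minus_pos.ne'
    have h2 := hg.plus_pos.ne'
    have h3 := hg.sub_ne
    have hY := hq.eq_onQuartic hD.isOpen hx (curvY (x 2) (x 3))
    have hZ := hq.eq_onQuartic hD.isOpen hx (curvZ (-1) (x 2) (x 3))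
    have hX := hq.eq_onQuartic hD.isOpen hx
      (fun P P₁ _ Q Q₁ _ => curvX (-1) (x 2) (x 3) P P₁ Q Q₁)
    have hX' := hq.eq_onQuartic hD.isOpen hx
      (fun P P₁ _ Q Q₁ _ => curvX 1 (x 2) (x 3) P P₁ Q Q₁)
    rw [curvY_quartic h1 h2 h3] at hY
    rw [curvZ_quartic h1 h2 h3] at hZ
    rw [curvX_quartic h1 h2 h3] at hX
    have hB := hg.bianchi
    rw [IsGoodPoint.flat_iff (hD.isGoodPoint hA) hD.isOpen hx, IsGoodPoint.pdCurv, typeD_eq_zero_iff]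
    constructor
    -- Y = 0 gives a₃ = a₁, then X = 0 gives a₀ = a₄, and X' = 0 reduces to a₁((p - q)/(1 + pq))³ =
    -- 0.
    · rintro ⟨e1, -, e3, e4, -⟩
      rw [e3, eq_comm, div_eq_zero_iff] at hY
      have h4 : 2 * (1 + x 2 * x 3) ^ 2 ≠ 0 := mul_ne_zero two_ne_zero (pow_ne_zero 2 h2)
      simp only [h4, or_false, mul_eq_zero, h1, h3, sub_eq_zero] at hY
      rw [e1, hY] at hX
      rw [curvX_sd_quartic hY.symm h1 h2 h3, e4] at hX'
      have h04 : a 4 - a 0 = 0 := by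
        rw [sub_self, zero_mul, zero_div, add_zero] at hX
        exact hX.symm
      rw [h04, zero_add, eq_comm, mul_eq_zero] at hX'
      have h13 := hX'.resolve_right (pow_ne_zero 3 (div_ne_zero h3 h2))
      exact ⟨h13, hY.trans h13, by linarith⟩
    · rintro ⟨e1, e2, e3⟩
      rw [curvX_sd_quartic (e1.trans e2.symm) h1 h2 h3] at hX'
      simp only [e1, e2, e3, sub_self, zero_mul, zero_div, add_zero] at hX hX' hY hZ
      refine ⟨hX, hZ, hY, hX', ?_⟩
      rw [hX, hZ, hX'] at hB
      linarith
  constructor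
  · intro h
    obtain ⟨x, hx⟩ := hD.isConnected.nonempty
    exact (key x hx).1 (h x hx)
  · exact fun h x hx => (key x hx).2 h

/-! ## Genericity -/

theorem isOpen_paramsAt (x : R4) : IsOpen (paramsAt x) := by
  have h1 : Continuous fun a : Fin 5 → ℝ => quarticP a (x 2) := by unfold quarticP; fun_prop
  have h2 : Continuous fun a : Fin 5 → ℝ => quarticQ a (x 3) := by unfold quarticQ; fun_prop
  exact (isOpen_lt continuous_const h1).inter (isOpen_lt h2 continuous_const)

theorem paramsAt_nonempty (h : 0 < 1 - (x 2) ^ 2 * (x 3) ^ 2) : (paramsAt x).Nonempty := by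
  -- Chosen so that P(p₀) = 1 - p₀⁴q₀⁴ and Q(q₀) = -(1 - p₀⁴q₀⁴).
  refine ⟨![1 + x 2 ^ 4, 0, 0, 0, -(1 + x 3 ^ 4)], ?_, ?_⟩
  · have : 0 < 1 - x 2 ^ 4 * x 3 ^ 4 := by
      have : 1 - x 2 ^ 4 * x 3 ^ 4
          = (1 - x 2 ^ 2 * x 3 ^ 2) * (1 + x 2 ^ 2 * x 3 ^ 2) := by ring
      rw [this]; positivity
    simp [quarticP]
    linarith
  · have : 0 < 1 - x 2 ^ 4 * x 3 ^ 4 := by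
      have : 1 - x 2 ^ 4 * x 3 ^ 4
          = (1 - x 2 ^ 2 * x 3 ^ 2) * (1 + x 2 ^ 2 * x 3 ^ 2) := by ring
      rw [this]; positivity
    simp [quarticQ]
    linarith

/-- The sign conditions and the Einstein equation persist on a small ball around the point; being
convex, it is a chart domain, and the criterion for quartic pairs applies there. -/
theorem eq_of_mem_einsteinParamsAt (hD : IsChartDomain D) (hx : x ∈ D)
    (ha : a ∈ einsteinParamsAt x) : a 1 = a 3 := by
  obtain ⟨⟨hP, hQ⟩, U, hU, hxU, lam, hlam⟩ := ha
  have hcP : Continuous fun y : R4 => quarticP a (y 2) :=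
    (contDiff_quarticP a).continuous.comp (continuous_apply 2)
  have hcQ : Continuous fun y : R4 => quarticQ a (y 3) :=
    (contDiff_quarticQ a).continuous.comp (continuous_apply 3)
  have hV : IsOpen ((D ∩ U) ∩ ({y | 0 < quarticP a (y 2)} ∩ {y | quarticQ a (y 3) < 0})) :=
    (hD.isOpen.inter hU).inter
      ((isOpen_lt continuous_const hcP).inter (isOpen_lt hcQ continuous_const))
  obtain ⟨r, hr, hball⟩ := Metric.isOpen_iff.1 hV x ⟨⟨hx, hxU⟩, hP, hQ⟩
  have hB : IsChartDomain (Metric.ball x r) :=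
    ⟨Metric.isOpen_ball, (convex_ball x r).isConnected ⟨x, Metric.mem_ball_self hr⟩,
      fun y hy => hD.ne y (hball hy).1.1, fun y hy => hD.pos y (hball hy).1.1⟩
  have hA : IsAdmissible (Metric.ball x r) (quarticP a) (quarticQ a) :=
    ⟨fun _ _ => (contDiff_quarticP a).contDiffAt, fun _ _ => (contDiff_quarticQ a).contDiffAt,
      fun y hy => (hball hy).2.1, fun y hy => (hball hy).2.2⟩
  exact (isEinstein_quartic_iff hB hA fun _ _ => ⟨rfl, rfl⟩).1
    ⟨lam, fun y hy => hlam y (hball hy).1.2⟩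

theorem isNowhereDense_einsteinParamsAt (hD : IsChartDomain D) (hx : x ∈ D) :
    IsNowhereDense (einsteinParamsAt x) := by
  have hcl : IsClosed {a : Fin 5 → ℝ | a 1 = a 3} :=
    isClosed_eq (continuous_apply 1) (continuous_apply 3)
  have hsub : einsteinParamsAt x ⊆ {a : Fin 5 → ℝ | a 1 = a 3} :=
    fun a ha => eq_of_mem_einsteinParamsAt hD hx ha
  have hint : interior {a : Fin 5 → ℝ | a 1 = a 3} = ∅ := by
    rw [Set.eq_empty_iff_forall_notMem]
    intro a ha
    have hc : Continuous fun t => Function.update a 1 t := continuous_const.update 1 continuous_id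
    have hev : ∀ᶠ t in nhds (a 1), Function.update a 1 t ∈ interior {a : Fin 5 → ℝ | a 1 = a 3} :=
      hc.continuousAt.eventually_mem (by simpa using isOpen_interior.mem_nhds ha)
    have hev' : ∀ᶠ t in nhds (a 1), t = a 3 := hev.mono fun t ht => by
      have := interior_subset ht
      simpa using this
    -- The real line has no isolated points, so the punctured neighbourhood contains some t ≠ a₁
    -- with t = a₃ = a₁.
    have := (hev'.filter_mono nhdsWithin_le_nhds : ∀ᶠ t in nhdsWithin (a 1) {a 1}ᶜ, t = a 3)
    obtain ⟨t, ht, ht'⟩ := (this.and self_mem_nhdsWithin).exists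
    exact ht' (ht.trans hev'.self_of_nhds.symm)
  exact Set.subset_eq_empty (interior_mono (closure_minimal hsub hcl)) hint

/-! ## Conformally self-dual solutions are quartic -/

theorem eventually_deriv_eq_zero {G G' : ℝ → ℝ} {t₀ : ℝ} (h0 : ∀ᶠ t in nhds t₀, G t = 0)
    (h : ∀ᶠ t in nhds t₀, HasDerivAt G (G' t) t) : ∀ᶠ t in nhds t₀, G' t = 0 := by
  filter_upwards [h0.eventually_nhds, h] with t ht ht'
  have h1 : G =ᶠ[nhds t] fun _ => 0 := ht
  rw [← ht'.deriv, h1.deriv_eq, deriv_const]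

theorem eq_zero_of_eventually_quadratic {A B C t₀ : ℝ}
    (h : ∀ᶠ t in nhds t₀, A + B * t + C * t ^ 2 = 0) : A = 0 ∧ B = 0 ∧ C = 0 := by
  have h1 := eventually_deriv_eq_zero (G' := fun t => B + C * (2 * t)) h <| .of_forall fun t => by
    have := (((hasDerivAt_id t).const_mul B).const_add A).add ((hasDerivAt_pow 2 t).const_mul C)
    exact this.congr_deriv (by simp)
  have h2 := eventually_deriv_eq_zero (G' := fun _ => 2 * C) h1 <| .of_forall fun t => by
    have := ((((hasDerivAt_id t).const_mul 2).const_mul C)).const_add B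
    exact this.congr_deriv (by ring)
  have e0 := h.self_of_nhds
  have e1 := h1.self_of_nhds
  have e2 := h2.self_of_nhds
  have hC : C = 0 := by linarith
  subst hC
  have hB : B = 0 := by linarith
  subst hB
  exact ⟨by linarith, rfl, rfl⟩

/-- The fifth derivative of the first structure function vanishes. -/
theorem fifth_deriv_eq_zero {f : ℝ → ℝ} {t₀ q c₀ c₁ c₂ : ℝ}
    (hf : ∀ᶠ t in nhds t₀, ContDiffAt ℝ ∞ f t) (hq : 1 - t₀ * q ≠ 0)
    (h : ∀ᶠ t in nhds t₀, weylExpr (-1) t q (f t) (deriv f t) (deriv (deriv f) t) c₀ c₁ c₂ = 0) :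
    deriv^[5] f t₀ = 0 := by
  have hs : ∀ n : ℕ, ∀ᶠ t in nhds t₀, ContDiffAt ℝ ∞ (deriv^[n] f) t := by
    intro n
    induction n with
    | zero => exact hf
    | succ n ih =>
      simp only [Function.iterate_succ_apply']
      exact ih.mono fun t => contDiffAt_deriv
  have hd : ∀ n : ℕ, ∀ᶠ t in nhds t₀, HasDerivAt (deriv^[n] f) (deriv^[n + 1] f t) t := by
    intro n
    simp only [Function.iterate_succ_apply']
    exact (hs n).mono fun t ht => (ht.differentiableAt (by simp)).hasDerivAt
  have hu : ∀ t, HasDerivAt (fun t => 1 - t * q) (-q) t := fun t =>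
    (((hasDerivAt_id t).mul_const q).const_sub 1).congr_deriv (by ring)
  have hid : ∀ t : ℝ, HasDerivAt (fun t => t) 1 t := fun t => hasDerivAt_id t
  -- With q fixed, the Q-terms form a quadratic polynomial in t, which three derivatives annihilate.
  -- Meanwhile the coefficients of the lower-order terms in f run through 6, 4, 2, 0 and 12, 6, 2,
  -- 0, so only the fifth derivative survives.
  have h0 : ∀ᶠ t in nhds t₀, (1 - t * q) ^ 2 * (deriv^[2] f t) + 6 * q * (1 - t * q) * deriv^[1] f t
      + 12 * q ^ 2 * deriv^[0] f t
      - (c₂ * (1 - t * q) ^ 2 + 6 * c₁ * (1 - t * q) * t + 12 * c₀ * t ^ 2) = 0 := by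
    filter_upwards [h] with t ht
    simp only [Function.iterate_succ, Function.iterate_zero, Function.comp, id]
    rw [← ht, weylExpr]
    ring
  have h1 : ∀ᶠ t in nhds t₀, (1 - t * q) ^ 2 * (deriv^[3] f t) + 4 * q * (1 - t * q) * deriv^[2] f t
      + 6 * q ^ 2 * deriv^[1] f t
      - (-2 * q * c₂ * (1 - t * q) + 6 * c₁ * (1 - 2 * t * q) + 24 * c₀ * t) = 0 := by
    refine eventually_deriv_eq_zero h0 ?_
    filter_upwards [hd 0, hd 1, hd 2] with t d0 d1 d2
    refine (((((hu t).pow 2).mul d2).add (((hu t).const_mul (6 * q)).mul d1)).add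
      (d0.const_mul (12 * q ^ 2))).sub ((((hu t).pow 2).const_mul c₂).add
        (((hu t).const_mul (6 * c₁)).mul (hid t)) |>.add (((hid t).pow 2).const_mul (12 * c₀)))
      |>.congr_deriv ?_
    norm_num
    ring
  have h2 : ∀ᶠ t in nhds t₀, (1 - t * q) ^ 2 * (deriv^[4] f t) + 2 * q * (1 - t * q) * deriv^[3] f t
      + 2 * q ^ 2 * deriv^[2] f t - (2 * q ^ 2 * c₂ - 12 * q * c₁ + 24 * c₀) = 0 := by
    refine eventually_deriv_eq_zero h1 ?_
    filter_upwards [hd 1, hd 2, hd 3] with t d1 d2 d3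
    refine (((((hu t).pow 2).mul d3).add (((hu t).const_mul (4 * q)).mul d2)).add
      (d1.const_mul (6 * q ^ 2))).sub (((hu t).const_mul (-2 * q * c₂)).add
        ((((hid t).const_mul 2).mul_const q).const_sub 1 |>.const_mul (6 * c₁))
        |>.add ((hid t).const_mul (24 * c₀))) |>.congr_deriv ?_
    norm_num
    ring
  have h3 : ∀ᶠ t in nhds t₀, (1 - t * q) ^ 2 * (deriv^[5] f t) = 0 := by
    refine eventually_deriv_eq_zero h2 ?_
    filter_upwards [hd 2, hd 3, hd 4] with t d2 d3 d4
    refine (((((hu t).pow 2).mul d4).add (((hu t).const_mul (2 * q)).mul d3)).add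
      (d2.const_mul (2 * q ^ 2))).sub_const _ |>.congr_deriv ?_
    norm_num
    ring
  exact (mul_eq_zero.1 h3.self_of_nhds).resolve_left (pow_ne_zero 2 hq)

/-- A function whose `n`-th derivative vanishes on an interval is a polynomial there. -/
theorem exists_eq_sum_of_iterate_deriv_eq_zero {I : Set ℝ} (hI : IsOpen I) (hI' : IsPreconnected I)
    (n : ℕ) : ∀ f : ℝ → ℝ, (∀ t ∈ I, ContDiffAt ℝ ∞ f t) → (∀ t ∈ I, deriv^[n] f t = 0) →
      ∃ c : ℕ → ℝ, ∀ t ∈ I, f t = ∑ k ∈ Finset.range n, c k * t ^ k := by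
  induction n with
  | zero => exact fun f _ h => ⟨0, fun t ht => by simpa using h t ht⟩
  | succ n ih =>
    intro f hf h
    obtain ⟨c, hc⟩ := ih (deriv f) (fun t ht => contDiffAt_deriv (hf t ht)) h
    have hder : ∀ t ∈ I, HasDerivAt
        (fun t => f t - ∑ k ∈ Finset.range n, c k / (k + 1) * t ^ (k + 1)) 0 t := by
      intro t ht
      have h1 : HasDerivAt f (deriv f t) t :=
        ((hf t ht).differentiableAt (by simp)).hasDerivAt
      have h2 : HasDerivAt (fun t => ∑ k ∈ Finset.range n, c k / (k + 1) * t ^ (k + 1))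
          (∑ k ∈ Finset.range n, c k * t ^ k) t := by
        refine HasDerivAt.fun_sum fun k _ => ?_
        refine ((hasDerivAt_pow (k + 1) t).const_mul (c k / (k + 1))).congr_deriv ?_
        have : (k : ℝ) + 1 ≠ 0 := by positivity
        push_cast
        field_simp
      exact (h1.sub h2).congr_deriv (by rw [hc t ht, sub_self])
    obtain ⟨b, hb⟩ := hI.exists_is_const_of_deriv_eq_zero hI'
      (fun t ht => (hder t ht).differentiableAt.differentiableWithinAt)
      (fun t ht => (hder t ht).deriv)
    -- Termwise integration of the polynomial for f', with `b` the constant of integration.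
    refine ⟨fun k => if k = 0 then b else c (k - 1) / k, fun t ht => ?_⟩
    rw [Finset.sum_range_succ', ← sub_eq_iff_eq_add']
    simp
    linarith [hb t ht]

variable {D : Set R4} {P Q : ℝ → ℝ}

theorem exists_quarticPair_of_selfDual (hD : IsChartDomain D) (hA : IsAdmissible D P Q)
    (h : IsConformallySelfDual D (metric P Q)) : ∃ a, IsQuarticPair D P Q a := by
  have hW : ∀ x ∈ D, weylFun P Q x = 0 := fun x hx =>
    (IsGoodPoint.selfDual_iff (hD.isGoodPoint hA) hD.isOpen hx).1 (h x hx)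
  have hW' : ∀ x ∈ D, ∀ᶠ t in nhds (x 2), weylExpr (-1) t (x 3) (P t) (deriv P t)
      (deriv (deriv P) t) (Q (x 3)) (deriv Q (x 3)) (deriv (deriv Q) (x 3)) = 0 := fun x hx =>
    (eventually_update_mem hD.isOpen hx 2).mono fun t ht => by
      simpa [weylFun] using hW _ ht
  have h5 : ∀ x ∈ D, deriv^[5] P (x 2) = 0 := fun x hx => by
    refine fifth_deriv_eq_zero ?_ (hD.isGoodPoint hA x hx).minus_pos.ne' (hW' x hx)
    exact (eventually_update_mem hD.isOpen hx 2).mono fun t ht => by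
      simpa using hA.smooth_P _ ht
  -- The values of p on the connected set D form an open interval, so one vector of coefficients
  -- serves all of D.
  have hI : IsOpen ((fun x : R4 => x 2) '' D) := isOpenMap_eval 2 _ hD.isOpen
  have hI' : IsPreconnected ((fun x : R4 => x 2) '' D) :=
    (hD.isConnected.image _ (continuous_apply 2).continuousOn).isPreconnected
  obtain ⟨c, hc⟩ := exists_eq_sum_of_iterate_deriv_eq_zero hI hI' 5 P
    (by rintro _ ⟨x, hx, rfl⟩; exact hA.smooth_P x hx)
    (by rintro _ ⟨x, hx, rfl⟩; exact h5 x hx)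
  set a : Fin 5 → ℝ := fun i => c i with ha
  have hP : ∀ t ∈ (fun x : R4 => x 2) '' D, P t = quarticP a t := by
    intro t ht
    rw [hc t ht]
    simp [Finset.sum_range_succ, quarticP, ha]
  refine ⟨a, fun x hx => ⟨hP _ ⟨x, hx, rfl⟩, ?_⟩⟩
  have hev : ∀ᶠ t in nhds (x 2), P =ᶠ[nhds t] quarticP a :=
    Filter.Eventually.eventually_nhds (p := fun t => P t = quarticP a t)
      (Filter.mem_of_superset (hI.mem_nhds ⟨x, hx, rfl⟩) fun t ht => hP t ht)
  -- By linearity and the quartic identity, only the deviations δ₂, δ₁, δ₀ of Q'', Q', Q from the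
  -- reversed quartic contribute: δ₂(1 - tq)² + 6δ₁t(1 - tq) + 12δ₀t² vanishes for t near p, and its
  -- coefficients give δ₂ = δ₁ = δ₀ = 0.
  have hquad := eq_zero_of_eventually_quadratic
    (t₀ := x 2)
    (A := deriv (deriv Q) (x 3) - (2 * a 2 + 6 * a 1 * x 3 + 12 * a 0 * x 3 ^ 2))
    (B := -2 * x 3 * (deriv (deriv Q) (x 3) - (2 * a 2 + 6 * a 1 * x 3 + 12 * a 0 * x 3 ^ 2))
      + 6 * (deriv Q (x 3) - (a 3 + 2 * a 2 * x 3 + 3 * a 1 * x 3 ^ 2 + 4 * a 0 * x 3 ^ 3)))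
    (C := x 3 ^ 2 * (deriv (deriv Q) (x 3) - (2 * a 2 + 6 * a 1 * x 3 + 12 * a 0 * x 3 ^ 2))
      - 6 * x 3 * (deriv Q (x 3) - (a 3 + 2 * a 2 * x 3 + 3 * a 1 * x 3 ^ 2 + 4 * a 0 * x 3 ^ 3))
      + 12 * (Q (x 3) - quarticQ a (x 3))) (by
    filter_upwards [hW' x hx, hev] with t ht ht'
    rw [ht'.deriv.deriv_eq, ht'.deriv_eq, ht'.eq_of_nhds, deriv_quarticP, deriv_quarticP,
      weylExpr] at ht
    simp only [quarticP, quarticQ, Matrix.cons_val_zero, Matrix.cons_val_one, Matrix.cons_val]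
      at ht ⊢
    linear_combination -ht)
  obtain ⟨e1, e2, e3⟩ := hquad
  rw [e1, mul_zero, zero_add] at e2
  rw [e1, (mul_eq_zero.1 e2).resolve_left (by norm_num)] at e3
  linarith

/-! ## Parallel endomorphisms commute with the curvature -/

section Parallel

variable {D : Set R4} {g : MetricField} {E : R4 → Matrix (Fin 4) (Fin 4) ℝ}
  {Θ : Fin 4 → R4 → Matrix (Fin 4) (Fin 4) ℝ} {x : R4}

theorem covDerivEnd_eq (g : MetricField) (J : R4 → Matrix (Fin 4) (Fin 4) ℝ) (a b c : Fin 4)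
    (x : R4) : covDerivEnd g J a b c x
      = (pdM a J x + (christoffelM g a x * J x - J x * christoffelM g a x)) b c := by
  simp only [covDerivEnd, Matrix.add_apply, Matrix.sub_apply, Matrix.mul_apply, pdM_apply,
    christoffelM, Matrix.of_apply, Finset.sum_sub_distrib]
  simp only [mul_comm]

theorem IsKahlerStructure.pdM_eq {J : R4 → Matrix (Fin 4) (Fin 4) ℝ}
    (hJ : IsKahlerStructure D g J) (hx : x ∈ D) (a : Fin 4) :
    pdM a J x = J x * christoffelM g a x - christoffelM g a x * J x := by
  have h : pdM a J x + (christoffelM g a x * J x - J x * christoffelM g a x) = 0 := by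
    ext b c
    rw [← covDerivEnd_eq, hJ.parallel x hx]
    rfl
  rw [eq_neg_of_add_eq_zero_left h, neg_sub]

/-- The Ricci identity: when ∂J = [J, Γ], equality of the mixed second derivatives of J says exactly
that J commutes with the curvature. -/
theorem IsKahlerStructure.riemannM_comm {J : R4 → Matrix (Fin 4) (Fin 4) ℝ}
    (hJ : IsKahlerStructure D g J) (h : IsCoframe D g E Θ) (hx : x ∈ D) (c d : Fin 4) :
    J x * riemannM g c d x = riemannM g c d x * J x := by
  have hsm : ∀ i j, ContDiffAt ℝ 2 (fun y => J y i j) x := fun i j =>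
    ((hJ.smooth i j).contDiffAt (h.isOpen.mem_nhds hx)).of_le (WithTop.coe_le_coe.2 le_top)
  have hd : DiffM J x := fun i j => (hsm i j).differentiableAt (by norm_num)
  have hder : ∀ c d, pdM c (pdM d J) x
      = J x * pdM c (christoffelM g d) x + pdM c J x * christoffelM g d x
        - (christoffelM g d x * pdM c J x + pdM c (christoffelM g d) x * J x) := by
    intro c d
    have hΓ := h.diffM_christoffelM hx d
    rw [← pdM_mul hd hΓ, ← pdM_mul hΓ hd, ← pdM_sub (hd.mul hΓ) (hΓ.mul hd)]
    exact pdM_congr (Filter.eventually_of_mem (h.isOpen.mem_nhds hx)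
      fun y hy => hJ.pdM_eq hy d) c
  have hcomm : pdM c (pdM d J) x = pdM d (pdM c J) x := by
    ext i j
    exact pd_comm (hsm i j) c d
  rw [hder, hder, hJ.pdM_eq hx, hJ.pdM_eq hx] at hcomm
  rw [riemannM_eq, curvForm, ← sub_eq_zero] at *
  rw [← hcomm]
  noncomm_ring

/-- The curvature of a hyper-Kähler metric, in an orthonormal coframe, commutes with an orthogonal
complex structure and is trace-free against it. -/
theorem IsHyperKahler.exists_complexStructure (hg : IsHyperKahler D g) (h : IsCoframe D g E Θ)
    (hx : x ∈ D) : ∃ M : Matrix (Fin 4) (Fin 4) ℝ, Mᵀ = -M ∧ M * M = -1 ∧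
      ∀ c d, M * curvForm Θ c d x = curvForm Θ c d x * M ∧
        (M * curvForm Θ c d x).trace = 0 := by
  obtain ⟨I, J, K, hI, hJ, hK, hIJ⟩ := hg
  have hu := h.isUnit_det hx
  have hE := Matrix.nonsing_inv_mul _ hu
  have hE' := Matrix.mul_nonsing_inv _ hu
  have hsq : E x * K x * (E x)⁻¹ * (E x * K x * (E x)⁻¹) = -1 := by
    have : E x * K x * (E x)⁻¹ * (E x * K x * (E x)⁻¹)
        = E x * (K x * ((E x)⁻¹ * E x) * K x) * (E x)⁻¹ := by noncomm_ring
    rw [this, hE, Matrix.mul_one, hK.sq x hx, Matrix.mul_neg, Matrix.mul_one, Matrix.neg_mul, hE']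
  have horth : (E x * K x * (E x)⁻¹)ᵀ * (E x * K x * (E x)⁻¹) = 1 := by
    have ht : ((E x)⁻¹)ᵀ * (E x)ᵀ = 1 := by
      rw [← Matrix.transpose_mul, hE', Matrix.transpose_one]
    have : (E x * K x * (E x)⁻¹)ᵀ * (E x * K x * (E x)⁻¹)
        = ((E x)⁻¹)ᵀ * ((K x)ᵀ * ((E x)ᵀ * E x) * K x) * (E x)⁻¹ := by
      simp only [Matrix.transpose_mul, Matrix.mul_assoc]
    rw [this, ← h.metric_eq x hx, hK.orthogonal x hx, h.metric_eq x hx, ← Matrix.mul_assoc, ht,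
      Matrix.one_mul, hE']
  have hF : ∀ c d, curvForm Θ c d x = E x * riemannM g c d x * (E x)⁻¹ := fun c d => by
    rw [h.mul_riemannM hx, Matrix.mul_nonsing_inv_cancel_right _ _ hu]
  have hMF : ∀ c d, E x * K x * (E x)⁻¹ * curvForm Θ c d x
      = E x * (K x * riemannM g c d x) * (E x)⁻¹ := fun c d => by
    rw [hF]
    simp only [Matrix.mul_assoc, Matrix.nonsing_inv_mul_cancel_left _ _ hu]
  refine ⟨E x * K x * (E x)⁻¹, ?_, hsq, fun c d => ⟨?_, ?_⟩⟩
  · calc (E x * K x * (E x)⁻¹)ᵀ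
        = -((E x * K x * (E x)⁻¹)ᵀ * (E x * K x * (E x)⁻¹ * (E x * K x * (E x)⁻¹))) := by
          rw [hsq, Matrix.mul_neg, Matrix.mul_one, neg_neg]
      _ = -(E x * K x * (E x)⁻¹) := by
          rw [← Matrix.mul_assoc, horth, Matrix.one_mul]
  · rw [hMF, hK.riemannM_comm h hx, hF]
    simp only [Matrix.mul_assoc, Matrix.nonsing_inv_mul_cancel_left _ _ hu]
  -- Since J commutes with the curvature R, tr(IJR) = tr(JIR); as JI = -IJ, this trace is zero.
  · have hJI : J x * I x = -K x := by
      have h1 : I x * (J x * I x) * (J x) = -1 := by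
        rw [← Matrix.mul_assoc, hIJ x hx, Matrix.mul_assoc, hIJ x hx, hK.sq x hx]
      calc J x * I x = I x * I x * (J x * I x) * (J x * J x) := by
            rw [hI.sq x hx, hJ.sq x hx]; simp
        _ = I x * (I x * (J x * I x) * J x) * J x := by noncomm_ring
        _ = -K x := by rw [h1, ← hIJ x hx]; simp
    rw [hMF, Matrix.trace_mul_comm, ← Matrix.mul_assoc, hE, Matrix.one_mul]
    have h1 : (I x * J x * riemannM g c d x).trace = (J x * I x * riemannM g c d x).trace := by
      rw [Matrix.mul_assoc, hJ.riemannM_comm h hx, ← Matrix.mul_assoc, Matrix.trace_mul_comm,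
        ← Matrix.mul_assoc]
    rw [hIJ x hx, hJI, Matrix.neg_mul, Matrix.trace_neg] at h1
    linarith

end Parallel

/-! ## Hyper-Kähler metrics are Ricci-flat -/

theorem exists_so4_of_transpose {M : Matrix (Fin 4) (Fin 4) ℝ} (hM : Mᵀ = -M) :
    ∃ u v, M = so4 u v := by
  refine ⟨![M 0 1 - M 2 3, M 0 2 + M 1 3, M 0 3 - M 1 2],
    ![M 0 1 + M 2 3, M 0 2 - M 1 3, M 0 3 + M 1 2], ?_⟩
  refine eq_of_antisymm hM (so4_transpose _ _) fun i j hij => ?_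
  rw [so4_eq]
  fin_cases i <;> fin_cases j <;> first | exact absurd hij (by decide) | skip
  all_goals (simp; ring)

theorem so4_eq_zero {u v : Fin 3 → ℝ} (h : so4 u v = 0) : u = 0 ∧ v = 0 := by
  rw [so4_eq] at h
  have h01 := congrFun (congrFun h 0) 1
  have h02 := congrFun (congrFun h 0) 2
  have h03 := congrFun (congrFun h 0) 3
  have h12 := congrFun (congrFun h 1) 2
  have h13 := congrFun (congrFun h 1) 3
  have h23 := congrFun (congrFun h 2) 3
  simp at h01 h02 h03 h12 h13 h23
  constructor <;> ext i <;> fin_cases i <;> simp <;> linarith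

theorem trace_so4_mul (u v u' v' : Fin 3 → ℝ) :
    (so4 u v * so4 u' v').trace = -(u ⬝ᵥ u' + v ⬝ᵥ v') := by
  simp only [so4_eq, Matrix.trace, Matrix.diag, Matrix.smul_apply,
    Matrix.mul_apply, Fin.sum_univ_four, dotProduct, Fin.sum_univ_three]
  simp
  ring

/-- An orthogonal complex structure is purely self-dual or purely anti-self-dual. -/
theorem eq_zero_or_eq_zero_of_so4_sq {u v : Fin 3 → ℝ} (h : so4 u v * so4 u v = -1) :
    u = 0 ∧ v ≠ 0 ∨ u ≠ 0 ∧ v = 0 := by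
  have hn : u ⬝ᵥ u + v ⬝ᵥ v = 4 := by
    have := trace_so4_mul u v u v
    rw [h, Matrix.trace_neg, Matrix.trace_one, Fintype.card_fin] at this
    push_cast at this
    linarith
  have huv : ∀ i j, u i * v j = 0 := by
    have e : ∀ i j : Fin 4, (so4 u v * so4 u v) i j = (-1 : Matrix (Fin 4) (Fin 4) ℝ) i j :=
      fun i j => by rw [h]
    simp only [so4_eq, Matrix.smul_apply, Matrix.mul_apply, Fin.sum_univ_four] at e
    have h00 := e 0 0
    have h11 := e 1 1
    have h22 := e 2 2
    have h33 := e 3 3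
    have h01 := e 0 1
    have h02 := e 0 2
    have h03 := e 0 3
    have h12 := e 1 2
    have h13 := e 1 3
    have h23 := e 2 3
    simp at h00 h11 h22 h33 h01 h02 h03 h12 h13 h23
    intro i j
    fin_cases i <;> fin_cases j <;> simp only [Fin.zero_eta, Fin.mk_one, Fin.reduceFinMk] <;>
      linarith
  by_cases hu : u = 0
  · refine Or.inl ⟨hu, fun hv => ?_⟩
    simp [hu, hv] at hn
  · obtain ⟨i, hi⟩ := Function.ne_iff.1 hu
    exact Or.inr ⟨hu, funext fun j => (mul_eq_zero.1 (huv i j)).resolve_left hi⟩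

/-- Lagrange's identity |u × a|² = |u|²|a|² - (u·a)². -/
theorem eq_zero_of_cross_eq_zero_of_dot_eq_zero {u a : Fin 3 → ℝ} (hu : u ≠ 0)
    (hc : u ⨯₃ a = 0) (hd : u ⬝ᵥ a = 0) : a = 0 := by
  have h := cross_dot_cross u a u a
  rw [hc, hd, dotProduct_comm a u, hd] at h
  simp only [zero_dotProduct, mul_zero, sub_zero] at h
  exact dotProduct_self_eq_zero.1 ((mul_eq_zero.1 h.symm).resolve_left
    fun h' => hu (dotProduct_self_eq_zero.1 h'))

/-- `M` lies in one half of 𝔰𝔬(4). In that half the curvature is parallel to `M` by commutation and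
orthogonal to it by the trace condition, hence zero. If this is the self-dual half, the Bianchi
identity carries the vanishing trace over to 2x + z. -/
theorem typeD_of_complexStructure {M : Matrix (Fin 4) (Fin 4) ℝ} (hM : Mᵀ = -M)
    (hM2 : M * M = -1) {x z y x' z' : ℝ} (hb : 2 * x + z = 2 * x' + z')
    (hc : ∀ k l, M * typeD x z y x' z' k l = typeD x z y x' z' k l * M)
    (ht : ∀ k l, (M * typeD x z y x' z' k l).trace = 0) : y = 0 ∧ 2 * x + z = 0 := by
  obtain ⟨u, v, rfl⟩ := exists_so4_of_transpose hM
  have hc' : ∀ k l, _ := fun k l => so4_eq_zero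
    ((so4_commutator _ _ _ _).symm.trans (sub_eq_zero.2 (hc k l)))
  have ht' : ∀ k l, _ := fun k l => (trace_so4_mul _ _ _ _).symm.trans (ht k l)
  rcases eq_zero_or_eq_zero_of_so4_sq hM2 with ⟨rfl, hv⟩ | ⟨hu, rfl⟩
  · have key := fun k l => eq_zero_of_cross_eq_zero_of_dot_eq_zero hv (neg_eq_zero.1 (hc' k l).2)
      (by rw [← neg_eq_zero, ← ht' k l, zero_dotProduct, zero_add])
    have h1 := congrFun (key 0 1) 0
    have h2 := congrFun (key 0 3) 2
    have h3 := congrFun (key 1 2) 2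
    simp [asd, sd] at h1 h2 h3
    constructor <;> linarith
  · have key := fun k l => eq_zero_of_cross_eq_zero_of_dot_eq_zero hu (hc' k l).1
      (by rw [← neg_eq_zero, ← ht' k l, zero_dotProduct, add_zero])
    have h1 := congrFun (key 0 1) 0
    have h2 := congrFun (key 0 3) 2
    have h3 := congrFun (key 1 2) 2
    simp [asd, sd] at h1 h2 h3
    constructor <;> linarith

theorem isRicciFlat_of_isHyperKahler {D : Set R4} (hD : IsOpen D) {P Q : ℝ → ℝ}
    (h : ∀ x ∈ D, IsGoodPoint P Q x) (hg : IsHyperKahler D (metric P Q)) :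
    IsRicciFlat D (metric P Q) := by
  intro x hx
  have hF := isCoframe hD h
  obtain ⟨M, hM, hM2, hMR⟩ := hg.exists_complexStructure hF hx
  have hx' := h x hx
  have hu := hF.isUnit_det hx
  have hc : ∀ k l, (LinearMap.mulLeft ℝ M - LinearMap.mulRight ℝ M) (IsGoodPoint.pdCurv P Q x k l) = 0 := by
    rw [← pull₂_eq_zero_iff hu]
    intro c d
    rw [← pull₂_map, ← hx'.curvForm_conn]
    exact sub_eq_zero.2 (hMR c d).1
  -- The trace is packaged as a scalar matrix so that `pull₂_map`, which takes matrix-valued linear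
  -- maps, applies.
  have ht : ∀ k l, (LinearMap.toSpanSingleton ℝ _ (1 : Matrix (Fin 4) (Fin 4) ℝ) ∘ₗ
      Matrix.traceLinearMap (Fin 4) ℝ ℝ ∘ₗ LinearMap.mulLeft ℝ M) (IsGoodPoint.pdCurv P Q x k l) = 0 := by
    rw [← pull₂_eq_zero_iff hu]
    intro c d
    rw [← pull₂_map, ← hx'.curvForm_conn]
    simp [(hMR c d).2]
  have ht' : ∀ k l, (M * IsGoodPoint.pdCurv P Q x k l).trace = 0 := fun k l => by
    simpa using ht k l
  have h0 := typeD_of_complexStructure hM hM2 hx'.bianchi (fun k l => sub_eq_zero.1 (hc k l)) ht'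
  intro a b
  simpa using (IsGoodPoint.einstein_iff h hD hx 0).2 h0 a b

/-! ## Complex structures from parallel anti-self-dual forms -/

theorem contDiffAt_det {ι : Type*} [Fintype ι] [DecidableEq ι] {A : R4 → Matrix ι ι ℝ} {x : R4}
    (hA : ∀ i j, ContDiffAt ℝ ∞ (fun y => A y i j) x) :
    ContDiffAt ℝ ∞ (fun y => (A y).det) x := by
  simp only [Matrix.det_apply']
  exact ContDiffAt.sum fun σ _ => contDiffAt_const.mul (contDiffAt_prod fun i _ => hA (σ i) i)

theorem contDiffAt_inv_apply {A : R4 → Matrix (Fin 4) (Fin 4) ℝ} {x : R4}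
    (hA : ∀ i j, ContDiffAt ℝ ∞ (fun y => A y i j) x) (h : (A x).det ≠ 0) (i j : Fin 4) :
    ContDiffAt ℝ ∞ (fun y => (A y)⁻¹ i j) x := by
  simp only [Matrix.inv_def, Matrix.smul_apply, smul_eq_mul, Ring.inverse_eq_inv',
    Matrix.adjugate_apply]
  refine ((contDiffAt_det hA).inv h).mul
    (contDiffAt_det (A := fun y => (A y).updateRow j (Pi.single i 1)) fun k l => ?_)
  by_cases hk : k = j
  · subst hk
    simp only [Matrix.updateRow_self]
    exact contDiffAt_const
  · simp only [Matrix.updateRow_ne hk]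
    exact hA k l

/-- Multiplication of imaginary quaternions; the factors 2 cancel the ½ in `so4`. -/
theorem asd_mul_asd (n m : Fin 3 → ℝ) :
    so4 ((2 : ℝ) • n) 0 * so4 ((2 : ℝ) • m) 0
      = so4 ((2 : ℝ) • (n ⨯₃ m)) 0 - (n ⬝ᵥ m) • (1 : Matrix (Fin 4) (Fin 4) ℝ) := by
  simp only [so4_eq, cross_apply, dotProduct, Fin.sum_univ_three]
  ext i j
  fin_cases i <;> fin_cases j <;>
    simp [Matrix.mul_apply, Fin.sum_univ_four] <;> ring

/-- The endomorphism field, in coordinates, of a field of anti-self-dual forms. -/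
def asdEnd (E : R4 → Matrix (Fin 4) (Fin 4) ℝ) (n : R4 → Fin 3 → ℝ) (y : R4) :
    Matrix (Fin 4) (Fin 4) ℝ :=
  (E y)⁻¹ * so4 ((2 : ℝ) • n y) 0 * E y

theorem asdEnd_mul {E : R4 → Matrix (Fin 4) (Fin 4) ℝ} {x : R4} (hE : IsUnit (E x).det)
    (n m : R4 → Fin 3 → ℝ) : asdEnd E n x * asdEnd E m x
      = asdEnd E (fun y => n y ⨯₃ m y) x - (n x ⬝ᵥ m x) • (1 : Matrix (Fin 4) (Fin 4) ℝ) := by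
  have h : asdEnd E n x * asdEnd E m x
      = (E x)⁻¹ * (so4 ((2 : ℝ) • n x) 0 * so4 ((2 : ℝ) • m x) 0) * E x := by
    simp only [asdEnd, Matrix.mul_assoc, Matrix.mul_nonsing_inv_cancel_left _ _ hE]
  rw [h, asd_mul_asd, Matrix.mul_sub, Matrix.sub_mul, asdEnd, Matrix.mul_smul, Matrix.smul_mul,
    Matrix.mul_one, Matrix.nonsing_inv_mul _ hE]

/-- `hpar` is the equation dn + η × n = 0. Only the anti-self-dual half η enters because the two
halves of 𝔰𝔬(4) commute, and conjugation by `E` carries parallelism to coordinates. -/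
theorem IsCoframe.isKahlerStructure {D : Set R4} {g : MetricField}
    {E : R4 → Matrix (Fin 4) (Fin 4) ℝ} {η ζ : Fin 3 → Fin 4 → R4 → ℝ}
    (h : IsCoframe D g E (spinConn η ζ))
    (hE : ∀ x ∈ D, ∀ i j, ContDiffAt ℝ ∞ (fun y => E y i j) x) {n : R4 → Fin 3 → ℝ}
    (hn : ∀ x ∈ D, ∀ i, ContDiffAt ℝ ∞ (fun y => n y i) x) (h1 : ∀ x ∈ D, n x ⬝ᵥ n x = 1)
    (hpar : ∀ x ∈ D, ∀ a i, pd a (fun y => n y i) x = (n x ⨯₃ fun i => η i a x) i) :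
    IsKahlerStructure D g (asdEnd E n) := by
  have hL : ∀ x ∈ D, ∀ i j, ContDiffAt ℝ ∞ (fun y => so4 ((2 : ℝ) • n y) 0 i j) x := by
    intro x hx i j
    simp only [so4, Matrix.smul_apply, Matrix.sum_apply, Matrix.add_apply, smul_eq_mul,
      Pi.smul_apply, Pi.zero_apply]
    exact contDiffAt_const.mul (ContDiffAt.sum fun k _ =>
      ((contDiffAt_const.mul (hn x hx k)).mul contDiffAt_const).add contDiffAt_const)
  have hsm : ∀ x ∈ D, ∀ i j, ContDiffAt ℝ ∞ (fun y => asdEnd E n y i j) x := by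
    intro x hx i j
    simp only [asdEnd, Matrix.mul_apply]
    exact ContDiffAt.sum fun k _ => (ContDiffAt.sum fun l _ => (contDiffAt_inv_apply (hE x hx)
      (h.det_pos x hx).ne' i l).mul (hL x hx l k)).mul (hE x hx k j)
  have hEJ : ∀ x ∈ D, E x * asdEnd E n x = so4 ((2 : ℝ) • n x) 0 * E x := fun x hx => by
    rw [asdEnd, Matrix.mul_assoc, Matrix.mul_nonsing_inv_cancel_left _ _ (h.isUnit_det hx)]
  have hzero : asdEnd E (fun _ => 0) = fun _ => 0 := by
    ext y : 1
    simp [asdEnd, so4]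
  refine ⟨fun a b x hx => (hsm x hx a b).contDiffWithinAt, fun x hx => ?_, fun x hx => ?_,
    fun x hx a b c => ?_⟩
  · rw [asdEnd_mul (h.isUnit_det hx), h1 x hx]
    simp only [cross_self, hzero, one_smul, zero_sub]
  · have h2 := asd_mul_asd (n x) (n x)
    rw [cross_self, h1 x hx, one_smul] at h2
    have h0 : so4 ((2 : ℝ) • (0 : Fin 3 → ℝ)) 0 = 0 := by simp [so4]
    rw [h0, zero_sub] at h2
    calc (asdEnd E n x)ᵀ * g x * asdEnd E n x
        = (E x * asdEnd E n x)ᵀ * (E x * asdEnd E n x) := by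
          rw [h.metric_eq x hx, Matrix.transpose_mul]; simp only [Matrix.mul_assoc]
      _ = (E x)ᵀ * -(so4 ((2 : ℝ) • n x) 0 * so4 ((2 : ℝ) • n x) 0) * E x := by
          rw [hEJ x hx, Matrix.transpose_mul, so4_transpose]; noncomm_ring
      _ = g x := by rw [h2, neg_neg, Matrix.mul_one, h.metric_eq x hx]
  · have hdJ : DiffM (asdEnd E n) x := fun i j => (hsm x hx i j).differentiableAt (by simp)
    have hdL : DiffM (fun y => so4 ((2 : ℝ) • n y) 0) x := fun i j =>
      (hL x hx i j).differentiableAt (by simp)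
    have hder : E x * pdM a (asdEnd E n) x + pdM a E x * asdEnd E n x
        = so4 ((2 : ℝ) • n x) 0 * pdM a E x + pdM a (fun y => so4 ((2 : ℝ) • n y) 0) x * E x := by
      rw [← pdM_mul (h.diffM hx) hdJ, ← pdM_mul hdL (h.diffM hx)]
      exact pdM_congr (Filter.eventually_of_mem (h.isOpen.mem_nhds hx) hEJ) a
    have hpdL : pdM a (fun y => so4 ((2 : ℝ) • n y) 0) x
        = so4 ((2 : ℝ) • n x) 0 * spinConn η ζ a x - spinConn η ζ a x * so4 ((2 : ℝ) • n x) 0 := by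
      have hdn : ∀ i, DifferentiableAt ℝ (fun y => n y i) x := fun i =>
        (hn x hx i).differentiableAt (by simp)
      -- The field of forms is treated as a connection form with identical components in all
      -- directions; the index 0 is a dummy.
      have h2 := pdM_spinConn (η := fun i _ y => 2 * n y i) (ζ := fun _ _ _ => 0) (x := x)
        (fun i _ => (hdn i).const_mul 2) (fun _ _ => differentiableAt_const _) a 0
      have h3 : spinConn (fun i _ y => 2 * n y i) (fun _ _ _ => 0) 0
          = fun y => so4 ((2 : ℝ) • n y) 0 := rfl
      have h4 : ∀ i, pd a (fun y => 2 * n y i) x = 2 * pd a (fun y => n y i) x := fun i => by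
        rw [pd_mul (differentiableAt_const _) (hdn i)]
        simp [pd]
      rw [← h3, h2, spinConn, so4_commutator]
      congr 1
      · ext i
        rw [h4, hpar x hx, map_smul, LinearMap.smul_apply]
        rfl
      · ext i
        simp [pd]
    have hp : pdM a E x = E x * christoffelM g a x - spinConn η ζ a x * E x := by
      rw [h.mul_christoffelM hx a]; abel
    have hfin : E x * (pdM a (asdEnd E n) x + (christoffelM g a x * asdEnd E n x
        - asdEnd E n x * christoffelM g a x)) = 0 := by
      rw [hp, hpdL] at hder
      have e := hEJ x hx
      calc _ = E x * pdM a (asdEnd E n) x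
            + (E x * christoffelM g a x - spinConn η ζ a x * E x) * asdEnd E n x
            + spinConn η ζ a x * (E x * asdEnd E n x)
            - (E x * asdEnd E n x) * christoffelM g a x := by noncomm_ring
        _ = 0 := by rw [hder, e]; noncomm_ring
    have hfin' := congrArg ((E x)⁻¹ * ·) hfin
    simp only [Matrix.mul_zero, Matrix.nonsing_inv_mul_cancel_left _ _ (h.isUnit_det hx)] at hfin'
    rw [covDerivEnd_eq, hfin']
    rfl

/-! ## Ricci-flat solutions are hyper-Kähler -/

namespace IsGoodPoint

variable {P Q : ℝ → ℝ} {x : R4}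

theorem contDiffAt_conn (h : IsGoodPoint P Q x) {ε : ℝ} (hε : ε = -1 ∨ ε = 1) {i : Fin 3}
    (hi : i ≠ 0) : ContDiffAt ℝ ∞ (conn P Q ε i 1) x := by
  have hp : ContDiffAt ℝ ∞ (fun y : R4 => y 2) x := by fun_prop
  have hq : ContDiffAt ℝ ∞ (fun y : R4 => y 3) x := by fun_prop
  have hP : ContDiffAt ℝ ∞ (fun y : R4 => P (y 2)) x := h.smooth_P.comp x hp
  have hQ : ContDiffAt ℝ ∞ (fun y : R4 => Q (y 3)) x := h.smooth_Q.comp x hq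
  have hP' : ContDiffAt ℝ ∞ (fun y : R4 => deriv P (y 2)) x :=
    ContDiffAt.comp (g := deriv P) x (contDiffAt_deriv h.smooth_P) hp
  have hQ' : ContDiffAt ℝ ∞ (fun y : R4 => deriv Q (y 3)) x :=
    ContDiffAt.comp (g := deriv Q) x (contDiffAt_deriv h.smooth_Q) hq
  have hs : ContDiffAt ℝ ∞ (fun y : R4 => (1 - y 2 * y 3) * (1 + y 2 * y 3)) x := by fun_prop
  have hm : ContDiffAt ℝ ∞ (fun y : R4 => mVal ε (y 2) (y 3)) x := by
    unfold mVal; fun_prop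
  have hmp : ContDiffAt ℝ ∞ (fun y : R4 => mVal_p ε (y 2) (y 3)) x := by
    unfold mVal_p; fun_prop
  have hmq : ContDiffAt ℝ ∞ (fun y : R4 => mVal_q ε (y 2) (y 3)) x := by
    unfold mVal_q; fun_prop
  have hw : ContDiffAt ℝ ∞ (wFun P Q) x := (hP.mul hQ).neg.sqrt h.neg_mul_pos.ne'
  have hm0 := h.mVal_ne hε
  have hvP : ContDiffAt ℝ ∞ (fun y : R4 => vP ε (y 2) (y 3) (P (y 2)) (deriv P (y 2))) x :=
    (hP'.div_const 2).sub ((hP.mul hmp).div hm hm0)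
  have hvQ : ContDiffAt ℝ ∞ (fun y : R4 => vQ ε (y 2) (y 3) (Q (y 3)) (deriv Q (y 3))) x :=
    (hQ'.div_const 2).sub ((hQ.mul hmq).div hm hm0)
  fin_cases i
  · exact absurd rfl hi
  · exact contDiffAt_const.mul (hw.div hm hm0)
  · exact (((hp.pow 2).mul hvQ).add (contDiffAt_const.mul hvP)).div hs h.s_ne

/-- The anti-self-dual half of the curvature vanishes at `x`. -/
def HalfFlat (P Q : ℝ → ℝ) (x : R4) : Prop :=
  curvX (-1) (x 2) (x 3) (P (x 2)) (deriv P (x 2)) (Q (x 3)) (deriv Q (x 3)) = 0 ∧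
  curvZ (-1) (x 2) (x 3) (P (x 2)) (deriv P (x 2)) (deriv (deriv P) (x 2)) (Q (x 3))
    (deriv Q (x 3)) (deriv (deriv Q) (x 3)) = 0 ∧
  curvY (x 2) (x 3) (P (x 2)) (deriv P (x 2)) (deriv (deriv P) (x 2)) (Q (x 3))
    (deriv Q (x 3)) (deriv (deriv Q) (x 3)) = 0

theorem conn_one_zero (P Q : ℝ → ℝ) (x : R4) : conn P Q (-1) 1 0 x = -conn P Q (-1) 1 1 x := by
  simp [conn, connVal]

/-- This is the equation X = 0 with denominators removed. With `conn_one_zero`, the dτ- and dφ-parts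
of the connection combine into a multiple of dφ - dτ. -/
theorem conn_two_zero (h : IsGoodPoint P Q x) (hf : HalfFlat P Q x) :
    conn P Q (-1) 2 0 x = -conn P Q (-1) 2 1 x := by
  have h1 := h.minus_pos.ne'
  have h2 := h.plus_pos.ne'
  have h3 := h.sub_ne
  have hX := hf.1
  have h4 : 1 + -(x 2 * x 3) ≠ 0 := by rwa [← sub_eq_add_neg]
  simp only [curvX, neg_one_mul, mul_eq_zero, div_eq_zero_iff, h1, h2, h3, h4, false_or,
    or_false] at hX
  rw [eq_neg_iff_add_eq_zero]
  simp only [conn, connVal, Matrix.cons_val, Matrix.cons_val_zero, Matrix.cons_val_one]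
  rw [← add_div, div_eq_zero_iff]
  left
  linear_combination -hX

/-- The dφ∧dp and dφ∧dq components of vanishing curvature: the dφ-component of the connection is
itself rotated by the remaining 1-form `conn P Q (-1) 0`. -/
theorem hasPQ_conn (h : IsGoodPoint P Q x) (hf : HalfFlat P Q x) :
    HasPQ (conn P Q (-1) 1 1) (conn P Q (-1) 2 1 x * conn P Q (-1) 0 2 x)
        (conn P Q (-1) 2 1 x * conn P Q (-1) 0 3 x) x ∧
      HasPQ (conn P Q (-1) 2 1) (-(conn P Q (-1) 1 1 x * conn P Q (-1) 0 2 x))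
        (-(conn P Q (-1) 1 1 x * conn P Q (-1) 0 3 x)) x := by
  have key : ∀ d i, 1 < d → spinCurvVal (-1) (x 2) (x 3) (P (x 2)) (deriv P (x 2))
      (deriv (deriv P) (x 2)) (Q (x 3)) (deriv Q (x 3)) (deriv (deriv Q) (x 3)) (wFun P Q x)
      1 d i = 0 := by
    intro d i hd
    rw [spinCurvVal_asd h.minus_pos.ne' h.plus_pos.ne' h.sub_ne h.P_pos.ne' h.w_pos.ne' h.Q_eq
      h.c_sq 1 d hd, hf.1, hf.2.1, hf.2.2]
    fin_cases i <;> simp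
  have e1 := key 2 1 (by decide)
  have e2 := key 2 2 (by decide)
  have e3 := key 3 1 (by decide)
  have e4 := key 3 2 (by decide)
  simp only [spinCurvVal, cross_apply, Matrix.cons_val, Matrix.cons_val_zero,
    Matrix.cons_val_one, neg_neg, one_mul, Pi.zero_apply, zero_sub] at e1 e2 e3 e4
  have z : ∀ i a, connVal (-1) (x 2) (x 3) (P (x 2)) (deriv P (x 2)) (Q (x 3)) (deriv Q (x 3))
      (wFun P Q x) i a = conn P Q (-1) i a x := fun _ _ => rfl
  have z1 : conn P Q (-1) 0 1 x = 0 := rfl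
  have z2 : conn P Q (-1) 1 2 x = 0 := rfl
  have z3 : conn P Q (-1) 1 3 x = 0 := rfl
  have z4 : conn P Q (-1) 2 2 x = 0 := rfl
  have z5 : conn P Q (-1) 2 3 x = 0 := rfl
  simp only [z, z1, z2, z3, z4, z5, mul_zero, sub_zero, zero_sub] at e1 e2 e3 e4
  exact ⟨(h.hconn (Or.inl rfl) 1 1).congr (by linarith) (by linarith),
    (h.hconn (Or.inl rfl) 2 1).congr (by linarith) (by linarith)⟩

end IsGoodPoint

/-! ### Global parallel anti-self-dual forms -/

section Sections

variable {D : Set R4} {P Q : ℝ → ℝ} {x : R4}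

open IsGoodPoint

/-- The length of the `dφ`-component of the anti-self-dual connection is constant. -/
theorem exists_conn_sq_eq (hD : IsOpen D) (hD' : IsConnected D)
    (h : ∀ x ∈ D, IsGoodPoint P Q x) (hf : ∀ x ∈ D, HalfFlat P Q x) :
    ∃ k : ℝ, 0 < k ∧ ∀ x ∈ D, conn P Q (-1) 1 1 x ^ 2 + conn P Q (-1) 2 1 x ^ 2 = k ^ 2 := by
  have hder : ∀ x ∈ D, HasPQ (fun y => conn P Q (-1) 1 1 y ^ 2 + conn P Q (-1) 2 1 y ^ 2) 0 0 x :=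
    fun x hx => by
      obtain ⟨h1, h2⟩ := (h x hx).hasPQ_conn (hf x hx)
      refine ((h1.pow 2).add (h2.pow 2)).congr ?_ ?_ <;> push_cast <;> ring
  obtain ⟨c, hc⟩ := hD.exists_is_const_of_fderiv_eq_zero (𝕜 := ℝ) hD'.isPreconnected
    (fun x hx => (HasFDerivAt.differentiableAt (hder x hx)).differentiableWithinAt)
    (fun x hx => by
      rw [HasFDerivAt.fderiv (hder x hx)]
      simp)
  obtain ⟨x, hx⟩ := hD'.nonempty
  -- This component is w/m with w > 0, which ensures k > 0 and permits normalization.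
  have hV : conn P Q (-1) 1 1 x ≠ 0 := by
    have : conn P Q (-1) 1 1 x = wFun P Q x / mVal (-1) (x 2) (x 3) := by simp [conn, connVal]
    rw [this]
    exact div_ne_zero (h x hx).w_pos.ne' ((h x hx).mVal_ne (Or.inl rfl))
  have hc0 : 0 < c := by
    rw [← hc x hx]
    positivity
  exact ⟨√c, Real.sqrt_pos.2 hc0, fun y hy => by rw [Real.sq_sqrt hc0.le, hc y hy]⟩

/-- The parallel anti-self-dual form in the direction of the `dφ`-component of the connection. -/
def axisSection (P Q : ℝ → ℝ) (k : ℝ) (y : R4) : Fin 3 → ℝ :=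
  ![0, conn P Q (-1) 1 1 y / k, conn P Q (-1) 2 1 y / k]

/-- The parallel anti-self-dual forms orthogonal to `axisSection`, with phase `δ`. -/
def phaseSection (P Q : ℝ → ℝ) (k δ : ℝ) (y : R4) : Fin 3 → ℝ :=
  ![Real.cos (k * (y 1 - y 0) + δ),
    Real.sin (k * (y 1 - y 0) + δ) * -(conn P Q (-1) 2 1 y / k),
    Real.sin (k * (y 1 - y 0) + δ) * (conn P Q (-1) 1 1 y / k)]

theorem pd_phase (k δ : ℝ) (a : Fin 4) (x : R4) :
    pd a (fun y => k * (y 1 - y 0) + δ) x = (![-k, k, 0, 0] : Fin 4 → ℝ) a := by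
  have h : HasFDerivAt (fun y : R4 => k * (y 1 - y 0) + δ)
      (k • ((ContinuousLinearMap.proj 1 : R4 →L[ℝ] ℝ) - ContinuousLinearMap.proj 0)) x :=
    ((((ContinuousLinearMap.proj 1 : R4 →L[ℝ] ℝ).hasFDerivAt).sub
      ((ContinuousLinearMap.proj 0 : R4 →L[ℝ] ℝ).hasFDerivAt)).const_mul k).add_const δ
  rw [pd, h.fderiv]
  fin_cases a <;> simp

theorem pd_comp {φ : ℝ → ℝ} {φ' : ℝ} {f : R4 → ℝ} (hφ : HasDerivAt φ φ' (f x))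
    (hf : DifferentiableAt ℝ f x) (a : Fin 4) : pd a (fun y => φ (f y)) x = φ' * pd a f x := by
  have h : HasFDerivAt (fun y => φ (f y)) (φ' • fderiv ℝ f x) x :=
    hφ.comp_hasFDerivAt x hf.hasFDerivAt
  rw [pd, h.fderiv]
  rfl

variable {k : ℝ}

theorem axisSection_dot (hk : 0 < k)
    (h : conn P Q (-1) 1 1 x ^ 2 + conn P Q (-1) 2 1 x ^ 2 = k ^ 2) :
    axisSection P Q k x ⬝ᵥ axisSection P Q k x = 1 := by
  simp [axisSection, dotProduct, Fin.sum_univ_three]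
  field_simp
  exact h

theorem phaseSection_dot (hk : 0 < k)
    (h : conn P Q (-1) 1 1 x ^ 2 + conn P Q (-1) 2 1 x ^ 2 = k ^ 2) (δ : ℝ) :
    phaseSection P Q k δ x ⬝ᵥ phaseSection P Q k δ x = 1 := by
  have h1 := axisSection_dot hk h
  simp only [axisSection, phaseSection, dotProduct, Fin.sum_univ_three, Matrix.cons_val,
    Matrix.cons_val_zero, Matrix.cons_val_one] at h1 ⊢
  linear_combination Real.sin (k * (x 1 - x 0) + δ) ^ 2 * h1
    + Real.sin_sq_add_cos_sq (k * (x 1 - x 0) + δ)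

theorem axisSection_dot_phaseSection (δ : ℝ) :
    axisSection P Q k x ⬝ᵥ phaseSection P Q k δ x = 0 := by
  simp only [axisSection, phaseSection, dotProduct, Fin.sum_univ_three, Matrix.cons_val,
    Matrix.cons_val_zero, Matrix.cons_val_one]
  ring

theorem axisSection_cross_phaseSection (hk : 0 < k)
    (h : conn P Q (-1) 1 1 x ^ 2 + conn P Q (-1) 2 1 x ^ 2 = k ^ 2) :
    axisSection P Q k x ⨯₃ phaseSection P Q k 0 x = phaseSection P Q k (-(Real.pi / 2)) x := by
  have h1 := axisSection_dot hk h
  simp only [axisSection, dotProduct, Fin.sum_univ_three, Matrix.cons_val,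
    Matrix.cons_val_zero, Matrix.cons_val_one] at h1
  simp only [axisSection, phaseSection, cross_apply, ← sub_eq_add_neg, Real.cos_sub_pi_div_two,
    Real.sin_sub_pi_div_two, add_zero]
  ext i
  fin_cases i <;> simp
  · linear_combination Real.sin (k * (x 1 - x 0)) * h1
  · ring
  · ring

theorem contDiffAt_axisSection (h : IsGoodPoint P Q x) (i : Fin 3) :
    ContDiffAt ℝ ∞ (fun y => axisSection P Q k y i) x := by
  fin_cases i
  · exact contDiffAt_const
  · exact (h.contDiffAt_conn (Or.inl rfl) (by decide)).div_const k
  · exact (h.contDiffAt_conn (Or.inl rfl) (by decide)).div_const k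

theorem contDiffAt_phaseSection (h : IsGoodPoint P Q x) (δ : ℝ) (i : Fin 3) :
    ContDiffAt ℝ ∞ (fun y => phaseSection P Q k δ y i) x := by
  have hθ : ContDiffAt ℝ ∞ (fun y : R4 => k * (y 1 - y 0) + δ) x := by fun_prop
  fin_cases i
  · exact hθ.cos
  · exact hθ.sin.mul ((h.contDiffAt_conn (Or.inl rfl) (by decide)).div_const k).neg
  · exact hθ.sin.mul ((h.contDiffAt_conn (Or.inl rfl) (by decide)).div_const k)

theorem pd_axisSection (h : IsGoodPoint P Q x) (hf : HalfFlat P Q x) (a : Fin 4) (i : Fin 3) :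
    pd a (fun y => axisSection P Q k y i) x
      = (axisSection P Q k x ⨯₃ fun i => conn P Q (-1) i a x) i := by
  obtain ⟨hV, hU⟩ := h.hasPQ_conn hf
  have h10 := conn_one_zero P Q x
  have h20 := h.conn_two_zero hf
  have hV' := (hV.mul (HasPQ.const k⁻¹)).pd a
  have hU' := (hU.mul (HasPQ.const k⁻¹)).pd a
  have h0 := (HasPQ.const (x := x) 0).pd a
  have z1 : conn P Q (-1) 0 1 x = 0 := rfl
  have z2 : conn P Q (-1) 1 2 x = 0 := rfl
  have z3 : conn P Q (-1) 1 3 x = 0 := rfl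
  have z4 : conn P Q (-1) 2 2 x = 0 := rfl
  have z5 : conn P Q (-1) 2 3 x = 0 := rfl
  have z6 : conn P Q (-1) 0 0 x = 0 := rfl
  simp only [cross_apply, axisSection, div_eq_mul_inv]
  fin_cases i
  · refine h0.trans ?_
    fin_cases a <;> simp [h10, h20, z2, z3, z4, z5] <;> ring
  · refine hV'.trans ?_
    fin_cases a <;> simp [z1, z6] <;> ring
  · refine hU'.trans ?_
    fin_cases a <;> simp [z1, z6] <;> ring

/-- Along dφ - dτ the connection is k times the unit axis, so the plane orthogonal to the axis turns
through k(φ - τ); the dp- and dq-derivatives come from `hasPQ_conn`. -/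
theorem pd_phaseSection (hk : 0 < k)
    (hk2 : conn P Q (-1) 1 1 x ^ 2 + conn P Q (-1) 2 1 x ^ 2 = k ^ 2) (h : IsGoodPoint P Q x)
    (hf : HalfFlat P Q x) (δ : ℝ) (a : Fin 4) (i : Fin 3) :
    pd a (fun y => phaseSection P Q k δ y i) x
      = (phaseSection P Q k δ x ⨯₃ fun i => conn P Q (-1) i a x) i := by
  obtain ⟨hV, hU⟩ := h.hasPQ_conn hf
  have h10 := conn_one_zero P Q x
  have h20 := h.conn_two_zero hf
  have hVk := hV.mul (HasPQ.const k⁻¹)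
  have hUk := hU.mul (HasPQ.const k⁻¹)
  have hV' := hVk.pd a
  have hθ : DifferentiableAt ℝ (fun y : R4 => k * (y 1 - y 0) + δ) x := by fun_prop
  have hc := (pd_comp (Real.hasDerivAt_cos _) hθ a).trans (by rw [pd_phase])
  have hs := (pd_comp (Real.hasDerivAt_sin _) hθ a).trans (by rw [pd_phase])
  have hsV := pd_mul hθ.sin (HasFDerivAt.differentiableAt hVk) a
  have hsU := pd_mul hθ.sin (HasFDerivAt.differentiableAt hUk.neg) a
  have hnU := hUk.neg.pd a
  rw [hs, hV'] at hsV
  rw [hs, hnU] at hsU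
  have z1 : conn P Q (-1) 0 1 x = 0 := rfl
  have z2 : conn P Q (-1) 1 2 x = 0 := rfl
  have z3 : conn P Q (-1) 1 3 x = 0 := rfl
  have z4 : conn P Q (-1) 2 2 x = 0 := rfl
  have z5 : conn P Q (-1) 2 3 x = 0 := rfl
  have z6 : conn P Q (-1) 0 0 x = 0 := rfl
  have hk' : k * k⁻¹ = 1 := mul_inv_cancel₀ hk.ne'
  have hk3 : (conn P Q (-1) 1 1 x ^ 2 + conn P Q (-1) 2 1 x ^ 2) * k⁻¹ = k := by
    rw [hk2, pow_two, mul_assoc, hk', mul_one]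
  simp only [cross_apply, phaseSection, div_eq_mul_inv]
  generalize Real.cos (k * (x 1 - x 0) + δ) = C at *
  generalize Real.sin (k * (x 1 - x 0) + δ) = S at *
  generalize hV0 : conn P Q (-1) 1 1 x = V at *
  generalize hU0 : conn P Q (-1) 2 1 x = U at *
  fin_cases i
  · refine hc.trans ?_
    fin_cases a <;> simp [h10, h20, z2, z3, z4, z5, hV0, hU0]
    · linear_combination -S * hk3
    · linear_combination S * hk3
  · refine hsU.trans ?_
    fin_cases a <;> simp [h20, hU0, z1, z4, z5, z6]
    · linear_combination C * U * hk'
    · linear_combination C * U * hk'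
    · ring
    · ring
  · refine hsV.trans ?_
    fin_cases a <;> simp [h10, hV0, z1, z2, z3, z6]
    · linear_combination C * V * hk'
    · linear_combination C * V * hk'
    · ring
    · ring

/-- The axis and the phases 0 and -π/2 form an orthonormal triple of parallel sections, with the
third the cross product of the first two; `asdEnd_mul` turns this into IJ = K. -/
theorem isHyperKahler_of_halfFlat (hD : IsOpen D) (hD' : IsConnected D)
    (h : ∀ x ∈ D, IsGoodPoint P Q x) (hf : ∀ x ∈ D, HalfFlat P Q x) :
    IsHyperKahler D (metric P Q) := by
  obtain ⟨k, hk, hk2⟩ := exists_conn_sq_eq hD hD' h hf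
  have hF := isCoframe hD h
  have hE := fun x hx => (h x hx).contDiffAt_frame
  have hphase : ∀ δ, IsKahlerStructure D (metric P Q)
      (asdEnd (frame P Q) (phaseSection P Q k δ)) := fun δ =>
    hF.isKahlerStructure hE (fun x hx => contDiffAt_phaseSection (h x hx) δ)
      (fun x hx => phaseSection_dot hk (hk2 x hx) δ)
      (fun x hx => pd_phaseSection hk (hk2 x hx) (h x hx) (hf x hx) δ)
  refine ⟨asdEnd (frame P Q) (axisSection P Q k), asdEnd (frame P Q) (phaseSection P Q k 0),
    asdEnd (frame P Q) (phaseSection P Q k (-(Real.pi / 2))), ?_, hphase _, hphase _,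
    fun x hx => ?_⟩
  · exact hF.isKahlerStructure hE (fun x hx => contDiffAt_axisSection (h x hx))
      (fun x hx => axisSection_dot hk (hk2 x hx)) (fun x hx => pd_axisSection (h x hx) (hf x hx))
  · rw [asdEnd_mul (hF.isUnit_det hx), axisSection_dot_phaseSection, zero_smul, sub_zero, asdEnd,
      asdEnd, axisSection_cross_phaseSection hk (hk2 x hx)]

end Sections

theorem isHyperKahler_quartic_iff {D : Set R4} {P Q : ℝ → ℝ} {a : Fin 5 → ℝ}
    (hD : IsChartDomain D) (hA : IsAdmissible D P Q) (hq : IsQuarticPair D P Q a) :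
    IsHyperKahler D (metric P Q) ↔ a 1 = a 3 ∧ a 0 = a 4 := by
  have hg := hD.isGoodPoint hA
  constructor
  · exact fun h => (isRicciFlat_quartic_iff hD hA hq).1
      (isRicciFlat_of_isHyperKahler hD.isOpen hg h)
  · rintro ⟨h13, h04⟩
    refine isHyperKahler_of_halfFlat hD.isOpen hD.isConnected hg fun x hx => ?_
    have h1 := (hg x hx).minus_pos.ne'
    have h2 := (hg x hx).plus_pos.ne'
    have h3 := (hg x hx).sub_ne
    refine ⟨?_, ?_, ?_⟩
    · rw [hq.eq_onQuartic hD.isOpen hx (fun P P₁ _ Q Q₁ _ => curvX (-1) (x 2) (x 3) P P₁ Q Q₁),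
        curvX_quartic h1 h2 h3, h13, h04]
      simp
    · rw [hq.eq_onQuartic hD.isOpen hx (curvZ (-1) (x 2) (x 3)), curvZ_quartic h1 h2 h3, h13, h04]
      simp
    · rw [hq.eq_onQuartic hD.isOpen hx (curvY (x 2) (x 3)), curvY_quartic h1 h2 h3, h13]
      simp

end PD

end

theorem mainTheorem4 (D : Set PD.R4) (hD : PD.IsChartDomain D) :
    (∀ P Q : ℝ → ℝ, PD.IsAdmissible D P Q →
      (PD.IsConformallySelfDual D (PD.metric P Q) ↔
        ∃ a : Fin 5 → ℝ, PD.IsQuarticPair D P Q a)) ∧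
    (∀ (P Q : ℝ → ℝ) (a : Fin 5 → ℝ), PD.IsAdmissible D P Q → PD.IsQuarticPair D P Q a →
      (PD.IsEinstein D (PD.metric P Q) ↔ a 1 = a 3) ∧
      (PD.IsQuaternionicKahler D (PD.metric P Q) ↔ a 1 = a 3) ∧
      (PD.IsRicciFlat D (PD.metric P Q) ↔ a 1 = a 3 ∧ a 0 = a 4) ∧
      (PD.IsHyperKahler D (PD.metric P Q) ↔ a 1 = a 3 ∧ a 0 = a 4) ∧
      (PD.IsFlat D (PD.metric P Q) ↔ a 1 = 0 ∧ a 3 = 0 ∧ a 0 = a 4)) ∧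
    (∀ x ∈ D, IsOpen (PD.paramsAt x) ∧ (PD.paramsAt x).Nonempty ∧
      IsNowhereDense (PD.einsteinParamsAt x)) := by
  exact ⟨fun P Q hA => ⟨PD.exists_quarticPair_of_selfDual hD hA,
      fun ⟨_, hq⟩ => PD.selfDual_of_quartic hD hA hq⟩,
    fun P Q a hA hq => ⟨PD.isEinstein_quartic_iff hD hA hq,
      PD.isQuaternionicKahler_quartic_iff hD hA hq, PD.isRicciFlat_quartic_iff hD hA hq,
      PD.isHyperKahler_quartic_iff hD hA hq, PD.isFlat_quartic_iff hD hA hq⟩,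
    fun x hx => ⟨PD.isOpen_paramsAt x, PD.paramsAt_nonempty (hD.pos x hx),
      PD.isNowhereDense_einsteinParamsAt hD hx⟩⟩
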